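/- Let $M$ be a compact (Hausdorff, without boundary) complex manifold and let $\omega$ be a real-analytic Kähler form on $M$, i.e. a closed, strictly positive, real-analytic real $(1,1)$-form; let $d$ be the distance of the Riemannian metric $g(v,w)=\omega(v,Jw)$. If $u$ is a real-analytic local Kähler potential of $\omega$ on an open set $U\subseteq M$ ($\omega=i\partial\bar\partial u$ on $U$), a polarization of $u$ is a function $u_{\mathbb C}(p,q)$ on a connected open set $W\subseteq U\times U$ containing the diagonal of $U$ which is holomorphic in $p$, antiholomorphic in $q$ (and jointly real-analytic), with $u_{\mathbb C}(p,p)=u(p)$. Its diastasis is $D_u(p,q)=u(p)+u(q)-2\operatorname{Re}u_{\mathbb C}(p,q)$. A diastasis neighbourhood of $\omega$ is a pair $(V_\omega,D_\omega)$, where $V_\omega\subseteq M\times M$ is an open neighbourhood of the diagonal and $D_\omega:V_\omega\to\mathbb R$ is a function such that every point of $V_\omega$ lies in such a $W$ with $D_\omega=D_u$ on $V_\omega\cap W$, and such that, for some $C>0$, $D_\omega(p,q)\ge C\,d(p,q)^2$ for all $(p,q)\in V_\omega$. Given such a pair, the complex Legendre transform of $\psi:M\to\mathbb R\cup\{\infty\}$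 is $$L_\omega(\psi)(q)=\Big(\operatorname{usc}\sup_{p:(p,\cdot)\in V_\omega}\big[-D_\omega(p,\cdot)-\psi(p)\big]\Big)(q),$$ where $\operatorname{usc}f(x)=\lim_{\delta\to0}\sup_{d(y,x)<\delta}f(y)$. Let $\|\cdot\|_{C^k(M)}$ be the $C^k$ norm defined by a fixed finite family of coordinate charts together with compact subsets of their domains that cover $M$. Theorem 5.1. A diastasis neighbourhood $(V_\omega,D_\omega)$ of $\omega$ exists. For every such neighbourhood (and every choice of the norms) there is $\varepsilon>0$ such that for every real function $\eta\in C^2(M)$ with $\|\eta\|_{C^2(M)}<\varepsilon$ and every $q\in M$, the supremum of $-D_\omega(p,q)-\eta(p)$ over all $p$ with $(p,q)\in V_\omega$ is attained at a unique point $p=G(\eta)(q)$, and it equals $L_\omega(\eta)(q)$. Moreover, for every such $\eta$ and every integer $k\ge2$: 1. If $\eta$ is of class $C^k$, then $G(\eta)$ is a diffeomorphism of $M$ of class $C^{k-1}$. 2. If $\eta$ is of class $C^k$, then $L_\omega(\eta)$ is of class $C^k$; and the map $\eta\mapsto L_\omega(\eta)$, on the set of $\eta\in C^k(M)$ with $\|\eta\|_{C^2(M)}<\varepsilon$,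 is continuous for the $C^k$-topology. 3. $L_\omega^2(\eta)=\eta$. 4. For every $q$, the supremum defining $L_\omega(L_\omega(\eta))(q)$ is also attained at a unique point $G(L_\omega(\eta))(q)$, and $G(L_\omega(\eta))=G(\eta)^{-1}$. -/

import Mathlib

open scoped Manifold ContDiff Topology ENNReal

noncomputable section

namespace CalabiLegendre

variable {E : Type*} [NormedAddCommGroup E] [NormedSpace ℂ E]

/-- The form `i ∂∂̄ f` at `x`, for a real function `f` on a complex vector space, evaluated on two
real tangent vectors: `(i ∂∂̄ f)(v, w) = (D²f(i v, w) - D²f(v, i w)) / 2`. For `f = |z|²` on `ℂ`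
this is `i dz ∧ dz̄ = 2 dx ∧ dy`. -/
def iddbar (f : E → ℝ) (x v w : E) : ℝ :=
  (fderiv ℝ (fderiv ℝ f) x (Complex.I • v) w - fderiv ℝ (fderiv ℝ f) x v (Complex.I • w)) / 2

section Manifold

variable {M : Type*} [TopologicalSpace M] [ChartedSpace E M]

/-- The complex structure `J` of the tangent space at `p`. Mathlib's tangent space at `p` is the
model space `E`, identified through the (holomorphic) preferred chart at `p`, so `J` is
multiplication by `i`. -/
def tangentJ (p : M) : TangentSpace 𝓘(ℝ, E) p → TangentSpace 𝓘(ℝ, E) p :=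
  fun v => (Complex.I • (show E from v) : E)

/-- The expression of a 2-form on `M` in the preferred chart at `c`: the pullback of the form under
the inverse of the chart. It is meaningful on the target of the chart. -/
def formInChart (θ : ∀ p : M, (TangentSpace 𝓘(ℝ, E) p) [⋀^Fin 2]→L[ℝ] ℝ) (c : M) :
    E → E [⋀^Fin 2]→L[ℝ] ℝ :=
  fun x => (θ ((chartAt E c).symm x)).compContinuousLinearMap
    (mfderiv 𝓘(ℝ, E) 𝓘(ℝ, E) (chartAt E c).symm x)

end Manifold

/-- A real-analytic Kähler form on a complex manifold `M` modelled on `E`: a closed, strictly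
positive, real-analytic real `(1,1)`-form. -/
structure KahlerForm (E : Type*) [NormedAddCommGroup E] [NormedSpace ℂ E]
    (M : Type*) [TopologicalSpace M] [ChartedSpace E M] where
  /-- the underlying real 2-form -/
  form : ∀ p : M, (TangentSpace 𝓘(ℝ, E) p) [⋀^Fin 2]→L[ℝ] ℝ
  /-- the form is real-analytic -/
  analytic : ∀ c : M, AnalyticOnNhd ℝ (formInChart form c) (chartAt E c).target
  /-- the form is closed -/
  closed : ∀ c : M, ∀ x ∈ (chartAt E c).target, extDeriv (formInChart form c) x = 0
  /-- the form is of type `(1,1)` -/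
  type_one_one : ∀ (p : M) (v w : TangentSpace 𝓘(ℝ, E) p),
    form p ![tangentJ p v, tangentJ p w] = form p ![v, w]
  /-- the form is strictly positive -/
  pos : ∀ (p : M) (v : TangentSpace 𝓘(ℝ, E) p), v ≠ 0 → 0 < form p ![v, tangentJ p v]

variable {M : Type*} [TopologicalSpace M] [ChartedSpace E M]

namespace KahlerForm

variable (κ : KahlerForm E M)

/-- The Riemannian distance of the Kähler metric `g(v, w) = κ(v, J w)` (infimum of the lengths of
`C¹` paths), with value `∞` for points in different components. -/
def edist (p q : M) : ℝ≥0∞ :=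
  letI : ∀ x : M, ENorm (TangentSpace 𝓘(ℝ, E) x) :=
    fun x => ⟨fun v => ENNReal.ofReal (Real.sqrt (κ.form x ![v, tangentJ x v]))⟩
  Manifold.riemannianEDist 𝓘(ℝ, E) p q

/-- `u` is a real-analytic local Kähler potential of `κ` on the open set `U` (`κ = i ∂∂̄ u`), and
`uC` is its polarization on the connected open neighbourhood `W` of the diagonal of `U`: the
function that is holomorphic in the first variable, antiholomorphic in the second one, and equal
to `u` on the diagonal. -/
structure IsPolarizedPotential (U : Set M) (W : Set (M × M)) (u : M → ℝ) (uC : M × M → ℂ) :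
    Prop where
  isOpen_U : IsOpen U
  isOpen_W : IsOpen W
  isPreconnected_W : IsPreconnected W
  W_subset : W ⊆ U ×ˢ U
  diag_subset : ∀ p ∈ U, (p, p) ∈ W
  analytic : ContMDiffOn 𝓘(ℝ, E) 𝓘(ℝ, ℝ) ω u U
  potential : ∀ p ∈ U, ∀ v w : TangentSpace 𝓘(ℝ, E) p,
    κ.form p ![v, w] = iddbar (u ∘ (chartAt E p).symm) (chartAt E p p) v w
  polarization_analytic : ContMDiffOn (𝓘(ℝ, E).prod 𝓘(ℝ, E)) 𝓘(ℝ, ℂ) ω uC W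
  holomorphic : ∀ q : M,
    MDifferentiableOn 𝓘(ℂ, E) 𝓘(ℂ, ℂ) (fun p => uC (p, q)) {p | (p, q) ∈ W}
  antiholomorphic : ∀ p : M,
    MDifferentiableOn 𝓘(ℂ, E) 𝓘(ℂ, ℂ) (fun q => (starRingEnd ℂ) (uC (p, q))) {q | (p, q) ∈ W}
  diag : ∀ p ∈ U, uC (p, p) = (u p : ℂ)

end KahlerForm

/-- The diastasis `D_u(p, q) = u(p) + u(q) - 2 Re u_ℂ(p, q)` of a polarized potential. -/
def diastasis (u : M → ℝ) (uC : M × M → ℂ) (x : M × M) : ℝ :=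
  u x.1 + u x.2 - 2 * (uC x).re

/-- `V` is an open neighbourhood of the diagonal on which the Calabi diastasis `D` of `κ` is
defined (`D` is given locally by the diastasis of polarized local potentials) and satisfies
Calabi's lower bound `D(p, q) ≥ C d(p, q)²`. The values of `D` off `V` are irrelevant. -/
structure KahlerForm.IsDiastasisNhd (κ : KahlerForm E M) (V : Set (M × M)) (D : M × M → ℝ) :
    Prop where
  isOpen : IsOpen V
  diag_subset : ∀ p : M, (p, p) ∈ V
  eq_local : ∀ x ∈ V, ∃ (U : Set M) (W : Set (M × M)) (u : M → ℝ) (uC : M × M → ℂ),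
    κ.IsPolarizedPotential U W u uC ∧ x ∈ W ∧ ∀ y ∈ V ∩ W, D y = diastasis u uC y
  lower_bound : ∃ C : ℝ, 0 < C ∧ ∀ x ∈ V,
    ENNReal.ofReal C * κ.edist x.1 x.2 ^ 2 ≤ ENNReal.ofReal (D x)

/-- The function `p ↦ -D(p, q) - ψ(p)` whose supremum defines the Legendre transform of `ψ`
at `q`. -/
def legendreArg (D : M × M → ℝ) (ψ : M → EReal) (q p : M) : EReal :=
  ((-D (p, q) : ℝ) : EReal) - ψ p

/-- The complex Legendre transform of `ψ : M → ℝ ∪ {∞}`: the upper semicontinuous regularization of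
`q ↦ sup {-D(p, q) - ψ(p) : (p, q) ∈ V}`. -/
def legendre (V : Set (M × M)) (D : M × M → ℝ) (ψ : M → EReal) (q : M) : EReal :=
  Filter.limsup (fun q' => ⨆ p ∈ {p : M | (p, q') ∈ V}, legendreArg D ψ q' p) (𝓝 q)

/-- The supremum of `-D(p, q) - ψ(p)` over the `p` with `(p, q) ∈ V` is attained at `z` and at no
other point. -/
def IsUniqueMaximizer (V : Set (M × M)) (D : M × M → ℝ) (ψ : M → EReal) (q z : M) : Prop :=
  (z, q) ∈ V ∧ ∀ p : M, (p, q) ∈ V → p ≠ z → legendreArg D ψ q p < legendreArg D ψ q z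

/-- A real function seen as a function with values in the extended reals. -/
def toE (η : M → ℝ) : M → EReal := fun p => (η p : EReal)

/-- The Legendre transform of a real function as a real function (meaningful where the transform
is finite). -/
def legendreReal (V : Set (M × M)) (D : M × M → ℝ) (η : M → ℝ) : M → ℝ :=
  fun q => (legendre V D (toE η) q).toReal

/-- A finite family of coordinate charts together with compact subsets of their domains that
cover `M`. -/
structure ChartCover (E : Type*) [NormedAddCommGroup E] [NormedSpace ℂ E]
    (M : Type*) [TopologicalSpace M] [ChartedSpace E M] where
  /-- the centres of the charts -/
  centers : Finset M
  /-- the compact sets -/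
  K : M → Set M
  isCompact : ∀ c ∈ centers, IsCompact (K c)
  subset_source : ∀ c ∈ centers, K c ⊆ (chartAt E c).source
  covers : ∀ p : M, ∃ c ∈ centers, p ∈ K c

/-- The `C^k` norm defined by a finite cover with charts: the supremum of the norms of the
derivatives of order at most `k` of the coordinate expressions over the given compact sets. -/
def ChartCover.cNorm (𝒦 : ChartCover E M) (k : ℕ) (η : M → ℝ) : ℝ≥0∞ :=
  ⨆ c ∈ 𝒦.centers, ⨆ p ∈ 𝒦.K c, ⨆ j ∈ Set.Iic k,
    ‖iteratedFDeriv ℝ j (η ∘ (chartAt E c).symm) (chartAt E c p)‖ₑ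

end CalabiLegendre

end

/-! Existence of the diastasis. A closed real-analytic `(1,1)`-form has a Hermitian coefficient
whose power series also converges for independent variables `p` and `q̄`; this gives a holomorphic
function near the diagonal of `E × Ē` (`exists_complexification`). The diagonal is totally real, so
a holomorphic function on `B × B̄`, `B` convex, that vanishes on it is zero (`eq_zero_of_diag`).
Hence the extended coefficient is still closed in each variable, and two applications of the
holomorphic Poincaré lemma (`exists_primitive`) give a polarized potential `k` (`exists_isKernel`).
The identity theorem also shows that two potentials of one form have the same diastasis
(`IsKernel.diastasis_unique`), so the local diastases glue (`exists_isDiastasisNhd`).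

Geometry near the diagonal. The diastasis `d` is symmetric and vanishes on the diagonal, so `d_x(x,
x) = 0`, and `d_xx` on the diagonal is the Kähler metric (`IsKernel.fderiv_dfst_diastasis`).
Differentiating `d_x(x, x) = 0` gives `d_xy = -d_xx` on the diagonal. Around every point there is
therefore a small ball where `d` is uniformly convex in `x` and `y ↦ -d_x(x, y)` is strongly
monotone (`exists_isConvexCell`).

The transform. The bound `D ≥ C d²` and the smallness of `η` confine the maximizers for `q` to a
neighbourhood of `q` of uniform size (`KahlerForm.IsDiastasisNhd.exists_isClose`). In a cell a
maximizer solves `d_x(x, y) + dη(x) = 0`. Since the Hessian of `η` is small, the left side is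
strongly monotone in `x`, so the maximizer `G(q)` is unique. It is expansive in `y`, and `d_x(x, ·)`
covers a ball of covectors of definite size (`IsConvexCell.exists_dfst_eq`), so `G` is bijective.
The implicit function theorem, applied to the same equation solved for `x` or for `y`, makes `G` and
`G⁻¹` as regular as `dη`. The critical value `ψ` has the differential `-d_y(G(y), y)`, which
contains no derivative of `G`, so `ψ` is one order more regular than `G`.

Involution. For close points the inequality `-D(p, q) - η(p) ≤ ψ(q)`, with equality exactly if `p =
G(q)`, is symmetric in `(p, η)` and `(q, ψ)` because `D` is. Hence `η` is the transform of `ψ`, with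
maximizers `G⁻¹` (`IsCellAtlas.isMaximizer_symm`). The only smallness of `ψ` that is needed is that
of its values.

Continuity in `C^k`. The implicit function theorem is proved for equations with a parameter in a
topological space (`ParamContDiffOn.of_implicit`). With `η` itself as the parameter, the derivatives
of `ψ` are jointly continuous in `η` and the point, and compactness makes this uniform in the point
(`IsCellAtlas.eventually_cNorm_le`). -/

noncomputable section

set_option maxSynthPendingDepth 3

namespace CalabiLegendre

/-! ### Maps of class `C^n` with continuous dependence on a parameter -/

section ParamContDiff

universe u v

/-- A family `f t : E → F`, depending on a parameter `t` in a topological space, which is `C^n` in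
the space variable with derivatives depending continuously on both variables. -/
def ParamContDiffOn {P : Type v} [TopologicalSpace P] {E : Type u} [NormedAddCommGroup E]
    [NormedSpace ℝ E] : ℕ → ∀ {F : Type u} [NormedAddCommGroup F] [NormedSpace ℝ F],
      (P → E → F) → Set (P × E) → Prop
  | 0, _, _, _, f, O => ContinuousOn (fun z : P × E => f z.1 z.2) O
  | n + 1, _, _, _, f, O => ContinuousOn (fun z : P × E => f z.1 z.2) O ∧
      (∀ z ∈ O, DifferentiableAt ℝ (f z.1) z.2) ∧
      ParamContDiffOn n (fun t x => fderiv ℝ (f t) x) O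

variable {P : Type v} [TopologicalSpace P]
variable {E F F' G : Type u} [NormedAddCommGroup E] [NormedSpace ℝ E]
  [NormedAddCommGroup F] [NormedSpace ℝ F] [NormedAddCommGroup F'] [NormedSpace ℝ F']
  [NormedAddCommGroup G] [NormedSpace ℝ G] {n : ℕ} {O O' : Set (P × E)}

namespace ParamContDiffOn

theorem continuousOn {f : P → E → F} (h : ParamContDiffOn n f O) :
    ContinuousOn (fun z : P × E => f z.1 z.2) O := by
  cases n with
  | zero => exact h
  | succ n => exact h.1

theorem of_succ {n : ℕ} {F : Type u} [NormedAddCommGroup F] [NormedSpace ℝ F] {f : P → E → F}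
    (h : ParamContDiffOn (n + 1) f O) : ParamContDiffOn n f O := by
  induction n generalizing F with
  | zero => exact h.1
  | succ n ih => exact ⟨h.1, h.2.1, ih h.2.2⟩

theorem mono {n : ℕ} {F : Type u} [NormedAddCommGroup F] [NormedSpace ℝ F] {f : P → E → F}
    (h : ParamContDiffOn n f O) (hO : O' ⊆ O) : ParamContDiffOn n f O' := by
  induction n generalizing F with
  | zero => exact ContinuousOn.mono h hO
  | succ n ih => exact ⟨h.1.mono hO, fun z hz => h.2.1 z (hO hz), ih h.2.2⟩

theorem _root_.CalabiLegendre.isOpen_slice {P X : Type*} [TopologicalSpace P]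
    [TopologicalSpace X] {O : Set (P × X)} (hO : IsOpen O) (t : P) : IsOpen {x | (t, x) ∈ O} :=
  hO.preimage (Continuous.prodMk_right t)

theorem congr {n : ℕ} {F : Type u} [NormedAddCommGroup F] [NormedSpace ℝ F] {f g : P → E → F}
    (h : ParamContDiffOn n f O) (hO : IsOpen O) (hfg : ∀ z ∈ O, f z.1 z.2 = g z.1 z.2) :
    ParamContDiffOn n g O := by
  -- Slices of an open set are open, so equality on `O` is equality of germs in the space variable
  -- and passes to derivatives.
  have key : ∀ z ∈ O, f z.1 =ᶠ[𝓝 z.2] g z.1 := fun z hz =>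
    Filter.mem_of_superset ((isOpen_slice hO z.1).mem_nhds hz) fun x hx => hfg (z.1, x) hx
  induction n generalizing F with
  | zero => exact ContinuousOn.congr h fun z hz => (hfg z hz).symm
  | succ n ih =>
    refine ⟨h.1.congr fun z hz => (hfg z hz).symm,
      fun z hz => (h.2.1 z hz).congr_of_eventuallyEq (key z hz).symm, ?_⟩
    exact ih h.2.2 (fun z hz => (key z hz).fderiv_eq) fun z hz => (key z hz).fderiv

theorem const_param {n : ℕ} {F : Type u} [NormedAddCommGroup F] [NormedSpace ℝ F] {f : E → F}
    {U : Set E} (hU : IsOpen U) (hf : ContDiffOn ℝ n f U) :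
    ParamContDiffOn n (fun (_ : P) => f) {z | z.2 ∈ U} := by
  induction n generalizing F with
  | zero => exact hf.continuousOn.comp continuousOn_snd fun z hz => hz
  | succ n ih =>
    refine ⟨hf.continuousOn.comp continuousOn_snd fun z hz => hz, fun z hz => ?_, ?_⟩
    · exact (hf.contDiffAt (hU.mem_nhds hz)).differentiableAt (by simp)
    · exact ih (hf.fderiv_of_isOpen hU (by simp))

theorem clm_comp {n : ℕ} {F G : Type u} [NormedAddCommGroup F] [NormedSpace ℝ F]
    [NormedAddCommGroup G] [NormedSpace ℝ G] (L : F →L[ℝ] G) {f : P → E → F}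
    (h : ParamContDiffOn n f O) (hO : IsOpen O) :
    ParamContDiffOn n (fun t x => L (f t x)) O := by
  induction n generalizing F G with
  | zero => exact L.continuous.comp_continuousOn h
  | succ n ih =>
    refine ⟨L.continuous.comp_continuousOn h.1,
      fun z hz => L.differentiableAt.comp _ (h.2.1 z hz), ?_⟩
    refine (ih (ContinuousLinearMap.compL ℝ E F G L) h.2.2).congr hO fun z hz => ?_
    exact ((L.hasFDerivAt.comp z.2 (h.2.1 z hz).hasFDerivAt).fderiv).symm

theorem add {n : ℕ} {F : Type u} [NormedAddCommGroup F] [NormedSpace ℝ F] {f g : P → E → F}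
    (hf : ParamContDiffOn n f O) (hg : ParamContDiffOn n g O) (hO : IsOpen O) :
    ParamContDiffOn n (fun t x => f t x + g t x) O := by
  induction n generalizing F with
  | zero => exact ContinuousOn.add hf hg
  | succ n ih =>
    refine ⟨hf.1.add hg.1, fun z hz => (hf.2.1 z hz).fun_add (hg.2.1 z hz), ?_⟩
    refine (ih hf.2.2 hg.2.2).congr hO fun z hz => ?_
    exact (fderiv_fun_add (hf.2.1 z hz) (hg.2.1 z hz)).symm

theorem neg {f : P → E → F} (hf : ParamContDiffOn n f O) (hO : IsOpen O) :
    ParamContDiffOn n (fun t x => -f t x) O :=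
  clm_comp (-ContinuousLinearMap.id ℝ F) hf hO

/-- By the Leibniz rule the derivative is a sum of two bilinear expressions in `(f, g')` and `(f',
g)`. The target spaces change at each differentiation, so the induction has to range over all of
them. -/
theorem bilin {n : ℕ} {F F' G : Type u} [NormedAddCommGroup F] [NormedSpace ℝ F]
    [NormedAddCommGroup F'] [NormedSpace ℝ F'] [NormedAddCommGroup G] [NormedSpace ℝ G]
    (B : F →L[ℝ] F' →L[ℝ] G) {f : P → E → F} {g : P → E → F'}
    (hf : ParamContDiffOn n f O) (hg : ParamContDiffOn n g O) (hO : IsOpen O) :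
    ParamContDiffOn n (fun t x => B (f t x) (g t x)) O := by
  induction n generalizing F F' G with
  | zero => exact (B.continuous.comp_continuousOn hf).clm_apply hg
  | succ n ih =>
    refine ⟨(B.continuous.comp_continuousOn hf.1).clm_apply hg.1, fun z hz =>
      (B.differentiableAt.comp z.2 (hf.2.1 z hz)).clm_apply (hg.2.1 z hz), ?_⟩
    refine ((ih (B.precompR E) hf.of_succ hg.2.2).add
      (ih (B.precompL E) hf.2.2 hg.of_succ) hO).congr hO fun z hz => ?_
    exact ((B.hasFDerivAt_of_bilinear (hf.2.1 z hz).hasFDerivAt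
      (hg.2.1 z hz).hasFDerivAt).fderiv).symm

theorem prodMk {f : P → E → F} {g : P → E → F'}
    (hf : ParamContDiffOn n f O) (hg : ParamContDiffOn n g O) (hO : IsOpen O) :
    ParamContDiffOn n (fun t x => (f t x, g t x)) O := by
  refine ((clm_comp (.inl ℝ F F') hf hO).add (clm_comp (.inr ℝ F F') hg hO) hO).congr hO
    fun z _ => ?_
  simp

/-- The chain rule gives `h'(g) ∘ g'`: the induction hypothesis handles `h'(g)` and `bilin` handles
the composition of linear maps. -/
theorem comp {n : ℕ} {F F' : Type u} [NormedAddCommGroup F] [NormedSpace ℝ F]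
    [NormedAddCommGroup F'] [NormedSpace ℝ F'] {h : P → F → F'} {g : P → E → F} {U : Set (P × F)}
    (hh : ParamContDiffOn n h U) (hg : ParamContDiffOn n g O) (hO : IsOpen O)
    (hm : ∀ z ∈ O, (z.1, g z.1 z.2) ∈ U) :
    ParamContDiffOn n (fun t x => h t (g t x)) O := by
  induction n generalizing F' with
  | zero => exact ContinuousOn.comp hh (continuousOn_fst.prodMk hg) hm
  | succ n ih =>
    refine ⟨hh.1.comp (continuousOn_fst.prodMk hg.1) hm, fun z hz =>
      (hh.2.1 _ (hm z hz)).comp z.2 (hg.2.1 z hz), ?_⟩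
    refine (bilin (ContinuousLinearMap.compL ℝ E F F') (ih hh.2.2 hg.of_succ) hg.2.2 hO).congr hO
      fun z hz => ?_
    exact (((hh.2.1 _ (hm z hz)).hasFDerivAt.comp z.2 (hg.2.1 z hz).hasFDerivAt).fderiv).symm

theorem contDiffOn {n : ℕ} {F : Type u} [NormedAddCommGroup F] [NormedSpace ℝ F] {f : P → E → F}
    (h : ParamContDiffOn n f O) (hO : IsOpen O) (t : P) :
    ContDiffOn ℝ n (f t) {x | (t, x) ∈ O} := by
  induction n generalizing F with
  | zero =>
    exact contDiffOn_zero.2 (ContinuousOn.comp (f := fun x => (t, x)) h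
      (Continuous.prodMk_right t).continuousOn fun x hx => hx)
  | succ n ih =>
    refine (contDiffOn_succ_iff_fderiv_of_isOpen (isOpen_slice hO t)).2
      ⟨fun x hx => (h.2.1 (t, x) hx).differentiableWithinAt, by simp, ih h.2.2⟩

theorem continuousOn_iteratedFDeriv {n : ℕ} {F : Type u} [NormedAddCommGroup F] [NormedSpace ℝ F]
    {f : P → E → F} (h : ParamContDiffOn n f O) {j : ℕ} (hj : j ≤ n) :
    ContinuousOn (fun z : P × E => iteratedFDeriv ℝ j (f z.1) z.2) O := by
  induction n generalizing F j with
  | zero =>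
    obtain rfl : j = 0 := by omega
    simp only [iteratedFDeriv_zero_eq_comp, Function.comp_def]
    exact (LinearIsometryEquiv.continuous _).comp_continuousOn h
  | succ n ih =>
    cases j with
    | zero =>
      simp only [iteratedFDeriv_zero_eq_comp, Function.comp_def]
      exact (LinearIsometryEquiv.continuous _).comp_continuousOn h.1
    | succ j =>
      simp only [iteratedFDeriv_succ_eq_comp_right, Function.comp_def]
      exact (LinearIsometryEquiv.continuous _).comp_continuousOn (ih h.2.2 (by omega))

/-- Up to an isometry the `(j+1)`-st derivative of `f` is the `j`-th derivative of `f'`, so the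
recursive notion follows from joint continuity of the iterated derivatives, which is what a `C^k`
norm controls. -/
theorem of_iteratedFDeriv {n : ℕ} {F : Type u} [NormedAddCommGroup F] [NormedSpace ℝ F]
    {f : P → E → F} (hO : IsOpen O) (hd : ∀ t, ContDiffOn ℝ n (f t) {x | (t, x) ∈ O})
    (hc : ∀ j ≤ n, ContinuousOn (fun z : P × E => iteratedFDeriv ℝ j (f z.1) z.2) O) :
    ParamContDiffOn n f O := by
  have h0 : ContinuousOn (fun z : P × E => f z.1 z.2) O := by
    exact ((ContinuousMultilinearMap.apply ℝ (fun _ : Fin 0 => E) F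
      0).continuous.comp_continuousOn (hc 0 (Nat.zero_le _))).congr fun z _ => by simp
  induction n generalizing F with
  | zero => exact h0
  | succ n ih =>
    have hc' : ∀ j ≤ n, ContinuousOn
        (fun z : P × E => iteratedFDeriv ℝ j (fderiv ℝ (f z.1)) z.2) O := fun j hj => by
      refine ((continuousMultilinearCurryRightEquiv' ℝ j E F).continuous.comp_continuousOn
        (hc (j + 1) (by omega))).congr fun z _ => ?_
      rw [Function.comp_apply, iteratedFDeriv_succ_eq_comp_right, Function.comp_apply]
      exact (LinearIsometryEquiv.apply_symm_apply _ _).symm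
    refine ⟨h0, fun z hz => ((hd z.1).contDiffAt ((isOpen_slice hO z.1).mem_nhds hz)
      ).differentiableAt (by simp), ih (fun t => ?_) hc' ?_⟩
    · exact (hd t).fderiv_of_isOpen (isOpen_slice hO t) (by simp)
    · exact ((ContinuousMultilinearMap.apply ℝ (fun _ : Fin 0 => E) (E →L[ℝ] F)
        0).continuous.comp_continuousOn (hc' 0 (Nat.zero_le _))).congr fun z _ => by simp

end ParamContDiffOn

end ParamContDiff

end CalabiLegendre

end

/-! ### The implicit function theorem with a parameter -/

noncomputable section

set_option maxSynthPendingDepth 3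

namespace CalabiLegendre

section Implicit

universe u v

variable {P : Type v} [TopologicalSpace P]
variable {X Y Z : Type u} [NormedAddCommGroup X] [NormedSpace ℝ X] [CompleteSpace X]
  [NormedAddCommGroup Y] [NormedSpace ℝ Y] [CompleteSpace Y]
  [NormedAddCommGroup Z] [NormedSpace ℝ Z] [CompleteSpace Z]

omit [CompleteSpace Z] in
theorem isOpen_setOf_isInvertible :
    IsOpen {A : Y →L[ℝ] Z | A.IsInvertible} :=
  ContinuousLinearEquiv.isOpen

omit [CompleteSpace Z] in
theorem contDiffOn_inverse {n : ℕ} :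
    ContDiffOn ℝ n (ContinuousLinearMap.inverse : (Y →L[ℝ] Z) → (Z →L[ℝ] Y))
      {A | A.IsInvertible} := fun _ hA =>
  (ContinuousLinearMap.IsInvertible.contDiffAt_map_inverse hA).contDiffWithinAt

/-- A continuous solution of an implicit equation is differentiable, with the usual derivative. -/
theorem hasFDerivAt_of_implicit {Φ : X × Y → Z} {g : X → Y} {x : X} {n : ℕ} (hn : n ≠ 0)
    (hΦ : ContDiffAt ℝ n Φ (x, g x)) (hg : ContinuousAt g x)
    (hinv : (fderiv ℝ Φ (x, g x) ∘L .inr ℝ X Y).IsInvertible)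
    (h0 : ∀ᶠ x' in 𝓝 x, Φ (x', g x') = 0) :
    HasFDerivAt g (-(fderiv ℝ Φ (x, g x) ∘L .inr ℝ X Y).inverse ∘L
      (fderiv ℝ Φ (x, g x) ∘L .inl ℝ X Y)) x := by
  have hn' : (n : WithTop ℕ∞) ≠ 0 := by exact_mod_cast hn
  have h1 := hΦ.hasStrictFDerivAt_implicitFunction hn' hinv
  have h2 := hΦ.eventually_apply_eq_iff_implicitFunction hn' hinv
  have h3 : Filter.Tendsto (fun x' => (x', g x')) (𝓝 x) (𝓝 (x, g x)) :=
    (continuousAt_id.prodMk hg)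
  -- Near `(x, g x)` the zero set is the graph of the implicit function, and continuity keeps `(x',
  -- g x')` near that point; so `g` is the implicit function there.
  refine h1.hasFDerivAt.congr_of_eventuallyEq ?_
  filter_upwards [h3.eventually h2, h0] with x' h4 h5
  exact (h4.1 (h5.trans h0.self_of_nhds.symm)).symm

/-- A continuous solution of an implicit equation depending on a parameter has the regularity of
the equation. -/
theorem ParamContDiffOn.of_implicit {n : ℕ} (hn : n ≠ 0) {Φ : P → X × Y → Z} {g : P → X → Y}
    {U : Set (P × (X × Y))} {O : Set (P × X)} (hU : IsOpen U) (hO : IsOpen O)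
    (hΦ : ParamContDiffOn n (fun t (p : X × Y) => Φ t p) U)
    (hg : ContinuousOn (fun z : P × X => g z.1 z.2) O)
    (hm : ∀ z ∈ O, (z.1, (z.2, g z.1 z.2)) ∈ U)
    (hinv : ∀ z ∈ O, (fderiv ℝ (Φ z.1) (z.2, g z.1 z.2) ∘L .inr ℝ X Y).IsInvertible)
    (h0 : ∀ z ∈ O, Φ z.1 (z.2, g z.1 z.2) = 0) :
    ParamContDiffOn n g O := by
  obtain ⟨m, rfl⟩ := Nat.exists_eq_succ_of_ne_zero hn
  have hder : ∀ z ∈ O, HasFDerivAt (g z.1)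
      (-(fderiv ℝ (Φ z.1) (z.2, g z.1 z.2) ∘L .inr ℝ X Y).inverse ∘L
      (fderiv ℝ (Φ z.1) (z.2, g z.1 z.2) ∘L .inl ℝ X Y)) z.2 := by
    rintro ⟨t, x⟩ hz
    refine hasFDerivAt_of_implicit hn ?_ ?_ (hinv _ hz) ?_
    · exact (hΦ.contDiffOn hU t).contDiffAt ((isOpen_slice hU t).mem_nhds (hm _ hz))
    · exact ContinuousAt.comp (f := fun x => (t, x)) (x := x) (hg.continuousAt (hO.mem_nhds hz))
        (Continuous.prodMk_right t).continuousAt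
    · filter_upwards [(isOpen_slice hO t).mem_nhds hz] with x' hx'
      exact h0 (t, x') hx'
  -- Bootstrapping: the derivative of `g` is `-Φ_y⁻¹ Φ_x` at `(x, g x)`, which is of class `j` if
  -- `g` is and if `Φ'` is of class `m ≥ j`.
  have step : ∀ j ≤ m, ParamContDiffOn j g O → ParamContDiffOn (j + 1) g O := by
    intro j hj hgj
    have le_of : ∀ {k : ℕ} {W : Type u} [NormedAddCommGroup W] [NormedSpace ℝ W]
        {f : P → X × Y → W}, ParamContDiffOn (j + k) f U → ParamContDiffOn j f U := by
      intro k
      induction k with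
      | zero => exact fun h => h
      | succ k ih => exact fun h => ih h.of_succ
    obtain ⟨k, rfl⟩ := Nat.exists_eq_add_of_le hj
    have hΦ' := le_of hΦ.2.2
    have hid : ParamContDiffOn j (fun (_ : P) (x : X) => x) O :=
      (ParamContDiffOn.const_param (P := P) isOpen_univ
        (contDiff_id (𝕜 := ℝ) (E := X) (n := j)).contDiffOn).mono fun _ _ => trivial
    have hA := ParamContDiffOn.comp hΦ' (hid.prodMk hgj hO) hO hm
    have h1 := ParamContDiffOn.clm_comp
      ((ContinuousLinearMap.compL ℝ Y (X × Y) Z).flip (.inr ℝ X Y)) hA hO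
    have h2 := ParamContDiffOn.clm_comp
      ((ContinuousLinearMap.compL ℝ X (X × Y) Z).flip (.inl ℝ X Y)) hA hO
    have h3 := ParamContDiffOn.comp (ParamContDiffOn.const_param (P := P)
      isOpen_setOf_isInvertible (contDiffOn_inverse (Y := Y) (Z := Z) (n := j))) h1 hO hinv
    have h4 := (ParamContDiffOn.bilin (ContinuousLinearMap.compL ℝ X Z Y) h3 h2 hO).neg hO
    exact ⟨hg, fun z hz => (hder z hz).differentiableAt,
      h4.congr hO fun z hz => by rw [(hder z hz).fderiv]; simp⟩
  have : ∀ j ≤ m + 1, ParamContDiffOn j g O := by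
    intro j
    induction j with
    | zero => exact fun _ => hg
    | succ j ih => exact fun hj => step j (by omega) (ih (by omega))
  exact this _ le_rfl

end Implicit

/-! ### Strong monotonicity and convex cells -/

section Monotone

variable {E : Type*} [NormedAddCommGroup E] [NormedSpace ℝ E]

/-- The mean value theorem for `t ↦ Φ(y + t(x - y))(x - y)` on `[0, 1]`. -/
theorem monotone_of_fderiv_pos {Φ : E → E →L[ℝ] ℝ} {s : Set E} (hs : Convex ℝ s) {c : ℝ}
    (hd : ∀ x ∈ s, DifferentiableAt ℝ Φ x) (hc : ∀ x ∈ s, ∀ v, c * ‖v‖ ^ 2 ≤ fderiv ℝ Φ x v v)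
    {x y : E} (hx : x ∈ s) (hy : y ∈ s) : c * ‖x - y‖ ^ 2 ≤ (Φ x - Φ y) (x - y) := by
  have hseg : ∀ t ∈ Set.Icc (0 : ℝ) 1, y + t • (x - y) ∈ s := fun t ht =>
    hs.add_smul_sub_mem hy hx ht
  have hder : ∀ t ∈ Set.Icc (0 : ℝ) 1, HasDerivAt (fun t : ℝ => Φ (y + t • (x - y)) (x - y))
      (fderiv ℝ Φ (y + t • (x - y)) (x - y) (x - y)) t := by
    intro t ht
    have h1 : HasDerivAt (fun t : ℝ => y + t • (x - y)) (x - y) t := by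
      simpa using ((hasDerivAt_id t).smul_const (x - y)).const_add y
    have h2 := (hd _ (hseg t ht)).hasFDerivAt.comp_hasDerivAt t h1
    simpa using h2.clm_apply (hasDerivAt_const t (x - y))
  obtain ⟨t, ht, h⟩ := exists_hasDerivAt_eq_slope (fun t : ℝ => Φ (y + t • (x - y)) (x - y))
    (fun t => fderiv ℝ Φ (y + t • (x - y)) (x - y) (x - y)) one_pos
    (fun t ht => (hder t ht).continuousAt.continuousWithinAt)
    (fun t ht => hder t (Set.Ioo_subset_Icc_self ht))
  have h3 := hc _ (hseg t (Set.Ioo_subset_Icc_self ht)) (x - y)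
  rw [h] at h3
  simpa using h3

/-- Together with `monotone_of_fderiv_pos` this makes a strongly monotone map expansive, hence
injective with a quantitative inverse. -/
theorem norm_le_of_monotone {c : ℝ} {A : E →L[ℝ] ℝ} {v : E} (h : c * ‖v‖ ^ 2 ≤ A v) :
    c * ‖v‖ ≤ ‖A‖ := by
  rcases eq_or_ne v 0 with rfl | hv
  · simp
  · have hv' : 0 < ‖v‖ := norm_pos_iff.2 hv
    have h1 : c * ‖v‖ ^ 2 ≤ ‖A‖ * ‖v‖ := h.trans ((le_abs_self _).trans (A.le_opNorm v))
    nlinarith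

/-- The finite-dimensional Lax–Milgram lemma: coercivity gives injectivity, and a space and its dual
have the same dimension. -/
theorem exists_coe_eq_of_coercive [FiniteDimensional ℝ E] {T : E →L[ℝ] E →L[ℝ] ℝ} {c : ℝ}
    (hc : 0 < c) (hT : ∀ v, c * ‖v‖ ^ 2 ≤ T v v) : ∃ e : E ≃L[ℝ] (E →L[ℝ] ℝ), (e : E →L[ℝ] _) = T := by
  have hinj : Function.Injective (T : E →ₗ[ℝ] (E →L[ℝ] ℝ)) := by
    refine (injective_iff_map_eq_zero _).2 fun v hv => ?_
    have h1 := norm_le_of_monotone (hT v)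
    have h2 : T v = 0 := hv
    rw [h2, norm_zero] at h1
    exact norm_le_zero_iff.1 (nonpos_of_mul_nonpos_right h1 hc)
  have hdim : Module.finrank ℝ E = Module.finrank ℝ (E →L[ℝ] ℝ) := by
    rw [← (LinearMap.toContinuousLinearMap (𝕜 := ℝ) (E := E) (F' := ℝ)).finrank_eq]
    exact (Subspace.dual_finrank_eq (K := ℝ) (V := E)).symm
  let e := LinearEquiv.ofInjectiveOfFinrankEq (T : E →ₗ[ℝ] (E →L[ℝ] ℝ)) hinj hdim
  exact ⟨e.toContinuousLinearEquiv, by ext v w; rfl⟩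

/-- The partial derivative in the first variable. -/
def dfst (d : E × E → ℝ) (z : E × E) : E →L[ℝ] ℝ :=
  fderiv ℝ d z ∘L .inl ℝ E E

/-- A ball on which a function of two variables vanishing on the diagonal is uniformly convex in
the first variable, with a mixed second derivative close to a fixed coercive form. -/
structure IsConvexCell (d : E × E → ℝ) (x₀ : E) (R a : ℝ) : Prop where
  R_pos : 0 < R
  a_pos : 0 < a
  smooth : ContDiffOn ℝ ∞ d (Metric.ball x₀ R ×ˢ Metric.ball x₀ R)
  dfst_diag : ∀ x ∈ Metric.ball x₀ R, dfst d (x, x) = 0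
  convex : ∀ z ∈ Metric.ball x₀ R ×ˢ Metric.ball x₀ R, ∀ v,
    a * ‖v‖ ^ 2 ≤ fderiv ℝ (dfst d) z (v, 0) v
  mixed : ∀ z ∈ Metric.ball x₀ R ×ˢ Metric.ball x₀ R, ∀ v,
    a * ‖v‖ ^ 2 ≤ -(fderiv ℝ (dfst d) z (0, v) v)
  approx : ∃ T : E →L[ℝ] E →L[ℝ] ℝ, (∀ v, a * ‖v‖ ^ 2 ≤ -(T v v)) ∧
    ∀ z ∈ Metric.ball x₀ R ×ˢ Metric.ball x₀ R,
      ‖fderiv ℝ (dfst d) z ∘L .inr ℝ E E - T‖ ≤ a / 2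

namespace IsConvexCell

variable {d : E × E → ℝ} {x₀ : E} {R a : ℝ}

theorem contDiffOn_dfst (h : IsConvexCell d x₀ R a) :
    ContDiffOn ℝ ∞ (dfst d) (Metric.ball x₀ R ×ˢ Metric.ball x₀ R) :=
  ((ContinuousLinearMap.compL ℝ E (E × E) ℝ).flip (.inl ℝ E E)).contDiff.comp_contDiffOn
    (h.smooth.fderiv_of_isOpen (Metric.isOpen_ball.prod Metric.isOpen_ball) (by simp))

theorem differentiableAt_dfst (h : IsConvexCell d x₀ R a) {z : E × E}
    (hz : z ∈ Metric.ball x₀ R ×ˢ Metric.ball x₀ R) : DifferentiableAt ℝ (dfst d) z :=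
  (h.contDiffOn_dfst.contDiffAt ((Metric.isOpen_ball.prod Metric.isOpen_ball).mem_nhds
    hz)).differentiableAt (by simp)

theorem hasFDerivAt_dfst_left (h : IsConvexCell d x₀ R a) {x y : E} (hx : x ∈ Metric.ball x₀ R)
    (hy : y ∈ Metric.ball x₀ R) :
    HasFDerivAt (fun x => dfst d (x, y)) (fderiv ℝ (dfst d) (x, y) ∘L .inl ℝ E E) x :=
  (h.differentiableAt_dfst ⟨hx, hy⟩).hasFDerivAt.comp x (hasFDerivAt_prodMk_left x y)

theorem hasFDerivAt_dfst_right (h : IsConvexCell d x₀ R a) {x y : E} (hx : x ∈ Metric.ball x₀ R)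
    (hy : y ∈ Metric.ball x₀ R) :
    HasFDerivAt (fun y => dfst d (x, y)) (fderiv ℝ (dfst d) (x, y) ∘L .inr ℝ E E) y :=
  (h.differentiableAt_dfst ⟨hx, hy⟩).hasFDerivAt.comp y (hasFDerivAt_prodMk_right x y)

/-- The differential of a perturbation `x ↦ d (x, y) + η x` determines `x`, if the second
derivative of `η` is small. -/
theorem norm_sub_le_left (h : IsConvexCell d x₀ R a) {ξ : E → E →L[ℝ] ℝ}
    (hξ : ∀ x ∈ Metric.ball x₀ R, DifferentiableAt ℝ ξ x)
    (hξ' : ∀ x ∈ Metric.ball x₀ R, ‖fderiv ℝ ξ x‖ ≤ a / 2) {x x' y : E}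
    (hx : x ∈ Metric.ball x₀ R) (hx' : x' ∈ Metric.ball x₀ R) (hy : y ∈ Metric.ball x₀ R) :
    a / 2 * ‖x - x'‖ ≤ ‖(dfst d (x, y) + ξ x) - (dfst d (x', y) + ξ x')‖ := by
  refine norm_le_of_monotone (monotone_of_fderiv_pos (Φ := fun x => dfst d (x, y) + ξ x)
    (convex_ball x₀ R) (fun z hz => (h.hasFDerivAt_dfst_left hz hy).differentiableAt.add (hξ z hz))
    (fun z hz v => ?_) hx hx')
  rw [((h.hasFDerivAt_dfst_left hz hy).fun_add (hξ z hz).hasFDerivAt).fderiv]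
  have h1 := h.convex (z, y) ⟨hz, hy⟩ v
  -- The perturbation uses up at most half of the convexity constant `a`.
  have h2 : |fderiv ℝ ξ z v v| ≤ a / 2 * ‖v‖ ^ 2 := by
    have := (fderiv ℝ ξ z).le_opNorm₂ v v
    have h3 := mul_le_mul_of_nonneg_right (hξ' z hz) (sq_nonneg ‖v‖)
    rw [Real.norm_eq_abs] at this
    nlinarith
  have h4 := (abs_le.1 h2).1
  simp only [add_apply, ContinuousLinearMap.coe_comp, Function.comp_apply,
    ContinuousLinearMap.inl_apply]
  linarith

/-- The map `y ↦ -d_x(x, y)` is strongly monotone by the field `mixed`. A perturbation `dη(x)` does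
not depend on `y`, so nothing is lost from the constant `a`. -/
theorem norm_sub_le_right (h : IsConvexCell d x₀ R a) {x y y' : E}
    (hx : x ∈ Metric.ball x₀ R) (hy : y ∈ Metric.ball x₀ R) (hy' : y' ∈ Metric.ball x₀ R) :
    a * ‖y - y'‖ ≤ ‖dfst d (x, y) - dfst d (x, y')‖ := by
  have := norm_le_of_monotone (monotone_of_fderiv_pos (Φ := fun y => -dfst d (x, y))
    (convex_ball x₀ R) (c := a)
    (fun z hz => (h.hasFDerivAt_dfst_right hx hz).differentiableAt.neg)
    (fun z hz v => ?_) hy hy')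
  · rwa [neg_sub_neg, norm_sub_rev (dfst d _)] at this
  · rw [(h.hasFDerivAt_dfst_right hx hz).fun_neg.fderiv]
    simpa using h.mixed (x, z) ⟨hx, hz⟩ v

/-- Every small covector is the partial derivative of `d` at some point `(x, y)`, `x` fixed. -/
theorem exists_dfst_eq [FiniteDimensional ℝ E] (h : IsConvexCell d x₀ R a) {x : E} {ρ : ℝ}
    (hρ : 0 ≤ ρ) (hx : Metric.closedBall x ρ ⊆ Metric.ball x₀ R) {ζ : E →L[ℝ] ℝ}
    (hζ : ‖ζ‖ ≤ a / 2 * ρ) : ∃ y ∈ Metric.closedBall x ρ, dfst d (x, y) = ζ := by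
  obtain ⟨T, hT, happ⟩ := h.approx
  obtain ⟨e, he⟩ := exists_coe_eq_of_coercive (T := -T) h.a_pos (by simpa using hT)
  have hxB : x ∈ Metric.ball x₀ R := hx (Metric.mem_closedBall_self hρ)
  have hA : ApproximatesLinearOn (fun y => -dfst d (x, y)) (e : E →L[ℝ] (E →L[ℝ] ℝ))
      (Metric.ball x₀ R) (a / 2).toNNReal := by
    have hder : ∀ y ∈ Metric.ball x₀ R, HasFDerivAt (fun y => -dfst d (x, y) - e y)
        (-(fderiv ℝ (dfst d) (x, y) ∘L .inr ℝ E E) - (e : E →L[ℝ] (E →L[ℝ] ℝ))) y := fun y hy =>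
      (h.hasFDerivAt_dfst_right hxB hy).neg.sub (e : E →L[ℝ] (E →L[ℝ] ℝ)).hasFDerivAt
    have := (convex_ball x₀ R).lipschitzOnWith_of_nnnorm_hasFDerivWithin_le
      (C := (a / 2).toNNReal) (fun y hy => (hder y hy).hasFDerivWithinAt) (fun y hy => ?_)
    · rw [ApproximatesLinearOn.approximatesLinearOn_iff_lipschitzOnWith]
      exact this
    · rw [← NNReal.coe_le_coe, coe_nnnorm, Real.coe_toNNReal _ (by linarith [h.a_pos]), he]
      refine le_of_eq_of_le ?_ (happ (x, y) ⟨hxB, hy⟩)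
      rw [← norm_neg]
      congr 1
      ext v w
      simp only [neg_apply, sub_apply]
      ring
  have hbd : ∀ ζ : E →L[ℝ] ℝ, ‖e.symm ζ‖ ≤ (1 / a) * ‖ζ‖ := by
    intro ζ
    have h1 := norm_le_of_monotone (A := e (e.symm ζ)) (v := e.symm ζ) (c := a) (by
      have : (e (e.symm ζ)) = (-T) (e.symm ζ) := by rw [← he]; rfl
      rw [this]
      simpa using hT (e.symm ζ))
    rw [e.apply_symm_apply] at h1
    rw [one_div, inv_mul_eq_div, le_div_iff₀ h.a_pos]
    linarith
  let inv : (e : E →L[ℝ] (E →L[ℝ] ℝ)).NonlinearRightInverse :=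
    { toFun := e.symm
      nnnorm := (1 / a).toNNReal
      bound' := fun ζ => by
        rw [Real.coe_toNNReal _ (by have := h.a_pos; positivity)]; exact hbd ζ
      right_inv' := fun ζ => e.apply_symm_apply ζ }
  -- Quantitative surjectivity: `-d_x(x, ·)` differs from `e = -T` by a map with Lipschitz constant
  -- `a / 2`, and `e⁻¹` has norm at most `1 / a`. So the ball of radius `ρ` covers a ball of radius
  -- `(a - a / 2) ρ` around `-d_x(x, x) = 0`.
  have hs := hA.surjOn_closedBall_of_nonlinearRightInverse inv hρ hx
  have hmem : -ζ ∈ Metric.closedBall (-dfst d (x, x))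
      (((inv.nnnorm : ℝ)⁻¹ - ((a / 2).toNNReal : ℝ)) * ρ) := by
    have ha := h.a_pos
    have h1 : (inv.nnnorm : ℝ) = 1 / a := Real.coe_toNNReal _ (by positivity)
    have h2 : ((a / 2).toNNReal : ℝ) = a / 2 := Real.coe_toNNReal _ (by positivity)
    rw [h.dfst_diag x hxB, neg_zero, mem_closedBall_zero_iff, norm_neg, h1, h2, one_div, inv_inv]
    linarith
  obtain ⟨y, hy, hy'⟩ := hs hmem
  exact ⟨y, hy, neg_injective hy'⟩

end IsConvexCell

end Monotone

end CalabiLegendre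

end

/-! ### Critical points and critical values on a convex cell -/

noncomputable section

set_option maxSynthPendingDepth 3

namespace CalabiLegendre

namespace IsConvexCell

universe u v

variable {P : Type v} [TopologicalSpace P]
variable {E : Type u} [NormedAddCommGroup E] [NormedSpace ℝ E] [FiniteDimensional ℝ E]
variable {d : E × E → ℝ} {x₀ : E} {R a : ℝ} {ξ : P → E → E →L[ℝ] ℝ} {n : ℕ} {O : Set (P × E)}
  {g : P → E → E}

omit [NormedSpace ℝ E] [FiniteDimensional ℝ E] in
theorem isOpen_cell : IsOpen {z : P × (E × E) | z.2 ∈ Metric.ball x₀ R ×ˢ Metric.ball x₀ R} :=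
  (Metric.isOpen_ball.prod Metric.isOpen_ball).preimage continuous_snd

omit [FiniteDimensional ℝ E] in
theorem paramContDiffOn_comp_fst {F : Type u} [NormedAddCommGroup F] [NormedSpace ℝ F]
    {f : P → E → F} (hf : ParamContDiffOn n f {z | z.2 ∈ Metric.ball x₀ R}) :
    ParamContDiffOn n (fun t (p : E × E) => f t p.1)
      {z | z.2 ∈ Metric.ball x₀ R ×ˢ Metric.ball x₀ R} := by
  refine ParamContDiffOn.comp hf ((ParamContDiffOn.const_param (P := P) isOpen_univ
    (contDiff_fst (𝕜 := ℝ) (E := E) (F := E) (n := n)).contDiffOn).mono fun _ _ => trivial)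
    isOpen_cell fun z hz => hz.1

omit [FiniteDimensional ℝ E] in
/-- The equation `d_x (x, y) + ξ x = 0` is as regular as `ξ`. -/
theorem paramContDiffOn_equation (h : IsConvexCell d x₀ R a)
    (hξ : ParamContDiffOn n ξ {z | z.2 ∈ Metric.ball x₀ R}) :
    ParamContDiffOn n (fun t (p : E × E) => dfst d p + ξ t p.1)
      {z | z.2 ∈ Metric.ball x₀ R ×ˢ Metric.ball x₀ R} :=
  (ParamContDiffOn.const_param (P := P) (Metric.isOpen_ball.prod Metric.isOpen_ball)
    (h.contDiffOn_dfst.of_le (by exact_mod_cast le_top))).add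
    (paramContDiffOn_comp_fst hξ) isOpen_cell

theorem isInvertible_of_coercive {A : E →L[ℝ] E →L[ℝ] ℝ} {c : ℝ} (hc : 0 < c)
    (hA : ∀ v, c * ‖v‖ ^ 2 ≤ A v v) : A.IsInvertible :=
  exists_coe_eq_of_coercive hc hA

theorem _root_.ContinuousLinearMap.IsInvertible.neg' {X Y : Type*} [NormedAddCommGroup X]
    [NormedSpace ℝ X] [NormedAddCommGroup Y] [NormedSpace ℝ Y] {A : X →L[ℝ] Y}
    (hA : (-A).IsInvertible) : A.IsInvertible := by
  obtain ⟨e, he⟩ := hA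
  refine ⟨e.trans (ContinuousLinearEquiv.neg ℝ), ?_⟩
  ext v
  have : e v = -(A v) := by rw [← neg_apply, ← he]; rfl
  simp [this]

omit [FiniteDimensional ℝ E] in
theorem hasFDerivAt_equation (h : IsConvexCell d x₀ R a) {f : E → E →L[ℝ] ℝ} {x y : E}
    (hf : DifferentiableAt ℝ f x) (hx : x ∈ Metric.ball x₀ R) (hy : y ∈ Metric.ball x₀ R) :
    HasFDerivAt (fun p : E × E => dfst d p + f p.1)
      (fderiv ℝ (dfst d) (x, y) + fderiv ℝ f x ∘L .fst ℝ E E) (x, y) :=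
  (h.differentiableAt_dfst ⟨hx, hy⟩).hasFDerivAt.fun_add
    (HasFDerivAt.comp (x, y) (f := Prod.fst) (g := f) hf.hasFDerivAt hasFDerivAt_fst)

omit [FiniteDimensional ℝ E] in
theorem coercive_left (h : IsConvexCell d x₀ R a) {f : E → E →L[ℝ] ℝ}
    {x y : E} (hx : x ∈ Metric.ball x₀ R) (hy : y ∈ Metric.ball x₀ R)
    (hf' : ‖fderiv ℝ f x‖ ≤ a / 2) (v : E) :
    a / 2 * ‖v‖ ^ 2 ≤
      (fderiv ℝ (dfst d) (x, y) + fderiv ℝ f x ∘L .fst ℝ E E) (v, 0) v := by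
  have h1 := h.convex (x, y) ⟨hx, hy⟩ v
  have h2 : |fderiv ℝ f x v v| ≤ a / 2 * ‖v‖ ^ 2 := by
    have := (fderiv ℝ f x).le_opNorm₂ v v
    have h3 := mul_le_mul_of_nonneg_right hf' (sq_nonneg ‖v‖)
    rw [Real.norm_eq_abs] at this
    nlinarith
  have h4 := (abs_le.1 h2).1
  simp only [add_apply, ContinuousLinearMap.coe_comp, Function.comp_apply,
    ContinuousLinearMap.coe_fst']
  linarith

/-- The critical points of `x ↦ d (x, y) + η x` depend on `y` as regularly as `ξ = dη` does. -/
theorem paramContDiffOn_solution_left (h : IsConvexCell d x₀ R a) (hn : n ≠ 0)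
    (hξ : ParamContDiffOn n ξ {z | z.2 ∈ Metric.ball x₀ R})
    (hξ' : ∀ t, ∀ x ∈ Metric.ball x₀ R, ‖fderiv ℝ (ξ t) x‖ ≤ a / 2) (hO : IsOpen O)
    (hO' : ∀ z ∈ O, z.2 ∈ Metric.ball x₀ R) (hg : ∀ z ∈ O, g z.1 z.2 ∈ Metric.ball x₀ R)
    (h0 : ∀ z ∈ O, dfst d (g z.1 z.2, z.2) + ξ z.1 (g z.1 z.2) = 0) :
    ParamContDiffOn n g O := by
  have hdiff : ∀ t, ∀ x ∈ Metric.ball x₀ R, DifferentiableAt ℝ (ξ t) x := fun t x hx =>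
    (((hξ.contDiffOn (Metric.isOpen_ball.preimage continuous_snd) t).contDiffAt
      (Metric.isOpen_ball.mem_nhds hx)).differentiableAt (by exact_mod_cast hn))
  have heq := h.paramContDiffOn_equation hξ
  -- Continuity of the solution need not be assumed. By strong monotonicity `‖g w - g z‖` is at most
  -- `2 / a` times the left side of the equation for `w` evaluated at the fixed point `g z`, and
  -- this tends to `0` as `w → z`.
  have hcont : ContinuousOn (fun z : P × E => g z.1 z.2) O := by
    refine continuousOn_of_forall_continuousAt fun z hz => ?_
    rw [ContinuousAt, tendsto_iff_norm_sub_tendsto_zero]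
    have hF : ContinuousAt (fun w : P × E => dfst d (g z.1 z.2, w.2) + ξ w.1 (g z.1 z.2)) z :=
      (heq.continuousOn.continuousAt (isOpen_cell.mem_nhds
        (⟨hg z hz, hO' z hz⟩ : (g z.1 z.2, z.2) ∈ Metric.ball x₀ R ×ˢ Metric.ball x₀ R))).comp
        (f := fun w : P × E => (w.1, (g z.1 z.2, w.2))) (x := z) (by fun_prop)
    have hF' : Filter.Tendsto (fun w : P × E => 2 / a *
        ‖dfst d (g z.1 z.2, w.2) + ξ w.1 (g z.1 z.2)‖) (𝓝 z) (𝓝 0) := by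
      have := (hF.norm.tendsto.const_mul (2 / a))
      simpa [h0 z hz] using this
    refine squeeze_zero' (Filter.Eventually.of_forall fun _ => norm_nonneg _) ?_ hF'
    filter_upwards [hO.mem_nhds hz] with w hw
    have h1 := h.norm_sub_le_left (hdiff w.1) (hξ' w.1) (hg w hw) (hg z hz) (hO' w hw)
    rw [h0 w hw, zero_sub, norm_neg] at h1
    have ha := h.a_pos
    rw [div_mul_eq_mul_div, le_div_iff₀ ha]
    linarith
  -- The implicit function theorem solves for the second variable, while the unknown here is the
  -- first variable of `d`.
  have hsw : ParamContDiffOn n (fun t (p : E × E) => dfst d (p.2, p.1) + ξ t p.2)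
      {z : P × (E × E) | z.2 ∈ Metric.ball x₀ R ×ˢ Metric.ball x₀ R} :=
    ParamContDiffOn.comp heq (((ParamContDiffOn.const_param (P := P) isOpen_univ
      ((ContinuousLinearEquiv.prodComm ℝ E E).contDiff (n := n)).contDiffOn)).mono
      fun _ _ => trivial) isOpen_cell fun z hz => ⟨hz.2, hz.1⟩
  refine ParamContDiffOn.of_implicit hn isOpen_cell hO hsw hcont
    (fun z hz => ⟨hO' z hz, hg z hz⟩) (fun z hz => ?_) h0
  have h1 := (h.hasFDerivAt_equation (hdiff z.1 _ (hg z hz)) (hg z hz) (hO' z hz)).comp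
    (z.2, g z.1 z.2) ((ContinuousLinearEquiv.prodComm ℝ E E).hasFDerivAt)
  rw [show (fun p : E × E => dfst d (p.2, p.1) + ξ z.1 p.2) =
    (fun p : E × E => dfst d p + ξ z.1 p.1) ∘ (ContinuousLinearEquiv.prodComm ℝ E E) from rfl,
    h1.fderiv]
  refine isInvertible_of_coercive (half_pos h.a_pos) fun v => ?_
  simpa using h.coercive_left (hg z hz) (hO' z hz) (hξ' z.1 _ (hg z hz)) v

/-- The points `y` for which `x` is critical depend on `x` as regularly as `ξ = dη` does. -/
theorem paramContDiffOn_solution_right (h : IsConvexCell d x₀ R a) (hn : n ≠ 0)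
    (hξ : ParamContDiffOn n ξ {z | z.2 ∈ Metric.ball x₀ R}) (hO : IsOpen O)
    (hO' : ∀ z ∈ O, z.2 ∈ Metric.ball x₀ R) (hg : ∀ z ∈ O, g z.1 z.2 ∈ Metric.ball x₀ R)
    (h0 : ∀ z ∈ O, dfst d (z.2, g z.1 z.2) + ξ z.1 z.2 = 0) :
    ParamContDiffOn n g O := by
  have hdiff : ∀ t, ∀ x ∈ Metric.ball x₀ R, DifferentiableAt ℝ (ξ t) x := fun t x hx =>
    (((hξ.contDiffOn (Metric.isOpen_ball.preimage continuous_snd) t).contDiffAt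
      (Metric.isOpen_ball.mem_nhds hx)).differentiableAt (by exact_mod_cast hn))
  have heq := h.paramContDiffOn_equation hξ
  have hcont : ContinuousOn (fun z : P × E => g z.1 z.2) O := by
    refine continuousOn_of_forall_continuousAt fun z hz => ?_
    rw [ContinuousAt, tendsto_iff_norm_sub_tendsto_zero]
    have hF : ContinuousAt (fun w : P × E => dfst d (w.2, g z.1 z.2) + ξ w.1 w.2) z :=
      (heq.continuousOn.continuousAt (isOpen_cell.mem_nhds
        (⟨hO' z hz, hg z hz⟩ : (z.2, g z.1 z.2) ∈ Metric.ball x₀ R ×ˢ Metric.ball x₀ R))).comp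
        (f := fun w : P × E => (w.1, (w.2, g z.1 z.2))) (x := z) (by fun_prop)
    have hF' : Filter.Tendsto (fun w : P × E => 1 / a *
        ‖dfst d (w.2, g z.1 z.2) + ξ w.1 w.2‖) (𝓝 z) (𝓝 0) := by
      have := (hF.norm.tendsto.const_mul (1 / a))
      simpa [h0 z hz] using this
    refine squeeze_zero' (Filter.Eventually.of_forall fun _ => norm_nonneg _) ?_ hF'
    filter_upwards [hO.mem_nhds hz] with w hw
    have h1 := h.norm_sub_le_right (hO' w hw) (hg w hw) (hg z hz)
    rw [← add_sub_add_right_eq_sub _ _ (ξ w.1 w.2), h0 w hw, zero_sub, norm_neg] at h1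
    have ha := h.a_pos
    rw [div_mul_eq_mul_div, le_div_iff₀ ha]
    linarith
  refine ParamContDiffOn.of_implicit hn isOpen_cell hO heq hcont
    (fun z hz => ⟨hO' z hz, hg z hz⟩) (fun z hz => ?_) h0
  have h1 := h.hasFDerivAt_equation (hdiff z.1 _ (hO' z hz)) (hO' z hz) (hg z hz)
  rw [h1.fderiv]
  -- `ξ` does not involve the unknown `y`, so only the mixed derivative of `d` remains. It is
  -- negative definite, whence the sign, and no bound on `ξ'` is required.
  refine ContinuousLinearMap.IsInvertible.neg' (isInvertible_of_coercive h.a_pos fun v => ?_)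
  simpa using h.mixed _ ⟨hO' z hz, hg z hz⟩ v

omit [FiniteDimensional ℝ E] in
/-- The critical value `ψ(y) = -(d (x, y) + η x)`, `x = g y`, has the differential
`-d_y (g y, y)`. -/
theorem hasFDerivAt_criticalValue (h : IsConvexCell d x₀ R a) {f : E → ℝ} {γ : E → E} {y : E}
    (hf : DifferentiableAt ℝ f (γ y)) (hγ : DifferentiableAt ℝ γ y)
    (hy : y ∈ Metric.ball x₀ R) (hγy : γ y ∈ Metric.ball x₀ R)
    (h0 : dfst d (γ y, y) + fderiv ℝ f (γ y) = 0) :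
    HasFDerivAt (fun y => -d (γ y, y) - f (γ y)) (-(fderiv ℝ d (γ y, y) ∘L .inr ℝ E E)) y := by
  have hd : DifferentiableAt ℝ d (γ y, y) := (h.smooth.contDiffAt
    ((Metric.isOpen_ball.prod Metric.isOpen_ball).mem_nhds ⟨hγy, hy⟩)).differentiableAt (by simp)
  have h1 := hd.hasFDerivAt.comp (f := fun y => (γ y, y)) y
    (hγ.hasFDerivAt.prodMk (hasFDerivAt_id y))
  have h2 := hf.hasFDerivAt.comp y hγ.hasFDerivAt
  refine (h1.fun_neg.fun_sub h2).congr_fderiv ?_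
  ext v
  -- The envelope argument: the terms containing the derivative of `γ` add up to the critical point
  -- equation.
  have h3 := congrArg (fun A : E →L[ℝ] ℝ => A (fderiv ℝ γ y v)) h0
  have h4 : (fderiv ℝ γ y v, v) = (fderiv ℝ γ y v, (0 : E)) + (0, v) := by simp
  simp only [dfst, add_apply, ContinuousLinearMap.coe_comp, Function.comp_apply,
    ContinuousLinearMap.inl_apply, zero_apply] at h3
  simp only [sub_apply, neg_apply, ContinuousLinearMap.coe_comp, Function.comp_apply,
    ContinuousLinearMap.prod_apply, ContinuousLinearMap.id_apply, ContinuousLinearMap.inr_apply]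
  rw [h4, map_add]
  linarith

/-- The critical value is once more differentiable than the critical point. -/
theorem continuousOn_iteratedFDeriv_criticalValue (h : IsConvexCell d x₀ R a) (hn : n ≠ 0)
    {f : P → E → ℝ} (hf : ∀ t, ∀ x ∈ Metric.ball x₀ R, DifferentiableAt ℝ (f t) x)
    (hfc : ContinuousOn (fun z : P × E => f z.1 z.2) {z | z.2 ∈ Metric.ball x₀ R})
    (hξ : ParamContDiffOn n (fun t x => fderiv ℝ (f t) x) {z | z.2 ∈ Metric.ball x₀ R})
    (hξ' : ∀ t, ∀ x ∈ Metric.ball x₀ R, ‖fderiv ℝ (fderiv ℝ (f t)) x‖ ≤ a / 2) (hO : IsOpen O)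
    (hO' : ∀ z ∈ O, z.2 ∈ Metric.ball x₀ R) (hg : ∀ z ∈ O, g z.1 z.2 ∈ Metric.ball x₀ R)
    (h0 : ∀ z ∈ O, dfst d (g z.1 z.2, z.2) + fderiv ℝ (f z.1) (g z.1 z.2) = 0) :
    (∀ t, ContDiffOn ℝ (n + 1 : ℕ) (fun y => -d (g t y, y) - f t (g t y)) {y | (t, y) ∈ O}) ∧
    ∀ j ≤ n + 1, ContinuousOn (fun z : P × E =>
      iteratedFDeriv ℝ j (fun y => -d (g z.1 y, y) - f z.1 (g z.1 y)) z.2) O := by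
  have hg' := h.paramContDiffOn_solution_left hn hξ hξ' hO hO' hg h0
  have hder : ∀ z ∈ O, HasFDerivAt (fun y => -d (g z.1 y, y) - f z.1 (g z.1 y))
      (-(fderiv ℝ d (g z.1 z.2, z.2) ∘L .inr ℝ E E)) z.2 := fun z hz =>
    h.hasFDerivAt_criticalValue (hf _ _ (hg z hz))
      (((hg'.contDiffOn hO z.1).contDiffAt ((isOpen_slice hO z.1).mem_nhds hz)).differentiableAt
        (by exact_mod_cast hn)) (hO' z hz) (hg z hz) (h0 z hz)
  have hid : ParamContDiffOn n (fun (_ : P) (x : E) => x) O :=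
    (ParamContDiffOn.const_param (P := P) isOpen_univ
      (contDiff_id (𝕜 := ℝ) (E := E) (n := n)).contDiffOn).mono fun _ _ => trivial
  have hsm : ContDiffOn ℝ n (fun z => -(fderiv ℝ d z ∘L .inr ℝ E E))
      (Metric.ball x₀ R ×ˢ Metric.ball x₀ R) :=
    ((((ContinuousLinearMap.compL ℝ E (E × E) ℝ).flip (.inr ℝ E E)).contDiff.comp_contDiffOn
    (h.smooth.fderiv_of_isOpen (m := ∞) (Metric.isOpen_ball.prod Metric.isOpen_ball)
      (by simp))).neg).of_le (by exact_mod_cast le_top)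
  -- The differential `-d_y(g y, y)` involves `g` but not its derivative. It is of class `n` like
  -- `g`, so the value is of class `n + 1`.
  have hder' : ParamContDiffOn n
      (fun t x => fderiv ℝ (fun y => -d (g t y, y) - f t (g t y)) x) O :=
    (ParamContDiffOn.comp (ParamContDiffOn.const_param (P := P)
      (Metric.isOpen_ball.prod Metric.isOpen_ball) hsm) (hg'.prodMk hid hO) hO
      (fun z hz => ⟨hg z hz, hO' z hz⟩)).congr hO fun z hz => (hder z hz).fderiv.symm
  refine ⟨fun t => ?_, fun j hj => ?_⟩
  · refine (contDiffOn_succ_iff_fderiv_of_isOpen (isOpen_slice hO t)).2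
      ⟨fun x hx => (hder (t, x) hx).differentiableAt.differentiableWithinAt, by simp,
        hder'.contDiffOn hO t⟩
  · cases j with
    | zero =>
      simp only [iteratedFDeriv_zero_eq_comp, Function.comp_def]
      refine (LinearIsometryEquiv.continuous _).comp_continuousOn (ContinuousOn.sub
        (ContinuousOn.neg (h.smooth.continuousOn.comp (hg'.continuousOn.prodMk continuousOn_snd)
          fun z hz => ⟨hg z hz, hO' z hz⟩)) ?_)
      exact hfc.comp (continuousOn_fst.prodMk hg'.continuousOn) fun z hz => hg z hz
    | succ j =>
      simp only [iteratedFDeriv_succ_eq_comp_right, Function.comp_def]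
      exact (LinearIsometryEquiv.continuous _).comp_continuousOn
        (hder'.continuousOn_iteratedFDeriv (by omega))

end IsConvexCell

/-- A smooth function of two variables vanishing on the diagonal to second order with coercive
second derivative has a convex cell around every point. -/
theorem exists_isConvexCell {E : Type*} [NormedAddCommGroup E] [NormedSpace ℝ E]
    [FiniteDimensional ℝ E] {d : E × E → ℝ} {x₀ : E} {ρ : ℝ} (hρ : 0 < ρ)
    (hd : ContDiffOn ℝ ∞ d (Metric.ball x₀ ρ ×ˢ Metric.ball x₀ ρ))
    (hdiag : ∀ x ∈ Metric.ball x₀ ρ, dfst d (x, x) = 0)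
    (hpos : ∀ v, v ≠ 0 → 0 < fderiv ℝ (dfst d) (x₀, x₀) (v, 0) v) :
    ∃ R a : ℝ, R ≤ ρ ∧ IsConvexCell d x₀ R a := by
  have hx₀ : x₀ ∈ Metric.ball x₀ ρ := Metric.mem_ball_self hρ
  have hopen : IsOpen (Metric.ball x₀ ρ ×ˢ Metric.ball x₀ ρ) :=
    Metric.isOpen_ball.prod Metric.isOpen_ball
  have hd1 : ContDiffOn ℝ ∞ (dfst d) (Metric.ball x₀ ρ ×ˢ Metric.ball x₀ ρ) :=
    ((ContinuousLinearMap.compL ℝ E (E × E) ℝ).flip (.inl ℝ E E)).contDiff.comp_contDiffOn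
      (hd.fderiv_of_isOpen hopen (by simp))
  set H := fderiv ℝ (dfst d) with hH
  have hHc : ContinuousAt H (x₀, x₀) :=
    ((hd1.fderiv_of_isOpen (m := ∞) hopen (by simp)).continuousOn).continuousAt
      (hopen.mem_nhds ⟨hx₀, hx₀⟩)
  -- Positivity becomes coercivity by compactness of the unit sphere and homogeneity; the sphere is
  -- empty if `E = 0`, which is why that case is separate.
  obtain ⟨b, hb, hbH⟩ : ∃ b : ℝ, 0 < b ∧ ∀ v, b * ‖v‖ ^ 2 ≤ H (x₀, x₀) (v, 0) v := by
    rcases subsingleton_or_nontrivial E with hE | hE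
    · exact ⟨1, one_pos, fun v => by simp [Subsingleton.elim v 0]⟩
    · obtain ⟨w, hw, hmin⟩ := (isCompact_sphere (0 : E) 1).exists_isMinOn
        (f := fun v => H (x₀, x₀) (v, 0) v) (NormedSpace.sphere_nonempty.2 zero_le_one)
        (by fun_prop)
      refine ⟨_, hpos w (by rintro rfl; simp at hw), fun v => ?_⟩
      rcases eq_or_ne v 0 with rfl | hv
      · simp
      · have hv' : ‖v‖ ≠ 0 := norm_ne_zero_iff.2 hv
        have h1 : (‖v‖⁻¹ • v) ∈ Metric.sphere (0 : E) 1 := by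
          simp [norm_smul, hv']
        have h2 : H (x₀, x₀) (w, 0) w ≤ H (x₀, x₀) (‖v‖⁻¹ • v, 0) (‖v‖⁻¹ • v) := hmin h1
        have h3 : H (x₀, x₀) (‖v‖⁻¹ • v, 0) (‖v‖⁻¹ • v)
            = (‖v‖⁻¹) ^ 2 * H (x₀, x₀) (v, 0) v := by
          rw [show ((‖v‖⁻¹ • v, 0) : E × E) = ‖v‖⁻¹ • (v, 0) by simp, map_smul]
          simp only [map_smul, smul_apply, smul_eq_mul]
          ring
        rw [h3] at h2
        calc H (x₀, x₀) (w, 0) w * ‖v‖ ^ 2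
            ≤ (‖v‖⁻¹) ^ 2 * H (x₀, x₀) (v, 0) v * ‖v‖ ^ 2 := by gcongr
          _ = H (x₀, x₀) (v, 0) v := by field_simp
  -- Since `d_x` vanishes along the diagonal, its derivative in the direction `(v, v)` is zero.
  have hanti : ∀ v, H (x₀, x₀) (0, v) = -H (x₀, x₀) (v, 0) := by
    intro v
    have h1 : HasFDerivAt (fun x : E => dfst d (x, x)) (H (x₀, x₀) ∘L
        ((ContinuousLinearMap.id ℝ E).prod (ContinuousLinearMap.id ℝ E))) x₀ :=
      HasFDerivAt.comp (f := fun x : E => (x, x)) x₀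
        ((hd1.contDiffAt (hopen.mem_nhds ⟨hx₀, hx₀⟩)).differentiableAt (by simp)).hasFDerivAt
        ((hasFDerivAt_id x₀).prodMk (hasFDerivAt_id x₀))
    have h2 : HasFDerivAt (fun x : E => dfst d (x, x)) (0 : E →L[ℝ] E →L[ℝ] ℝ) x₀ := by
      refine (hasFDerivAt_const (0 : E →L[ℝ] ℝ) x₀).congr_of_eventuallyEq ?_
      filter_upwards [Metric.isOpen_ball.mem_nhds hx₀] with x hx using hdiag x hx
    have h3 := congrArg (fun A : E →L[ℝ] E →L[ℝ] ℝ => A v) (h1.unique h2)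
    simp only [ContinuousLinearMap.coe_comp, Function.comp_apply, ContinuousLinearMap.prod_apply,
      ContinuousLinearMap.id_apply, zero_apply] at h3
    rw [show ((v, v) : E × E) = (v, 0) + (0, v) by simp, map_add] at h3
    exact (neg_eq_of_add_eq_zero_right h3).symm
  -- With `a = b / 2` the tolerance `b / 4 = a / 2` is what `approx` requires, and it leaves both
  -- quadratic forms above `3b / 4 ≥ a`.
  have hev : ∀ᶠ z in 𝓝 (x₀, x₀), ‖H z - H (x₀, x₀)‖ < b / 4 :=
    (tendsto_iff_norm_sub_tendsto_zero.1 hHc).eventually_lt_const (by positivity)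
  obtain ⟨r, hr, hrH⟩ := Metric.eventually_nhds_iff.1 hev
  have hsub : Metric.ball x₀ (min r ρ) ⊆ Metric.ball x₀ ρ :=
    Metric.ball_subset_ball (min_le_right _ _)
  have hclose : ∀ z ∈ Metric.ball x₀ (min r ρ) ×ˢ Metric.ball x₀ (min r ρ),
      ‖H z - H (x₀, x₀)‖ ≤ b / 4 := by
    rintro ⟨x, y⟩ ⟨hx, hy⟩
    refine (hrH ?_).le
    rw [Prod.dist_eq]
    exact max_lt ((Metric.mem_ball.1 hx).trans_le (min_le_left _ _))
      ((Metric.mem_ball.1 hy).trans_le (min_le_left _ _))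
  have hquad : ∀ z ∈ Metric.ball x₀ (min r ρ) ×ˢ Metric.ball x₀ (min r ρ), ∀ w : E × E, ∀ v : E,
      ‖w‖ ≤ ‖v‖ → |H z w v - H (x₀, x₀) w v| ≤ b / 4 * ‖v‖ ^ 2 := by
    intro z hz w v hwv
    have h1 := (H z - H (x₀, x₀)).le_opNorm₂ w v
    rw [Real.norm_eq_abs] at h1
    calc |H z w v - H (x₀, x₀) w v| ≤ ‖H z - H (x₀, x₀)‖ * ‖w‖ * ‖v‖ := h1
      _ ≤ b / 4 * ‖v‖ * ‖v‖ := by gcongr; exact hclose z hz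
      _ = b / 4 * ‖v‖ ^ 2 := by ring
  refine ⟨min r ρ, b / 2, min_le_right _ _, lt_min hr hρ, half_pos hb, hd.mono
    (Set.prod_mono hsub hsub), fun x hx => hdiag x (hsub hx), fun z hz v => ?_,
    fun z hz v => ?_, H (x₀, x₀) ∘L .inr ℝ E E, fun v => ?_, fun z hz => ?_⟩
  · have h1 := (abs_le.1 (hquad z hz (v, 0) v (by simp))).1
    have h2 := hbH v
    nlinarith [sq_nonneg ‖v‖]
  · have h1 := (abs_le.1 (hquad z hz (0, v) v (by simp))).2
    have h2 := hbH v
    rw [hanti v, neg_apply] at h1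
    nlinarith [sq_nonneg ‖v‖]
  · have h2 := hbH v
    simp only [ContinuousLinearMap.coe_comp, Function.comp_apply, ContinuousLinearMap.inr_apply,
      hanti v, neg_apply, neg_neg]
    nlinarith [sq_nonneg ‖v‖]
  · rw [← ContinuousLinearMap.sub_comp]
    refine (ContinuousLinearMap.opNorm_comp_le _ _).trans ?_
    have h1 := ContinuousLinearMap.norm_inr_le_one ℝ E E
    calc ‖H z - H (x₀, x₀)‖ * ‖ContinuousLinearMap.inr ℝ E E‖ ≤ b / 4 * 1 := by
          gcongr; exact hclose z hz
      _ ≤ b / 2 / 2 := by linarith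

end CalabiLegendre

end

/-! ### Conjugate spaces, the identity theorem on the diagonal, holomorphic functions -/

noncomputable section

set_option maxSynthPendingDepth 3

namespace CalabiLegendre

/-- The complex conjugate of a complex normed space. -/
def Conj (E : Type*) : Type _ := E

section Conj

variable {E : Type*} [NormedAddCommGroup E] [NormedSpace ℂ E]

instance : NormedAddCommGroup (Conj E) := inferInstanceAs (NormedAddCommGroup E)

instance : Module ℂ (Conj E) := Module.compHom E (starRingEnd ℂ)

instance : NormedSpace ℂ (Conj E) where
  norm_smul_le c x := by
    have : ‖(starRingEnd ℂ c • (show E from x) : E)‖ ≤ ‖c‖ * ‖(show E from x)‖ := by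
      rw [norm_smul, RCLike.norm_conj]
    exact this

/-- The identity map of a complex space to its conjugate. -/
def toConj : E ≃L[ℝ] Conj E where
  toFun x := x
  invFun x := x
  map_add' _ _ := rfl
  map_smul' c x := by
    change c • x = starRingEnd ℂ (c : ℂ) • x
    rw [Complex.conj_ofReal]; rfl
  left_inv _ := rfl
  right_inv _ := rfl
  continuous_toFun := continuous_id
  continuous_invFun := continuous_id

theorem toConj_smul (c : ℂ) (x : E) : toConj (c • x) = (starRingEnd ℂ c) • toConj x := by
  change c • x = starRingEnd ℂ (starRingEnd ℂ c) • x
  rw [Complex.conj_conj]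

theorem smul_toConj (c : ℂ) (x : E) : c • toConj x = toConj ((starRingEnd ℂ c) • x) := by
  rw [toConj_smul, Complex.conj_conj]

/-- The product of a set with its conjugate. -/
def sqConj (B : Set E) : Set (E × Conj E) := B ×ˢ (toConj.symm ⁻¹' B)

theorem mem_sqConj {B : Set E} {x y : E} : (x, toConj y) ∈ sqConj B ↔ x ∈ B ∧ y ∈ B := Iff.rfl

theorem isOpen_sqConj {B : Set E} (hB : IsOpen B) : IsOpen (sqConj B) :=
  hB.prod (hB.preimage toConj.symm.continuous)

/-- Identity theorem: a holomorphic function on `B × B̄`, `B` open and convex, is determined by its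
values on the diagonal. -/
theorem eq_zero_of_diag {Z : Type*} [NormedAddCommGroup Z] [NormedSpace ℂ Z] [CompleteSpace Z]
    {B : Set E} (hB : IsOpen B) (hBc : Convex ℝ B) {f : E × Conj E → Z}
    (hf : DifferentiableOn ℂ f (sqConj B)) (h0 : ∀ x ∈ B, f (x, toConj x) = 0) {p q : E}
    (hp : p ∈ B) (hq : q ∈ B) : f (p, toConj q) = 0 := by
  set c := (2⁻¹ : ℝ) • (p + q) with hc
  set v := (2⁻¹ : ℝ) • (p - q) with hv
  have hpc : c + v = p := by rw [hc, hv]; module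
  have hqc : c - v = q := by rw [hc, hv]; module
  -- A complex line adapted to the two points: it lies in the diagonal for real `b` and passes
  -- through `(p, q̄)` at `b = -i`.
  let l : ℂ → E × Conj E := fun b => (c + (Complex.I * b) • v, toConj c + (-(Complex.I * b)) • toConj v)
  have hl2 : ∀ b, l b = (c + (Complex.I * b) • v,
      toConj (c + (Complex.I * starRingEnd ℂ b) • v)) := by
    intro b
    simp only [l, smul_toConj, map_add, map_neg, map_mul, Complex.conj_I, neg_mul, neg_neg]
  have hld : Differentiable ℂ l := by
    refine Differentiable.prodMk ?_ ?_
    · exact (((differentiable_id.const_mul Complex.I).smul_const v).const_add c)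
    · exact (((differentiable_id.const_mul Complex.I).neg.smul_const (toConj v)).const_add _)
  have hcB : c ∈ B := by
    have := hBc hp hq (a := 2⁻¹) (b := 2⁻¹) (by norm_num) (by norm_num) (by norm_num)
    rwa [← smul_add] at this
  set S : Set ℂ := l ⁻¹' sqConj B with hS
  have hSo : IsOpen S := (isOpen_sqConj hB).preimage hld.continuous
  have hSmem : ∀ b, b ∈ S ↔ c + (Complex.I * b) • v ∈ B ∧
      c + (Complex.I * starRingEnd ℂ b) • v ∈ B := by
    intro b
    rw [hS, Set.mem_preimage, hl2, mem_sqConj]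
  -- Convexity of `B` makes the domain `S` of `f ∘ l` convex, hence connected, so the identity
  -- theorem in one variable carries the vanishing on the real points near `0` to `-i`.
  have hSc : Convex ℝ S := by
    intro b hb b' hb' s t hs ht hst
    rw [hSmem] at *
    have key : ∀ w w' : ℂ, c + (Complex.I * (s • w + t • w')) • v =
        s • (c + (Complex.I * w) • v) + t • (c + (Complex.I * w') • v) := by
      intro w w'
      have : c = s • c + t • c := by rw [← add_smul, hst, one_smul]
      rw [mul_add, add_smul, mul_smul_comm, mul_smul_comm, smul_assoc, smul_assoc]
      nth_rewrite 1 [this]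
      module
    refine ⟨?_, ?_⟩
    · rw [key]; exact hBc hb.1 hb'.1 hs ht hst
    · have : starRingEnd ℂ (s • b + t • b') = s • starRingEnd ℂ b + t • starRingEnd ℂ b' := by
        simp [Complex.real_smul]
      rw [this, key]; exact hBc hb.2 hb'.2 hs ht hst
  have hS0 : (0 : ℂ) ∈ S := by rw [hSmem]; simpa using hcB
  have hSI : -Complex.I ∈ S := by
    rw [hSmem]
    refine ⟨?_, ?_⟩
    · rw [mul_neg, Complex.I_mul_I, neg_neg, one_smul, hpc]; exact hp
    · rw [map_neg, Complex.conj_I, neg_neg, Complex.I_mul_I, neg_smul, one_smul, ← sub_eq_add_neg,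
        hqc]; exact hq
  have hk : AnalyticOnNhd ℂ (f ∘ l) S :=
    (hf.comp hld.differentiableOn fun b hb => hb).analyticOnNhd hSo
  have hreal : ∀ r : ℝ, (r : ℂ) ∈ S → (f ∘ l) r = 0 := by
    intro r hr
    rw [Function.comp_apply, hl2, Complex.conj_ofReal]
    refine h0 _ ?_
    rw [hSmem] at hr
    exact hr.1
  have hfreq : ∃ᶠ z in 𝓝[≠] (0 : ℂ), (f ∘ l) z = 0 := by
    have h1 : Filter.Tendsto (fun n : ℕ => (((1 / ((n : ℝ) + 1) : ℝ)) : ℂ)) Filter.atTop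
        (𝓝[≠] (0 : ℂ)) := by
      refine tendsto_nhdsWithin_iff.2 ⟨?_, Filter.Eventually.of_forall fun n => ?_⟩
      · have : Filter.Tendsto (fun n : ℕ => (((1 / ((n : ℝ) + 1) : ℝ)) : ℂ)) Filter.atTop
            (𝓝 ((0 : ℝ) : ℂ)) := (Complex.continuous_ofReal.tendsto 0).comp
          (tendsto_one_div_add_atTop_nhds_zero_nat (𝕜 := ℝ))
        rwa [Complex.ofReal_zero] at this
      · simp only [Set.mem_compl_iff, Set.mem_singleton_iff, Complex.ofReal_eq_zero]
        positivity
    refine h1.frequently (Filter.Eventually.frequently ?_)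
    filter_upwards [h1.eventually (mem_nhdsWithin_of_mem_nhds (hSo.mem_nhds hS0))] with n hn
    exact hreal _ hn
  have := hk.eqOn_zero_of_preconnected_of_frequently_eq_zero hSc.isPreconnected hS0 hfreq hSI
  rw [Function.comp_apply, hl2] at this
  rw [map_neg, Complex.conj_I, neg_neg, mul_neg, Complex.I_mul_I, neg_neg, one_smul, neg_smul,
    one_smul, ← sub_eq_add_neg, hpc, hqc] at this
  exact this

end Conj

section ComplexLinearPart

variable {X Z : Type*} [NormedAddCommGroup X] [NormedSpace ℂ X] [NormedAddCommGroup Z]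
  [NormedSpace ℂ Z]

/-- The complex linear part `v ↦ (L v - i L (i v)) / 2` of a real linear map. -/
def complexPart (X Z : Type*) [NormedAddCommGroup X] [NormedSpace ℂ X] [NormedAddCommGroup Z]
    [NormedSpace ℂ Z] : (X →L[ℝ] Z) →L[ℝ] (X →L[ℂ] Z) :=
  LinearMap.mkContinuous
    { toFun := fun L =>
        { toFun := fun v => (2⁻¹ : ℂ) • (L v - Complex.I • L (Complex.I • v))
          map_add' := fun v w => by simp only [smul_add, map_add]; module
          map_smul' := fun c v => by
            have h : ∀ w : X, L (c • w) = c.re • L w + c.im • L (Complex.I • w) := fun w => by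
              rw [← map_smul, ← map_smul, ← map_add]
              congr 1
              nth_rewrite 1 [← Complex.re_add_im c]
              rw [add_smul, mul_smul, Complex.coe_smul, Complex.coe_smul]
            rw [h, smul_comm Complex.I c v, h, smul_smul Complex.I Complex.I v, Complex.I_mul_I,
              neg_one_smul, map_neg, RingHom.id_apply]
            simp only [← Complex.coe_smul]
            have hI : Complex.I * Complex.I = -1 := Complex.I_mul_I
            have hc := Complex.re_add_im c
            match_scalars
            · linear_combination (1 / 2) * hc
            · linear_combination (-Complex.I / 2) * hc + (c.im / 2 : ℂ) * hI
          cont := by fun_prop }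
      map_add' := fun L M => by ext v; simp only [add_apply, smul_add, ContinuousLinearMap.coe_mk', LinearMap.coe_mk, AddHom.coe_mk]; module
      map_smul' := fun r L => by
        ext v
        simp only [smul_apply, ContinuousLinearMap.coe_mk', LinearMap.coe_mk, AddHom.coe_mk, RingHom.id_apply]
        rw [smul_comm Complex.I r, ← smul_sub, smul_comm r] } 1 fun L => by
    refine ContinuousLinearMap.opNorm_le_bound _ (by positivity) fun v => ?_
    change ‖(2⁻¹ : ℂ) • (L v - Complex.I • L (Complex.I • v))‖ ≤ 1 * ‖L‖ * ‖v‖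
    have h1 := L.le_opNorm v
    have h2 := L.le_opNorm (Complex.I • v)
    have h3 := norm_sub_le (L v) (Complex.I • L (Complex.I • v))
    rw [norm_smul, Complex.norm_I, one_mul] at h3
    rw [norm_smul, Complex.norm_I, one_mul] at h2
    rw [norm_smul]
    norm_num
    linarith

theorem complexPart_apply (L : X →L[ℝ] Z) (v : X) :
    complexPart X Z L v = (2⁻¹ : ℂ) • (L v - Complex.I • L (Complex.I • v)) := rfl

theorem complexPart_restrictScalars (L : X →L[ℂ] Z) :
    complexPart X Z (L.restrictScalars ℝ) = L := by
  ext v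
  rw [complexPart_apply]
  simp only [ContinuousLinearMap.coe_restrictScalars', map_smul, smul_smul, Complex.I_mul_I]
  module

theorem norm_complexPart_le (L : X →L[ℝ] Z) : ‖complexPart X Z L‖ ≤ ‖L‖ := by
  have := (LinearMap.mkContinuous_norm_le _ zero_le_one _ : ‖complexPart X Z‖ ≤ 1)
  exact ((complexPart X Z).le_opNorm L).trans (mul_le_of_le_one_left (norm_nonneg L) this)

/-- Real-analytic functions with complex linear derivative. -/
def HolOn (f : X → Z) (O : Set X) : Prop :=
  ContDiffOn ℝ ω f O ∧ DifferentiableOn ℂ f O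

namespace HolOn

variable {f : X → Z} {O : Set X}

/-- `complexPart` is a continuous linear left inverse of restriction of scalars. Through it the
complex derivative inherits real analyticity from the real one. -/
theorem fderiv_eq (h : HolOn f O) (hO : IsOpen O) {x : X} (hx : x ∈ O) :
    fderiv ℂ f x = complexPart X Z (fderiv ℝ f x) := by
  have := (h.2.differentiableAt (hO.mem_nhds hx)).hasFDerivAt.restrictScalars ℝ
  rw [this.fderiv, complexPart_restrictScalars]

theorem fderiv_real_eq (h : HolOn f O) (hO : IsOpen O) {x : X} (hx : x ∈ O) :
    fderiv ℝ f x = (fderiv ℂ f x).restrictScalars ℝ :=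
  ((h.2.differentiableAt (hO.mem_nhds hx)).hasFDerivAt.restrictScalars ℝ).fderiv

/-- The derivative of a holomorphic function is holomorphic. -/
theorem fderiv (h : HolOn f O) (hO : IsOpen O) : HolOn (fderiv ℂ f) O := by
  have h1 : ContDiffOn ℝ ω (_root_.fderiv ℝ f) O := h.1.fderiv_of_isOpen hO (by simp)
  have h2 : ContDiffOn ℝ ω (_root_.fderiv ℂ f) O :=
    ((complexPart X Z).contDiff.comp_contDiffOn h1).congr fun x hx => h.fderiv_eq hO hx
  refine ⟨h2, fun x hx => DifferentiableAt.differentiableWithinAt ?_⟩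
  have h3 : DifferentiableAt ℝ (_root_.fderiv ℂ f) x :=
    (h2.contDiffAt (hO.mem_nhds hx)).differentiableAt (by simp)
  have hfx : ContDiffAt ℝ ω f x := h.1.contDiffAt (hO.mem_nhds hx)
  have hsym : IsSymmSndFDerivAt ℝ f x := hfx.isSymmSndFDerivAt (by simp)
  have h4 : _root_.fderiv ℝ (_root_.fderiv ℝ f) x =
      (ContinuousLinearMap.restrictScalarsL ℂ X Z ℝ ℝ) ∘L (_root_.fderiv ℝ (_root_.fderiv ℂ f) x) := by
    have h5 := (ContinuousLinearMap.restrictScalarsL ℂ X Z ℝ ℝ).hasFDerivAt.comp x h3.hasFDerivAt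
    refine (h5.congr_of_eventuallyEq ?_).fderiv
    filter_upwards [hO.mem_nhds hx] with y hy using h.fderiv_real_eq hO hy
  have h6 : ∀ v w, _root_.fderiv ℝ (_root_.fderiv ℂ f) x v w =
      _root_.fderiv ℝ (_root_.fderiv ℂ f) x w v := by
    intro v w
    have := hsym v w
    rw [h4] at this
    exact this
  -- Symmetry of the real second derivative moves the scalar to the other argument, in which the map
  -- is complex linear by construction.
  have h7 : ∀ (c : ℂ) v, _root_.fderiv ℝ (_root_.fderiv ℂ f) x (c • v) =
      c • _root_.fderiv ℝ (_root_.fderiv ℂ f) x v := by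
    intro c v
    ext w
    rw [h6, map_smul, smul_apply, h6]
  let A : X →L[ℂ] (X →L[ℂ] Z) :=
    { toFun := _root_.fderiv ℝ (_root_.fderiv ℂ f) x
      map_add' := map_add _
      map_smul' := h7
      cont := (_root_.fderiv ℝ (_root_.fderiv ℂ f) x).cont }
  exact (hasFDerivAt_of_restrictScalars ℝ h3.hasFDerivAt
    (show A.restrictScalars ℝ = _ from ContinuousLinearMap.ext fun _ => rfl)).differentiableAt

theorem mono {O' : Set X} (h : HolOn f O) (hO : O' ⊆ O) : HolOn f O' :=
  ⟨h.1.mono hO, h.2.mono hO⟩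

theorem clm_comp {W : Type*} [NormedAddCommGroup W] [NormedSpace ℂ W] (L : Z →L[ℂ] W)
    (h : HolOn f O) : HolOn (fun x => L (f x)) O :=
  ⟨(L.restrictScalars ℝ).contDiff.comp_contDiffOn h.1,
    L.differentiable.comp_differentiableOn h.2⟩

end HolOn

theorem _root_.AnalyticOnNhd.holOn [CompleteSpace Z] {f : X → Z} {O : Set X} (h : AnalyticOnNhd ℂ f O) :
    HolOn f O :=
  ⟨fun x hx => ((h x hx).restrictScalars (𝕜 := ℝ)).contDiffAt.contDiffWithinAt,
    h.differentiableOn⟩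

end ComplexLinearPart

end CalabiLegendre

end

/-! ### Complexification of real-analytic functions -/

noncomputable section

set_option maxSynthPendingDepth 3

namespace CalabiLegendre

section Complexification

variable {E Z : Type*} [NormedAddCommGroup E] [NormedSpace ℂ E] [NormedAddCommGroup Z]
  [NormedSpace ℂ Z]

/-- The identity map of the conjugate of a complex space to the space. -/
def fromConj (E : Type*) [NormedAddCommGroup E] [NormedSpace ℂ E] : Conj E →L[ℝ] E :=
  (toConj (E := E)).symm

theorem fromConj_toConj (x : E) : fromConj E (toConj x) = x := rfl

/-- The complex linear extension of a real linear map on `E` to `E × Ē`. -/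
def complexifyLinear (E Z : Type*) [NormedAddCommGroup E] [NormedSpace ℂ E] [NormedAddCommGroup Z]
    [NormedSpace ℂ Z] : (E →L[ℝ] Z) →L[ℝ] ((E × Conj E) →L[ℂ] Z) :=
  LinearMap.mkContinuous
    { toFun := fun L => complexPart E Z L ∘L .fst ℂ E (Conj E) +
        complexPart (Conj E) Z (L ∘L fromConj E) ∘L .snd ℂ E (Conj E)
      map_add' := fun L M => by
        ext v <;> simp [ContinuousLinearMap.add_comp]
      map_smul' := fun r L => by
        ext v <;> simp [ContinuousLinearMap.smul_comp] } 2 fun L => by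
    refine ContinuousLinearMap.opNorm_le_bound _ (by positivity) fun v => ?_
    have h1 := (complexPart E Z L).le_opNorm v.1
    have h2 := (complexPart (Conj E) Z (L ∘L fromConj E)).le_opNorm v.2
    have h3 := norm_complexPart_le L
    have h4 := norm_complexPart_le (L ∘L fromConj E)
    have h5 : ‖L ∘L fromConj E‖ ≤ ‖L‖ :=
      ContinuousLinearMap.opNorm_le_bound _ (norm_nonneg _) fun w => L.le_opNorm (fromConj E w)
    have h6 := norm_fst_le v
    have h7 := norm_snd_le v
    calc ‖complexPart E Z L v.1 + complexPart (Conj E) Z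
          (L ∘L fromConj E) v.2‖
        ≤ ‖L‖ * ‖v‖ + ‖L‖ * ‖v‖ := by
          refine (norm_add_le _ _).trans (add_le_add (h1.trans ?_) (h2.trans ?_))
          · gcongr
          · gcongr
            exact h4.trans h5
      _ = 2 * ‖L‖ * ‖v‖ := by ring

theorem complexifyLinear_apply (L : E →L[ℝ] Z) (v : E × Conj E) :
    complexifyLinear E Z L v = complexPart E Z L v.1 +
      complexPart (Conj E) Z (L ∘L fromConj E) v.2 := rfl

/-- A real linear map is the sum of its complex linear and its antilinear part, and the latter is
complex linear on the conjugate space. -/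
theorem complexifyLinear_diag (L : E →L[ℝ] Z) (v : E) :
    complexifyLinear E Z L (v, toConj v) = L v := by
  rw [complexifyLinear_apply, complexPart_apply, complexPart_apply, smul_toConj, Complex.conj_I]
  simp only [ContinuousLinearMap.coe_comp, Function.comp_apply, fromConj_toConj, neg_smul, map_neg]
  module

theorem norm_complexifyLinear_le (L : E →L[ℝ] Z) : ‖complexifyLinear E Z L‖ ≤ 2 * ‖L‖ := by
  have := (LinearMap.mkContinuous_norm_le _ zero_le_two _ : ‖complexifyLinear E Z‖ ≤ 2)
  exact ((complexifyLinear E Z).le_opNorm L).trans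
    (mul_le_mul_of_nonneg_right this (norm_nonneg _))

/-- The complex multilinear extension of a real multilinear map on `E` to `E × Ē`. -/
def complexifyMultilinear (E Z : Type*) [NormedAddCommGroup E] [NormedSpace ℂ E]
    [NormedAddCommGroup Z] [NormedSpace ℂ Z] :
    ∀ n : ℕ, (E [×n]→L[ℝ] Z) →L[ℝ] ((E × Conj E) [×n]→L[ℂ] Z)
  | 0 => ((continuousMultilinearCurryFin0 ℂ (E × Conj E) Z).symm.toContinuousLinearEquiv :
        Z →L[ℂ] _).restrictScalars ℝ ∘L
      ((continuousMultilinearCurryFin0 ℝ E Z).toContinuousLinearEquiv : _ →L[ℝ] Z)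
  | n + 1 => ((continuousMultilinearCurryLeftEquiv ℂ (fun _ : Fin (n + 1) => E × Conj E)
        Z).symm.toContinuousLinearEquiv : _ →L[ℂ] _).restrictScalars ℝ ∘L
      complexifyLinear E ((E × Conj E) [×n]→L[ℂ] Z) ∘L
      (ContinuousLinearMap.compL ℝ E (E [×n]→L[ℝ] Z) ((E × Conj E) [×n]→L[ℂ] Z)
        (complexifyMultilinear E Z n)) ∘L
      ((continuousMultilinearCurryLeftEquiv ℝ (fun _ : Fin (n + 1) => E)
        Z).toContinuousLinearEquiv : _ →L[ℝ] _)

theorem complexifyMultilinear_succ_apply {n : ℕ} (f : E [×(n + 1)]→L[ℝ] Z) :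
    complexifyMultilinear E Z (n + 1) f =
      (continuousMultilinearCurryLeftEquiv ℂ (fun _ : Fin (n + 1) => E × Conj E) Z).symm
        (complexifyLinear E ((E × Conj E) [×n]→L[ℂ] Z) ((complexifyMultilinear E Z n) ∘L
          (continuousMultilinearCurryLeftEquiv ℝ (fun _ : Fin (n + 1) => E) Z f))) := rfl

theorem complexifyMultilinear_diag {n : ℕ} (f : E [×n]→L[ℝ] Z) (v : Fin n → E) :
    complexifyMultilinear E Z n f (fun j => (v j, toConj (v j))) = f v := by
  induction n with
  | zero =>
    change f 0 = f v
    rw [Subsingleton.elim v 0]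
  | succ n ih =>
    rw [complexifyMultilinear_succ_apply, continuousMultilinearCurryLeftEquiv_symm_apply,
      complexifyLinear_diag]
    change complexifyMultilinear E Z n _ (fun j : Fin n => (Fin.tail v j, toConj (Fin.tail v j))) = _
    rw [ih]
    change f (Fin.cons (v 0) (Fin.tail v)) = f v
    rw [Fin.cons_self_tail]

/-- Each argument is split into two parts, which costs a factor `2` per argument. For a power series
this at most halves the guaranteed radius of convergence, as used in `exists_complexification`. -/
theorem norm_complexifyMultilinear_le {n : ℕ} (f : E [×n]→L[ℝ] Z) :
    ‖complexifyMultilinear E Z n f‖ ≤ 2 ^ n * ‖f‖ := by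
  induction n with
  | zero =>
    have h1 : complexifyMultilinear E Z 0 f =
      (continuousMultilinearCurryFin0 ℂ (E × Conj E) Z).symm
        (continuousMultilinearCurryFin0 ℝ E Z f) := rfl
    rw [h1, LinearIsometryEquiv.norm_map, LinearIsometryEquiv.norm_map]
    simp
  | succ n ih =>
    rw [complexifyMultilinear_succ_apply, LinearIsometryEquiv.norm_map]
    refine (norm_complexifyLinear_le _).trans ?_
    have : ‖(complexifyMultilinear E Z n) ∘L
        ((continuousMultilinearCurryLeftEquiv ℝ (fun _ : Fin (n + 1) => E) Z f))‖ ≤ 2 ^ n * ‖f‖ := by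
      refine ContinuousLinearMap.opNorm_le_bound _ (by positivity) fun v => (ih _).trans ?_
      rw [mul_assoc]
      gcongr
      rw [← (continuousMultilinearCurryLeftEquiv ℝ (fun _ : Fin (n + 1) => E) Z).norm_map f]
      exact ContinuousLinearMap.le_opNorm _ v
    calc _ ≤ 2 * (2 ^ n * ‖f‖) := by gcongr
      _ = 2 ^ (n + 1) * ‖f‖ := by ring

/-- A real-analytic function on `E` extends to a holomorphic function on a neighbourhood of the
diagonal in `E × Ē`. -/
theorem exists_complexification [CompleteSpace Z] {F : E → Z} {x₀ : E} (hF : AnalyticAt ℝ F x₀) :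
    ∃ f : E × Conj E → Z, AnalyticAt ℂ f (x₀, toConj x₀) ∧
      ∀ᶠ x in 𝓝 x₀, f (x, toConj x) = F x := by
  obtain ⟨p, r, hp⟩ := hF
  let q : FormalMultilinearSeries ℂ (E × Conj E) Z := fun n => complexifyMultilinear E Z n (p n)
  obtain ⟨s, hs0, hsr⟩ := ENNReal.lt_iff_exists_nnreal_btwn.1 (hp.r_pos.trans_le hp.r_le)
  have hs0' : 0 < s := by exact_mod_cast hs0
  obtain ⟨C, hC, hpC⟩ := p.norm_mul_pow_le_of_lt_radius hsr
  have hq : ((s / 2 : NNReal) : ℝ≥0∞) ≤ q.radius := by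
    refine q.le_radius_of_bound C fun n => ?_
    have h1 := norm_complexifyMultilinear_le (p n)
    calc ‖q n‖ * ((s / 2 : NNReal) : ℝ) ^ n ≤ (2 ^ n * ‖p n‖) * ((s / 2 : NNReal) : ℝ) ^ n := by
          gcongr
      _ = ‖p n‖ * (s : ℝ) ^ n := by
          rw [NNReal.coe_div, div_pow, NNReal.coe_ofNat]; field_simp
      _ ≤ C := hpC n
  have hqpos : 0 < q.radius := lt_of_lt_of_le (by exact_mod_cast half_pos hs0') hq
  have hball := q.hasFPowerSeriesOnBall hqpos
  refine ⟨fun z => q.sum (z - (x₀, toConj x₀)), ?_, ?_⟩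
  · refine AnalyticAt.fun_comp (g := q.sum) ?_ (by fun_prop)
    rw [sub_self]
    exact hball.analyticAt
  · filter_upwards [hp.hasFPowerSeriesAt.eventually_hasSum_sub] with x hx
    have h1 : (x, toConj x) - (x₀, toConj x₀) = (x - x₀, toConj (x - x₀)) := by
      rw [map_sub, Prod.mk_sub_mk]
    rw [h1, FormalMultilinearSeries.sum, ← hx.tsum_eq]
    refine tsum_congr fun n => ?_
    exact complexifyMultilinear_diag (p n) fun _ => x - x₀

end Complexification

/-! ### The holomorphic Poincaré lemma with parameters -/

section Average

open MeasureTheory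

variable {X Y W Z : Type*} [NormedAddCommGroup X] [NormedSpace ℂ X] [NormedAddCommGroup Y]
  [NormedSpace ℂ Y] [NormedAddCommGroup W] [NormedSpace ℂ W] [CompleteSpace W]
  [NormedAddCommGroup Z] [NormedSpace ℂ Z] [CompleteSpace Z]

/-- The dilation of the first factor of a product. -/
def scaleFst (X Y : Type*) [NormedAddCommGroup X] [NormedSpace ℂ X] [NormedAddCommGroup Y]
    [NormedSpace ℂ Y] (t : ℝ) : (X × Y) →L[ℂ] (X × Y) :=
  (t : ℂ) • (.inl ℂ X Y ∘L .fst ℂ X Y) + .inr ℂ X Y ∘L .snd ℂ X Y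

theorem scaleFst_apply (t : ℝ) (z : X × Y) : scaleFst X Y t z = (t • z.1, z.2) := by
  simp [scaleFst]

theorem continuous_scaleFst : Continuous (scaleFst X Y) := by
  unfold scaleFst
  exact ((Complex.continuous_ofReal.smul continuous_const).add continuous_const)

theorem norm_scaleFst_le {t : ℝ} (ht : t ∈ Set.Icc (0 : ℝ) 1) : ‖scaleFst X Y t‖ ≤ 1 := by
  refine ContinuousLinearMap.opNorm_le_bound _ zero_le_one fun z => ?_
  rw [scaleFst_apply, one_mul, Prod.norm_def, norm_smul, Real.norm_of_nonneg ht.1]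
  refine max_le ?_ (norm_snd_le z)
  exact (mul_le_of_le_one_left (norm_nonneg _) ht.2).trans (norm_fst_le z)

/-- Averages of holomorphic functions over the dilations of the first factor are holomorphic. -/
theorem analyticAt_average {f : X × Y → W} (hf : AnalyticAt ℂ f 0) :
    AnalyticAt ℂ (fun z => ∫ t in (0 : ℝ)..1, f (t • z.1, z.2)) (0 : X × Y) := by
  obtain ⟨p, r, hp⟩ := hf
  have hcont : ∀ n, Continuous fun t => (p n).compContinuousLinearMap
      fun _ => scaleFst X Y t := fun n =>
    (ContinuousMultilinearMap.compContinuousLinearMapLRight (p n)).cont.comp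
      (continuous_pi fun _ => continuous_scaleFst)
  -- The power series of the average is the average of the power series. The dilations have norm at
  -- most `1`, so no radius is lost, and dominated convergence exchanges sum and integral.
  let q : FormalMultilinearSeries ℂ (X × Y) W := fun n =>
    ∫ t in (0 : ℝ)..1, (p n).compContinuousLinearMap fun _ => scaleFst X Y t
  have hbound : ∀ n, ∀ t ∈ Set.Icc (0 : ℝ) 1,
      ‖(p n).compContinuousLinearMap fun _ => scaleFst X Y t‖ ≤ ‖p n‖ := by
    intro n t ht
    refine (ContinuousMultilinearMap.norm_compContinuousLinearMap_le _ _).trans ?_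
    refine mul_le_of_le_one_right (norm_nonneg _) ?_
    exact Finset.prod_le_one (fun _ _ => norm_nonneg _) fun _ _ => norm_scaleFst_le ht
  have hqn : ∀ n, ‖q n‖ ≤ ‖p n‖ := by
    intro n
    have := intervalIntegral.norm_integral_le_of_norm_le_const (a := (0 : ℝ)) (b := 1)
      (C := ‖p n‖) (f := fun t => (p n).compContinuousLinearMap fun _ => scaleFst X Y t)
      fun t ht => hbound n t (by
        rw [Set.uIoc_of_le zero_le_one] at ht; exact ⟨ht.1.le, ht.2⟩)
    simpa using this
  have hrad : p.radius ≤ q.radius := by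
    refine ENNReal.le_of_forall_nnreal_lt fun s hs => ?_
    obtain ⟨C, hC, hpC⟩ := p.norm_mul_pow_le_of_lt_radius hs
    exact q.le_radius_of_bound C fun n =>
      (mul_le_mul_of_nonneg_right (hqn n) (by positivity)).trans (hpC n)
  refine ⟨q, r, ⟨hp.r_le.trans hrad, hp.r_pos, fun {z} hz => ?_⟩⟩
  have hmem : ∀ t ∈ Set.Icc (0 : ℝ) 1, scaleFst X Y t z ∈ Metric.eball (0 : X × Y) r := by
    intro t ht
    rw [mem_eball_zero_iff] at hz ⊢
    refine lt_of_le_of_lt ?_ hz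
    rw [enorm_le_iff_norm_le]
    exact ((scaleFst X Y t).le_opNorm z).trans
      (mul_le_of_le_one_left (norm_nonneg _) (norm_scaleFst_le ht))
  have hq_apply : ∀ n, q n (fun _ => z) = ∫ t in (0 : ℝ)..1, p n fun _ => scaleFst X Y t z := by
    intro n
    have := (ContinuousMultilinearMap.apply ℂ (fun _ : Fin n => X × Y) W
      (fun _ => z)).intervalIntegral_comp_comm (μ := volume) (a := 0) (b := 1)
      ((hcont n).intervalIntegrable 0 1)
    exact this.symm
  have hsummable : Summable fun n => ‖p n‖ * ‖z‖ ^ n := by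
    have : (‖z‖₊ : ℝ≥0∞) < p.radius := by
      rw [mem_eball_zero_iff] at hz
      exact lt_of_lt_of_le hz hp.r_le
    simpa using p.summable_norm_mul_pow this
  have hsum := intervalIntegral.hasSum_integral_of_dominated_convergence
    (μ := volume) (a := (0 : ℝ)) (b := 1)
    (F := fun n t => p n fun _ => scaleFst X Y t z) (f := fun t => f (t • z.1, z.2))
    (fun n _ => ‖p n‖ * ‖z‖ ^ n) (fun n => ?_) (fun n => ?_) ?_ ?_ ?_
  · simp only [zero_add, hq_apply]
    exact hsum
  · refine Continuous.aestronglyMeasurable ?_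
    exact (p n).cont.comp (continuous_pi fun _ =>
      (ContinuousLinearMap.apply ℂ (X × Y) z).continuous.comp continuous_scaleFst)
  · refine Filter.Eventually.of_forall fun t ht => ?_
    rw [Set.uIoc_of_le zero_le_one] at ht
    refine ((p n).le_opNorm _).trans ?_
    simp only [Finset.prod_const, Finset.card_univ, Fintype.card_fin]
    gcongr
    exact ((scaleFst X Y t).le_opNorm z).trans
      (mul_le_of_le_one_left (norm_nonneg _) (norm_scaleFst_le ⟨ht.1.le, ht.2⟩))
  · exact Filter.Eventually.of_forall fun _ _ => hsummable
  · exact intervalIntegrable_const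
  · refine Filter.Eventually.of_forall fun t ht => ?_
    rw [Set.uIoc_of_le zero_le_one] at ht
    have := hp.hasSum (hmem t ⟨ht.1.le, ht.2⟩)
    rw [zero_add, scaleFst_apply] at this
    simpa only [scaleFst_apply] using this

/-- Poincaré lemma at the origin for holomorphic `1`-forms depending holomorphically on parameters. -/
theorem exists_primitive_zero {w : X × Y → (X →L[ℂ] Z)} (hw : AnalyticAt ℂ w 0)
    (hcl : ∀ᶠ z in 𝓝 (0 : X × Y), ∀ a b, fderiv ℂ w z (a, 0) b = fderiv ℂ w z (b, 0) a) :
    ∃ f : X × Y → Z, AnalyticAt ℂ f 0 ∧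
      (∀ᶠ z in 𝓝 (0 : X × Y), ∀ a, fderiv ℂ f z (a, 0) = w z a) ∧ ∀ y, f (0, y) = 0 := by
  -- The homotopy formula. It is jointly analytic by `analyticAt_average`; for fixed `y` it is the
  -- curve integral of the closed form along the segment from `0` to `x`, which gives its derivative
  -- in `x`.
  set f : X × Y → Z := fun z => (∫ t in (0 : ℝ)..1, w (t • z.1, z.2)) z.1 with hf
  have hfa : AnalyticAt ℂ f 0 :=
    ((ContinuousLinearMap.apply ℂ Z).flip.analyticAt_bilinear _).comp₂
      (analyticAt_average hw) analyticAt_fst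
  refine ⟨f, hfa, ?_, fun y => by simp [hf]⟩
  obtain ⟨ρ, hρ, hball⟩ := Metric.eventually_nhds_iff_ball.1
    (hcl.and (hw.eventually_analyticAt.and hfa.eventually_analyticAt))
  filter_upwards [Metric.ball_mem_nhds (0 : X × Y) hρ] with z hz a
  obtain ⟨x, y⟩ := z
  have hxy : ∀ x' ∈ Metric.ball (0 : X) ρ, (x', y) ∈ Metric.ball (0 : X × Y) ρ := by
    intro x' hx'
    rw [mem_ball_zero_iff] at hx' hz ⊢
    exact max_lt hx' ((norm_snd_le (x, y)).trans_lt hz)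
  have hx : x ∈ Metric.ball (0 : X) ρ := by
    rw [mem_ball_zero_iff] at hz ⊢
    exact (norm_fst_le (x, y)).trans_lt hz
  have h1 : HasFDerivWithinAt (fun b => ∫ᶜ x' in .segment 0 b, w (x', y)) (w (x, y))
      (Metric.ball 0 ρ) x := (convex_ball (0 : X)
        ρ).hasFDerivWithinAt_curveIntegral_segment_of_hasFDerivWithinAt_symmetric
    (𝕜 := ℂ) (dω := fun x => (fderiv ℂ w (x, y) ∘L .inl ℂ X Y).restrictScalars ℝ) (fun x' hx' => ?_)
    (fun a ha v _ w' _ => ?_) (Metric.mem_ball_self hρ) hx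
  · have h2 := h1.hasFDerivAt (Metric.isOpen_ball.mem_nhds hx)
    have h3 : (fun b => ∫ᶜ x' in .segment 0 b, w (x', y)) =ᶠ[𝓝 x] fun b => f (b, y) := by
      filter_upwards [Metric.isOpen_ball.mem_nhds hx] with b hb
      have hbc : Continuous fun t : ℝ => (t • b, y) := by fun_prop
      have hint : IntervalIntegrable (fun t : ℝ => w (t • b, y)) volume 0 1 := by
        refine ContinuousOn.intervalIntegrable fun t ht => ContinuousAt.continuousWithinAt ?_
        rw [Set.uIcc_of_le zero_le_one] at ht
        refine ContinuousAt.comp (f := fun t : ℝ => (t • b, y)) ?_ hbc.continuousAt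
        refine (hball _ (hxy _ ?_)).2.1.continuousAt
        rw [mem_ball_zero_iff] at hb ⊢
        rw [norm_smul, Real.norm_of_nonneg ht.1]
        exact (mul_le_of_le_one_left (norm_nonneg _) ht.2).trans_lt hb
      rw [curveIntegral_segment, hf]
      have := (ContinuousLinearMap.apply ℂ Z b).intervalIntegral_comp_comm (μ := volume)
        (a := 0) (b := 1) hint
      simpa [AffineMap.lineMap_apply] using this
    have h4 := h2.congr_of_eventuallyEq h3.symm
    have h5 : HasFDerivAt (fun b => f (b, y)) (fderiv ℂ f (x, y) ∘L .inl ℂ X Y) x :=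
      HasFDerivAt.comp (g := f) (f := fun b => (b, y)) x
        (hball _ hz).2.2.differentiableAt.hasFDerivAt (hasFDerivAt_prodMk_left x y)
    have h6 := congrArg (fun A : X →L[ℂ] Z => A a) (h5.unique h4)
    simpa using h6
  · have h2 : HasFDerivAt (fun x => w (x, y)) (fderiv ℂ w (x', y) ∘L .inl ℂ X Y) x' :=
      (hball _ (hxy x' hx')).2.1.differentiableAt.hasFDerivAt.comp x' (hasFDerivAt_prodMk_left x' y)
    exact (h2.restrictScalars ℝ).hasFDerivWithinAt
  · simpa using (hball _ (hxy a ha)).1 v w'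

/-- Poincaré lemma for holomorphic `1`-forms depending holomorphically on parameters. -/
theorem exists_primitive {w : X × Y → (X →L[ℂ] Z)} {z₀ : X × Y} (hw : AnalyticAt ℂ w z₀)
    (hcl : ∀ᶠ z in 𝓝 z₀, ∀ a b, fderiv ℂ w z (a, 0) b = fderiv ℂ w z (b, 0) a) :
    ∃ f : X × Y → Z, AnalyticAt ℂ f z₀ ∧
      (∀ᶠ z in 𝓝 z₀, ∀ a, fderiv ℂ f z (a, 0) = w z a) ∧ ∀ y, f (z₀.1, y) = 0 := by
  have hadd : Filter.Tendsto (fun z => z + z₀) (𝓝 0) (𝓝 z₀) := by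
    simpa using (continuous_add_const z₀).tendsto 0
  have hsub : Filter.Tendsto (fun z => z - z₀) (𝓝 z₀) (𝓝 0) := by
    simpa using (continuous_sub_right z₀).tendsto z₀
  obtain ⟨f, hf, hfw, hf0⟩ := exists_primitive_zero (w := fun z => w (z + z₀))
    (AnalyticAt.fun_comp (g := w) (by simpa using hw) (by fun_prop)) (by
      filter_upwards [hadd.eventually hcl] with z hz a b
      rw [fderiv_comp_add_right]
      exact hz a b)
  refine ⟨fun z => f (z - z₀), AnalyticAt.fun_comp (g := f) (by simpa using hf) (by fun_prop), ?_,
    fun y => ?_⟩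
  · filter_upwards [hsub.eventually hfw] with z hz a
    simp only [sub_eq_add_neg] at hz ⊢
    rw [fderiv_comp_add_right]
    simpa using hz a
  · have : (z₀.1, y) - z₀ = (0, y - z₀.2) := by ext <;> simp
    simpa [this] using hf0 (y - z₀.2)

end Average

end CalabiLegendre

end

/-! ### Polarized potentials on a ball and their diastasis -/

noncomputable section

set_option maxSynthPendingDepth 3

namespace CalabiLegendre

section HolSecond

variable {X Z : Type*} [NormedAddCommGroup X] [NormedSpace ℂ X] [NormedAddCommGroup Z]
  [NormedSpace ℂ Z] {f : X → Z} {O : Set X}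

theorem HolOn.hasFDerivAt_fderiv (h : HolOn f O) (hO : IsOpen O) {z : X} (hz : z ∈ O) :
    HasFDerivAt (_root_.fderiv ℂ f) (_root_.fderiv ℂ (_root_.fderiv ℂ f) z) z :=
  ((h.fderiv hO).2.differentiableAt (hO.mem_nhds hz)).hasFDerivAt

theorem HolOn.hasFDerivAt_fderiv_apply (h : HolOn f O) (hO : IsOpen O) {z : X} (hz : z ∈ O)
    (w : X) : HasFDerivAt (fun z => _root_.fderiv ℂ f z w)
      ((_root_.fderiv ℂ (_root_.fderiv ℂ f) z).flip w) z :=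
  (ContinuousLinearMap.apply ℂ Z w).hasFDerivAt.comp z (h.hasFDerivAt_fderiv hO hz)

theorem HolOn.fderiv_fderiv_symm (h : HolOn f O) (hO : IsOpen O) {z : X} (hz : z ∈ O) (v w : X) :
    _root_.fderiv ℂ (_root_.fderiv ℂ f) z v w = _root_.fderiv ℂ (_root_.fderiv ℂ f) z w v :=
  second_derivative_symmetric_of_eventually
    ((hO.eventually_mem hz).mono fun _ hy =>
      (h.2.differentiableAt (hO.mem_nhds hy)).hasFDerivAt) (h.hasFDerivAt_fderiv hO hz) v w

theorem HolOn.sub {g : X → Z} (hf : HolOn f O) (hg : HolOn g O) : HolOn (fun z => f z - g z) O :=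
  ⟨hf.1.sub hg.1, hf.2.sub hg.2⟩

theorem HolOn.add {g : X → Z} (hf : HolOn f O) (hg : HolOn g O) : HolOn (fun z => f z + g z) O :=
  ⟨hf.1.add hg.1, hf.2.add hg.2⟩

end HolSecond

variable {E : Type*} [NormedAddCommGroup E] [NormedSpace ℂ E]

/-- The mixed second derivative of a function on `E × Ē`. -/
def mixedDeriv (k : E × Conj E → ℂ) (z : E × Conj E) (v w : E) : ℂ :=
  fderiv ℂ (fderiv ℂ k) z (v, 0) (0, toConj w)

/-- The conjugate of a function on `E × Ē` composed with the exchange of the factors. -/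
def swapConj (k : E × Conj E → ℂ) (z : E × Conj E) : ℂ :=
  starRingEnd ℂ (k (fromConj E z.2, toConj z.1))

/-- The exchange of the factors of `E × Ē`. -/
def swapCLM (E : Type*) [NormedAddCommGroup E] [NormedSpace ℂ E] :
    E × Conj E →L[ℝ] E × Conj E :=
  (fromConj E ∘L .snd ℝ E (Conj E)).prod (((toConj (E := E)) : E →L[ℝ] Conj E) ∘L .fst ℝ E (Conj E))

theorem swapCLM_apply (z : E × Conj E) : swapCLM E z = (fromConj E z.2, toConj z.1) := rfl

theorem swapCLM_smul (c : ℂ) (z : E × Conj E) :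
    swapCLM E (c • z) = (starRingEnd ℂ c) • swapCLM E z := by
  rw [swapCLM_apply, swapCLM_apply, Prod.smul_fst, toConj_smul]
  rfl

/-- The exchange of factors is conjugate linear, and so is the conjugation of the values; the two
cancel, and the derivative is complex linear. -/
theorem hasFDerivAt_swapConj {k : E × Conj E → ℂ} {z : E × Conj E}
    (hk : DifferentiableAt ℂ k (swapCLM E z)) :
    ∃ A : E × Conj E →L[ℂ] ℂ, HasFDerivAt (swapConj k) A z ∧
      ∀ v, A v = starRingEnd ℂ (fderiv ℂ k (swapCLM E z) (swapCLM E v)) := by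
  have h1 : HasFDerivAt (swapConj k) ((Complex.conjCLE : ℂ →L[ℝ] ℂ) ∘L
      ((fderiv ℂ k (swapCLM E z)).restrictScalars ℝ ∘L swapCLM E)) z :=
    (Complex.conjCLE : ℂ →L[ℝ] ℂ).hasFDerivAt.comp z
      ((hk.hasFDerivAt.restrictScalars ℝ).comp z (swapCLM E).hasFDerivAt)
  let A : E × Conj E →L[ℂ] ℂ :=
    { toFun := fun v => starRingEnd ℂ (fderiv ℂ k (swapCLM E z) (swapCLM E v))
      map_add' := fun v w => by rw [map_add, map_add, map_add]
      map_smul' := fun c v => by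
        rw [swapCLM_smul, map_smul, smul_eq_mul, map_mul, Complex.conj_conj]; rfl
      cont := by fun_prop }
  exact ⟨A, hasFDerivAt_of_restrictScalars ℝ h1 (ContinuousLinearMap.ext fun _ => rfl),
    fun _ => rfl⟩

theorem swapCLM_mem {B : Set E} {z : E × Conj E} (hz : z ∈ sqConj B) : swapCLM E z ∈ sqConj B :=
  ⟨hz.2, hz.1⟩

theorem HolOn.swapConj {k : E × Conj E → ℂ} {B : Set E} (hB : IsOpen B)
    (hk : HolOn k (sqConj B)) : HolOn (swapConj k) (sqConj B) := by
  refine ⟨?_, fun z hz => ?_⟩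
  · exact (Complex.conjCLE : ℂ →L[ℝ] ℂ).contDiff.comp_contDiffOn
      (hk.1.comp (swapCLM E).contDiff.contDiffOn fun z hz => swapCLM_mem hz)
  · obtain ⟨A, hA, -⟩ := hasFDerivAt_swapConj (hk.2.differentiableAt
      ((isOpen_sqConj hB).mem_nhds (swapCLM_mem hz)))
    exact hA.differentiableAt.differentiableWithinAt

/-- The exchange turns the antiholomorphic slot into the holomorphic one, and the second derivative
is symmetric. The resulting conjugate transpose is the source of the Hermitian symmetry of real
potentials. -/
theorem mixedDeriv_swapConj {k : E × Conj E → ℂ} {B : Set E} (hB : IsOpen B)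
    (hk : HolOn k (sqConj B)) {x : E} (hx : x ∈ B) (v w : E) :
    mixedDeriv (swapConj k) (x, toConj x) v w =
      starRingEnd ℂ (mixedDeriv k (x, toConj x) w v) := by
  have hO := isOpen_sqConj hB
  have hxO : (x, toConj x) ∈ sqConj B := ⟨hx, hx⟩
  have h1 := (hk.swapConj hB).hasFDerivAt_fderiv_apply hO hxO (0, toConj w)
  have h2 : HasFDerivAt (fun z => starRingEnd ℂ (fderiv ℂ k (swapCLM E z) (w, 0)))
      ((Complex.conjCLE : ℂ →L[ℝ] ℂ) ∘L
      (((fderiv ℂ (fderiv ℂ k) (swapCLM E (x, toConj x))).flip (w, 0)).restrictScalars ℝ ∘L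
        swapCLM E)) (x, toConj x) :=
    (Complex.conjCLE : ℂ →L[ℝ] ℂ).hasFDerivAt.comp _
      (((hk.hasFDerivAt_fderiv_apply hO (swapCLM_mem hxO) (w, 0)).restrictScalars ℝ).comp _
        (swapCLM E).hasFDerivAt)
  have h3 : (fun z => fderiv ℂ (swapConj k) z (0, toConj w)) =ᶠ[𝓝 (x, toConj x)]
      fun z => starRingEnd ℂ (fderiv ℂ k (swapCLM E z) (w, 0)) := by
    filter_upwards [hO.mem_nhds hxO] with z hz
    obtain ⟨A, hA, hA'⟩ := hasFDerivAt_swapConj (hk.2.differentiableAt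
      (hO.mem_nhds (swapCLM_mem hz)))
    rw [hA.fderiv, hA', swapCLM_apply (0, toConj w), map_zero]
    rfl
  have h4 := congrArg (fun A : E × Conj E →L[ℝ] ℂ => A (v, 0))
    ((h1.restrictScalars ℝ).unique (h2.congr_of_eventuallyEq h3))
  change mixedDeriv (swapConj k) (x, toConj x) v w = starRingEnd ℂ
    (fderiv ℂ (fderiv ℂ k) (x, toConj x) (swapCLM E (v, 0)) (w, 0)) at h4
  rw [h4, mixedDeriv, hk.fderiv_fderiv_symm hO hxO, swapCLM_apply]
  simp

/-- A polarized potential of the `(1,1)`-form `θ` on an open subset of `E`. -/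
structure IsKernel (θ : E → E → E → ℝ) (B : Set E) (k : E × Conj E → ℂ) : Prop where
  hol : HolOn k (sqConj B)
  real : ∀ x ∈ B, (k (x, toConj x)).im = 0
  form : ∀ x ∈ B, ∀ v w, Complex.I * (mixedDeriv k (x, toConj x) v w -
    mixedDeriv k (x, toConj x) w v) = θ x v w

/-- The diastasis of a polarized potential. -/
def kernelDiastasis (k : E × Conj E → ℂ) (p : E × E) : ℝ :=
  (k (p.1, toConj p.1)).re + (k (p.2, toConj p.2)).re - 2 * (k (p.1, toConj p.2)).re

theorem kernelDiastasis_self (k : E × Conj E → ℂ) (x : E) : kernelDiastasis k (x, x) = 0 := by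
  simp only [kernelDiastasis]; ring

theorem mixedDeriv_smul_left (k : E × Conj E → ℂ) (z : E × Conj E) (c : ℂ) (v w : E) :
    mixedDeriv k z (c • v) w = c * mixedDeriv k z v w := by
  rw [mixedDeriv, mixedDeriv, show ((c • v, 0) : E × Conj E) = c • (v, 0) by simp, map_smul]; rfl

theorem mixedDeriv_smul_right (k : E × Conj E → ℂ) (z : E × Conj E) (c : ℂ) (v w : E) :
    mixedDeriv k z v (c • w) = starRingEnd ℂ c * mixedDeriv k z v w := by
  rw [mixedDeriv, mixedDeriv, toConj_smul,
    show ((0, starRingEnd ℂ c • toConj w) : E × Conj E) = starRingEnd ℂ c • (0, toConj w) by simp,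
    map_smul]; rfl

namespace IsKernel

variable {θ : E → E → E → ℝ} {B : Set E} {k k' : E × Conj E → ℂ}

theorem mono {B' : Set E} (h : IsKernel θ B k) (hB : B' ⊆ B) : IsKernel θ B' k :=
  ⟨h.hol.mono (Set.prod_mono hB (Set.preimage_mono hB)), fun x hx => h.real x (hB hx),
    fun x hx => h.form x (hB hx)⟩

/-- The function `k - swapConj k` is holomorphic and vanishes on the diagonal because `k` is real
there. -/
theorem conj_symm (h : IsKernel θ B k) (hB : IsOpen B) (hBc : Convex ℝ B) {x y : E}
    (hx : x ∈ B) (hy : y ∈ B) : k (y, toConj x) = starRingEnd ℂ (k (x, toConj y)) := by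
  have := eq_zero_of_diag hB hBc (f := fun z => k z - swapConj k z)
    (h.hol.sub (h.hol.swapConj hB)).2 (fun x hx => ?_) hy hx
  · exact sub_eq_zero.1 this
  · change k (x, toConj x) - starRingEnd ℂ (k (x, toConj x)) = 0
    rw [Complex.conj_eq_iff_im.2 (h.real x hx), sub_self]

theorem diastasis_symm (h : IsKernel θ B k) (hB : IsOpen B) (hBc : Convex ℝ B) {x y : E}
    (hx : x ∈ B) (hy : y ∈ B) : kernelDiastasis k (y, x) = kernelDiastasis k (x, y) := by
  simp only [kernelDiastasis]
  rw [h.conj_symm hB hBc hx hy, Complex.conj_re]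
  ring

theorem contDiffOn_diastasis (h : IsKernel θ B k) :
    ContDiffOn ℝ ω (kernelDiastasis k) (B ×ˢ B) := by
  have key : ∀ L : E × E →L[ℝ] E × Conj E, (∀ z ∈ B ×ˢ B, L z ∈ sqConj B) →
      ContDiffOn ℝ ω (fun z => (k (L z)).re) (B ×ˢ B) := fun L hL =>
    Complex.reCLM.contDiff.comp_contDiffOn (h.hol.1.comp L.contDiff.contDiffOn hL)
  have h1 := key ((ContinuousLinearMap.fst ℝ E E).prod (((toConj (E := E)) : E →L[ℝ] Conj E) ∘L .fst ℝ E E))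
    fun z hz => ⟨hz.1, hz.1⟩
  have h2 := key ((ContinuousLinearMap.snd ℝ E E).prod (((toConj (E := E)) : E →L[ℝ] Conj E) ∘L .snd ℝ E E))
    fun z hz => ⟨hz.2, hz.2⟩
  have h3 := key ((ContinuousLinearMap.fst ℝ E E).prod (((toConj (E := E)) : E →L[ℝ] Conj E) ∘L .snd ℝ E E))
    fun z hz => ⟨hz.1, hz.2⟩
  exact (h1.add h2).sub (contDiffOn_const.mul h3)

/-- The two partial derivatives on the diagonal have sum zero, as the diastasis vanishes along it,
and are equal by symmetry. -/
theorem dfst_diastasis_diag (h : IsKernel θ B k) (hB : IsOpen B) (hBc : Convex ℝ B) {x : E}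
    (hx : x ∈ B) : dfst (kernelDiastasis k) (x, x) = 0 := by
  have hd : DifferentiableAt ℝ (kernelDiastasis k) (x, x) :=
    (h.contDiffOn_diastasis.contDiffAt ((hB.prod hB).mem_nhds ⟨hx, hx⟩)).differentiableAt (by simp)
  ext v
  have h1 : HasFDerivAt (fun y : E => kernelDiastasis k (y, y)) (fderiv ℝ (kernelDiastasis k) (x, x)
      ∘L ((ContinuousLinearMap.id ℝ E).prod (ContinuousLinearMap.id ℝ E))) x :=
    HasFDerivAt.comp (f := fun y : E => (y, y)) x hd.hasFDerivAt
      ((hasFDerivAt_id x).prodMk (hasFDerivAt_id x))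
  simp only [kernelDiastasis_self] at h1
  have h2 := congrArg (fun A : E →L[ℝ] ℝ => A v) (h1.unique (hasFDerivAt_const (0 : ℝ) x))
  have h3 : HasFDerivAt (fun z : E × E => kernelDiastasis k (z.2, z.1))
      (fderiv ℝ (kernelDiastasis k) (x, x) ∘L (ContinuousLinearEquiv.prodComm ℝ E E : _ →L[ℝ] _))
      (x, x) :=
    HasFDerivAt.comp (f := ContinuousLinearEquiv.prodComm ℝ E E) (x, x) hd.hasFDerivAt
      (ContinuousLinearEquiv.prodComm ℝ E E).hasFDerivAt
  have h4 : (fun z : E × E => kernelDiastasis k (z.2, z.1)) =ᶠ[𝓝 (x, x)] kernelDiastasis k := by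
    filter_upwards [(hB.prod hB).mem_nhds ⟨hx, hx⟩] with z hz
    exact h.diastasis_symm hB hBc hz.1 hz.2
  have h5 := congrArg (fun A : E × E →L[ℝ] ℝ => A (v, 0))
    ((h3.congr_of_eventuallyEq h4.symm).unique hd.hasFDerivAt)
  have h6 : ((v, v) : E × E) = (v, 0) + (0, v) := by simp
  simp only [ContinuousLinearMap.coe_comp, Function.comp_apply, ContinuousLinearMap.prod_apply,
    ContinuousLinearMap.id_apply, zero_apply] at h2
  rw [h6, map_add] at h2
  have h7 : fderiv ℝ (kernelDiastasis k) (x, x) (0, v) =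
    fderiv ℝ (kernelDiastasis k) (x, x) (v, 0) := by simpa using h5
  simp only [dfst, ContinuousLinearMap.coe_comp, Function.comp_apply,
    ContinuousLinearMap.inl_apply, zero_apply]
  linarith

theorem form_smul_I (h : IsKernel θ B k) {x : E} (hx : x ∈ B) (v : E) :
    θ x v (Complex.I • v) = 2 * (mixedDeriv k (x, toConj x) v v).re := by
  have h1 := congrArg Complex.re (h.form x hx v (Complex.I • v))
  rw [mixedDeriv_smul_right, mixedDeriv_smul_left, Complex.conj_I, Complex.ofReal_re] at h1
  rw [← h1]
  have : Complex.I * (-Complex.I * mixedDeriv k (x, toConj x) v v -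
      Complex.I * mixedDeriv k (x, toConj x) v v) =
      2 * mixedDeriv k (x, toConj x) v v := by
    linear_combination (-2 * mixedDeriv k (x, toConj x) v v) * Complex.I_mul_I
  rw [this]
  simp

/-- The second derivative of the diastasis on the diagonal is the Kähler metric. -/
theorem fderiv_dfst_diastasis (h : IsKernel θ B k) (hB : IsOpen B) (hBc : Convex ℝ B) {x : E}
    (hx : x ∈ B) (v : E) :
    fderiv ℝ (dfst (kernelDiastasis k)) (x, x) (v, 0) v = θ x v (Complex.I • v) := by
  have hO := isOpen_sqConj hB
  have hBB := (hB.prod hB)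
  have hd : ContDiffOn ℝ ω (dfst (kernelDiastasis k)) (B ×ˢ B) :=
    ((ContinuousLinearMap.compL ℝ E (E × E) ℝ).flip (.inl ℝ E E)).contDiff.comp_contDiffOn
      (h.contDiffOn_diastasis.fderiv_of_isOpen hBB (by simp))
  have hdx : HasFDerivAt (dfst (kernelDiastasis k)) (fderiv ℝ (dfst (kernelDiastasis k)) (x, x))
      (x, x) := ((hd.contDiffAt (hBB.mem_nhds ⟨hx, hx⟩)).differentiableAt (by simp)).hasFDerivAt
  set D := fderiv ℝ (dfst (kernelDiastasis k)) (x, x)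
  have h1 : HasFDerivAt (fun y : E => dfst (kernelDiastasis k) (y, y)) (D
      ∘L ((ContinuousLinearMap.id ℝ E).prod (ContinuousLinearMap.id ℝ E))) x :=
    HasFDerivAt.comp (f := fun y : E => (y, y)) x hdx
      ((hasFDerivAt_id x).prodMk (hasFDerivAt_id x))
  have h2 : HasFDerivAt (fun y : E => dfst (kernelDiastasis k) (y, y)) (0 : E →L[ℝ] E →L[ℝ] ℝ) x := by
    refine (hasFDerivAt_const (0 : E →L[ℝ] ℝ) x).congr_of_eventuallyEq ?_
    filter_upwards [hB.mem_nhds hx] with y hy using h.dfst_diastasis_diag hB hBc hy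
  -- This trades the pure second derivative for minus the mixed one, to which only the term `-2 Re
  -- k(x, ȳ)` contributes.
  have h3 : D (v, 0) v + D (0, v) v = 0 := by
    have := congrArg (fun A : E →L[ℝ] E →L[ℝ] ℝ => A v v) (h1.unique h2)
    simp only [ContinuousLinearMap.coe_comp, Function.comp_apply, ContinuousLinearMap.prod_apply,
      ContinuousLinearMap.id_apply, zero_apply] at this
    rwa [show ((v, v) : E × E) = (v, 0) + (0, v) by simp, map_add] at this
  have h4 : HasFDerivAt (fun y : E => dfst (kernelDiastasis k) (x, y) v)
      ((ContinuousLinearMap.apply ℝ ℝ v) ∘L (D ∘L .inr ℝ E E)) x :=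
    (ContinuousLinearMap.apply ℝ ℝ v).hasFDerivAt.comp x
      (HasFDerivAt.comp (f := fun y : E => (x, y)) x hdx (hasFDerivAt_prodMk_right x x))
  have hreal : ∀ z ∈ sqConj B, HasFDerivAt (𝕜 := ℝ) k ((fderiv ℂ k z).restrictScalars ℝ) z :=
    fun z hz => (h.hol.2.differentiableAt (hO.mem_nhds hz)).hasFDerivAt.restrictScalars ℝ
  have h5 : ∀ y ∈ B, dfst (kernelDiastasis k) (x, y) v =
      (fderiv ℂ k (x, toConj x) (v, toConj v)).re - 2 * (fderiv ℂ k (x, toConj y) (v, 0)).re := by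
    intro y hy
    have e1 : HasFDerivAt (fun x : E => kernelDiastasis k (x, y))
        (fderiv ℝ (kernelDiastasis k) (x, y) ∘L .inl ℝ E E) x :=
      HasFDerivAt.comp (f := fun x : E => (x, y)) x
        ((h.contDiffOn_diastasis.contDiffAt (hBB.mem_nhds ⟨hx, hy⟩)).differentiableAt
          (by simp)).hasFDerivAt (hasFDerivAt_prodMk_left x y)
    have e2 := Complex.reCLM.hasFDerivAt.comp x (HasFDerivAt.comp (g := k)
      (f := fun x : E => (x, toConj x)) x (hreal _ ⟨hx, hx⟩)
      ((hasFDerivAt_id x).prodMk (toConj (E := E)).hasFDerivAt))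
    have e3 := Complex.reCLM.hasFDerivAt.comp x (HasFDerivAt.comp (g := k)
      (f := fun x : E => (x, toConj y)) x (hreal (x, toConj y) ⟨hx, hy⟩)
      (hasFDerivAt_prodMk_left x (toConj y)))
    have e4 := (e2.add_const ((k (y, toConj y)).re)).sub (e3.const_mul 2)
    have e5 := congrArg (fun A : E →L[ℝ] ℝ => A v) (e1.unique e4)
    simpa [dfst] using e5
  have h6 : HasFDerivAt (fun y : E => dfst (kernelDiastasis k) (x, y) v)
      (-((2 : ℝ) • (Complex.reCLM ∘L (((fderiv ℂ (fderiv ℂ k) (x, toConj x)).flip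
        (v, 0)).restrictScalars ℝ ∘L (.inr ℝ E (Conj E) ∘L ((toConj (E := E)) : E →L[ℝ] Conj E)))))) x := by
    have e1 := Complex.reCLM.hasFDerivAt.comp x (HasFDerivAt.comp
      (g := fun z => fderiv ℂ k z (v, 0)) (f := fun y : E => (x, toConj y)) x
      ((h.hol.hasFDerivAt_fderiv_apply hO (⟨hx, hx⟩ : (x, toConj x) ∈ sqConj B)
        (v, 0)).restrictScalars ℝ)
      (HasFDerivAt.comp x (hasFDerivAt_prodMk_right x (toConj x)) (toConj (E := E)).hasFDerivAt))
    refine ((e1.const_mul 2).const_sub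
      (fderiv ℂ k (x, toConj x) (v, toConj v)).re).congr_of_eventuallyEq ?_
    filter_upwards [hB.mem_nhds hx] with y hy using h5 y hy
  have h7 := congrArg (fun A : E →L[ℝ] ℝ => A v) (h4.unique h6)
  have h8 : D (0, v) v = -(2 * (fderiv ℂ (fderiv ℂ k) (x, toConj x) (0, toConj v) (v, 0)).re) := by
    simpa using h7
  rw [h.form_smul_I hx, mixedDeriv,
    h.hol.fderiv_fderiv_symm hO (⟨hx, hx⟩ : (x, toConj x) ∈ sqConj B)]
  linarith

theorem sub (h : IsKernel θ B k) (h' : IsKernel θ B k') (hB : IsOpen B) :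
    IsKernel (fun _ _ _ => 0) B fun z => k z - k' z := by
  have hO := isOpen_sqConj hB
  have hm : ∀ x ∈ B, ∀ v w, mixedDeriv (fun z => k z - k' z) (x, toConj x) v w =
      mixedDeriv k (x, toConj x) v w - mixedDeriv k' (x, toConj x) v w := by
    intro x hx v w
    have hxO : (x, toConj x) ∈ sqConj B := ⟨hx, hx⟩
    have h1 : fderiv ℂ (fun z => k z - k' z) =ᶠ[𝓝 (x, toConj x)]
        fun z => fderiv ℂ k z - fderiv ℂ k' z := by
      filter_upwards [hO.mem_nhds hxO] with z hz
      exact fderiv_fun_sub (h.hol.2.differentiableAt (hO.mem_nhds hz))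
        (h'.hol.2.differentiableAt (hO.mem_nhds hz))
    rw [mixedDeriv, h1.fderiv_eq, ((h.hol.hasFDerivAt_fderiv hO hxO).fun_sub
      (h'.hol.hasFDerivAt_fderiv hO hxO)).fderiv]
    rfl
  refine ⟨h.hol.sub h'.hol, fun x hx => ?_, fun x hx v w => ?_⟩
  · rw [Complex.sub_im, h.real x hx, h'.real x hx, sub_zero]
  · rw [hm x hx, hm x hx]
    have h1 := h.form x hx v w
    have h2 := h'.form x hx v w
    push_cast
    linear_combination h1 - h2

/-- Using `v` and `iv` in the form identity, the mixed derivative of `k` vanishes on the diagonal,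
hence everywhere by the identity theorem. So `k` is a function of `p` plus a function of `q̄`, and
such terms cancel in the diastasis. -/
theorem diastasis_eq_zero (h : IsKernel (fun _ _ _ => 0) B k) (hB : IsOpen B) (hBc : Convex ℝ B)
    {x y : E} (hx : x ∈ B) (hy : y ∈ B) : kernelDiastasis k (x, y) = 0 := by
  have hO := isOpen_sqConj hB
  have hdiag : ∀ x ∈ B, ∀ v w, mixedDeriv k (x, toConj x) v w = 0 := by
    intro x hx v w
    have h1 := h.form x hx v w
    have h2 := h.form x hx (Complex.I • v) w
    rw [mixedDeriv_smul_left, mixedDeriv_smul_right, Complex.conj_I] at h2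
    push_cast at h1 h2
    linear_combination (-Complex.I / 2) * h1 + (-1 / 2) * h2 + (mixedDeriv k (x, toConj x) v w
      ) * Complex.I_mul_I
  have hmix : ∀ p ∈ B, ∀ q ∈ B, ∀ v w, mixedDeriv k (p, toConj q) v w = 0 := by
    intro p hp q hq v w
    refine eq_zero_of_diag hB hBc (f := fun z => mixedDeriv k z v w) ?_
      (fun x hx => hdiag x hx v w) hp hq
    intro z hz
    exact (((ContinuousLinearMap.apply ℂ ℂ ((0, toConj w) : E × Conj E)) ∘L
      (ContinuousLinearMap.apply ℂ (E × Conj E →L[ℂ] ℂ) ((v, 0) : E × Conj E))).differentiableAt.comp z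
      (((h.hol.fderiv hO).fderiv hO).2.differentiableAt
        (hO.mem_nhds hz))).differentiableWithinAt
  have hfst : ∀ p ∈ B, ∀ q ∈ B, ∀ q' ∈ B, ∀ v, fderiv ℂ k (p, toConj q) (v, 0) =
      fderiv ℂ k (p, toConj q') (v, 0) := by
    intro p hp q hq q' hq' v
    have hder : ∀ q ∈ B, HasFDerivWithinAt (𝕜 := ℝ) (fun q => fderiv ℂ k (p, toConj q) (v, 0))
        (0 : E →L[ℝ] ℂ) B q := by
      intro q hq
      have e1 := HasFDerivAt.comp (g := fun z => fderiv ℂ k z (v, 0))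
        (f := fun y : E => (p, toConj y)) q
        ((h.hol.hasFDerivAt_fderiv_apply hO (⟨hp, hq⟩ : (p, toConj q) ∈ sqConj B)
          (v, 0)).restrictScalars ℝ)
        (HasFDerivAt.comp q (hasFDerivAt_prodMk_right p (toConj q)) (toConj (E := E)).hasFDerivAt)
      refine (e1.congr_fderiv ?_).hasFDerivWithinAt
      ext w
      have := hmix p hp q hq v w
      rw [mixedDeriv, h.hol.fderiv_fderiv_symm hO (⟨hp, hq⟩ : (p, toConj q) ∈ sqConj B)] at this
      simpa using this
    exact hBc.is_const_of_fderivWithin_eq_zero (𝕜 := ℝ)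
      (fun q hq => (hder q hq).differentiableWithinAt)
      (fun q hq => (hder q hq).fderivWithin (hB.uniqueDiffOn q hq)) hq hq'
  have hconst : ∀ q ∈ B, ∀ q' ∈ B, ∀ p ∈ B, ∀ p' ∈ B, k (p, toConj q) - k (p, toConj q') =
      k (p', toConj q) - k (p', toConj q') := by
    intro q hq q' hq' p hp p' hp'
    have hder : ∀ p ∈ B, HasFDerivWithinAt (fun p => k (p, toConj q) - k (p, toConj q'))
        (0 : E →L[ℂ] ℂ) B p := by
      intro p hp
      have e : ∀ q ∈ B, HasFDerivAt (fun p => k (p, toConj q))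
          (fderiv ℂ k (p, toConj q) ∘L .inl ℂ E (Conj E)) p := fun q hq =>
        HasFDerivAt.comp (g := k) (f := fun p : E => (p, toConj q)) p
          (h.hol.2.differentiableAt (hO.mem_nhds
            (⟨hp, hq⟩ : (p, toConj q) ∈ sqConj B))).hasFDerivAt (hasFDerivAt_prodMk_left p (toConj q))
      refine (((e q hq).sub (e q' hq')).congr_fderiv ?_).hasFDerivWithinAt
      ext v
      simpa [sub_eq_zero] using hfst p hp q hq q' hq' v
    have hder' : ∀ p ∈ B, HasFDerivWithinAt (fun p => k (p, toConj q) - k (p, toConj q'))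
        (0 : E →L[ℝ] ℂ) B p := fun p hp => (hder p hp).restrictScalars ℝ
    exact hBc.is_const_of_fderivWithin_eq_zero (𝕜 := ℝ)
      (fun q hq => (hder' q hq).differentiableWithinAt)
      (fun q hq => (hder' q hq).fderivWithin (hB.uniqueDiffOn q hq)) hp hp'
  have h1 := congrArg Complex.re (hconst x hx y hy x hx y hy)
  have h2 := congrArg Complex.re (h.conj_symm hB hBc hx hy)
  rw [Complex.conj_re] at h2
  simp only [Complex.sub_re] at h1
  simp only [kernelDiastasis]
  linarith

/-- The diastasis depends only on the form. -/
theorem diastasis_unique (h : IsKernel θ B k) (h' : IsKernel θ B k') (hB : IsOpen B)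
    (hBc : Convex ℝ B) {x y : E} (hx : x ∈ B) (hy : y ∈ B) :
    kernelDiastasis k (x, y) = kernelDiastasis k' (x, y) := by
  have := (h.sub h' hB).diastasis_eq_zero hB hBc hx hy
  simp only [kernelDiastasis, Complex.sub_re] at this ⊢
  linarith

end IsKernel

end CalabiLegendre

end

/-! ### Existence of local polarized potentials -/

noncomputable section

set_option maxSynthPendingDepth 3

namespace CalabiLegendre

section Projection

variable {E : Type*} [NormedAddCommGroup E] [NormedSpace ℂ E]

/-- `ℓ ↦ (w̄ ↦ (-i ℓ(w) + ℓ(i w)) / 2)`. -/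
def conjPart (E : Type*) [NormedAddCommGroup E] [NormedSpace ℂ E] :
    (E →L[ℝ] ℝ) →L[ℝ] (Conj E →L[ℂ] ℂ) :=
  complexPart (Conj E) ℂ ∘L
    (ContinuousLinearMap.compL ℝ (Conj E) ℝ ℂ ((-Complex.I) • Complex.ofRealCLM)) ∘L
      ((ContinuousLinearMap.compL ℝ (Conj E) E ℝ).flip (fromConj E))

theorem conjPart_apply (l : E →L[ℝ] ℝ) (w : E) :
    conjPart E l (toConj w) = 2⁻¹ * (-Complex.I * l w + l (Complex.I • w)) := by
  change complexPart (Conj E) ℂ _ (toConj w) = _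
  rw [complexPart_apply, smul_toConj, Complex.conj_I]
  change (2⁻¹ : ℂ) * (-Complex.I * (l w : ℂ) -
    Complex.I * (-Complex.I * (l (-Complex.I • w) : ℂ))) = _
  rw [neg_smul, map_neg]
  push_cast
  linear_combination (-(2⁻¹ : ℂ) * l (Complex.I • w)) * Complex.I_mul_I

/-- The coefficient `h` of a real `(1,1)`-form `θ(v, w) = i (h(v, w̄) - h(w, v̄))`. -/
def hermPart (E : Type*) [NormedAddCommGroup E] [NormedSpace ℂ E] :
    (E →L[ℝ] E →L[ℝ] ℝ) →L[ℝ] (E →L[ℂ] Conj E →L[ℂ] ℂ) :=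
  complexPart E (Conj E →L[ℂ] ℂ) ∘L ContinuousLinearMap.compL ℝ E _ _ (conjPart E)

theorem hermPart_apply (L : E →L[ℝ] E →L[ℝ] ℝ)
    (h : ∀ v w, L (Complex.I • v) (Complex.I • w) = L v w) (v w : E) :
    hermPart E L v (toConj w) = 2⁻¹ * (-Complex.I * L v w - L (Complex.I • v) w) := by
  change complexPart E (Conj E →L[ℂ] ℂ) _ v (toConj w) = _
  rw [complexPart_apply]
  change (2⁻¹ : ℂ) * (conjPart E (L v) (toConj w) -
    Complex.I * conjPart E (L (Complex.I • v)) (toConj w)) = _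
  rw [conjPart_apply, conjPart_apply, h]
  have h2 : L v (Complex.I • w) = - L (Complex.I • v) w := by
    have := h (Complex.I • v) w
    rw [smul_smul, Complex.I_mul_I, neg_one_smul, map_neg, neg_apply] at this
    linarith
  rw [h2]
  push_cast
  linear_combination (2⁻¹ * 2⁻¹ * (L (Complex.I • v) w : ℂ)) * Complex.I_mul_I

theorem eq_hermPart (L : E →L[ℝ] E →L[ℝ] ℝ)
    (h : ∀ v w, L (Complex.I • v) (Complex.I • w) = L v w) (ha : ∀ v w, L v w = - L w v)
    (v w : E) : Complex.I * (hermPart E L v (toConj w) - hermPart E L w (toConj v)) = L v w := by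
  rw [hermPart_apply L h, hermPart_apply L h]
  have h2 : L (Complex.I • w) v = L (Complex.I • v) w := by
    have := h (Complex.I • v) w
    rw [smul_smul, Complex.I_mul_I, neg_one_smul, map_neg, neg_apply] at this
    rw [ha, this]
  rw [h2, ha w v]
  push_cast
  linear_combination (-(L v w : ℂ)) * Complex.I_mul_I

/-- The symmetries of the derivative of the coefficient of a closed `(1,1)`-form: its complex linear
part is symmetric in the first two arguments, its antilinear part in the first and the third. -/
theorem hermPart_closed (P : E →L[ℝ] E →L[ℝ] E →L[ℝ] ℝ)
    (h : ∀ a v w, P a (Complex.I • v) (Complex.I • w) = P a v w)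
    (ha : ∀ a v w, P a v w = - P a w v) (hc : ∀ a b c, P a b c - P b a c + P c a b = 0)
    (a b c : E) :
    hermPart E (P a) b (toConj c) - Complex.I * hermPart E (P (Complex.I • a)) b (toConj c) =
      hermPart E (P b) a (toConj c) - Complex.I * hermPart E (P (Complex.I • b)) a (toConj c) ∧
    hermPart E (P a) b (toConj c) + Complex.I * hermPart E (P (Complex.I • a)) b (toConj c) =
      hermPart E (P c) b (toConj a) + Complex.I * hermPart E (P (Complex.I • c)) b (toConj a) := by
  have hI : ∀ a v w, P a v (Complex.I • w) = - P a (Complex.I • v) w := by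
    intro a v w
    have := h a (Complex.I • v) w
    rw [smul_smul, Complex.I_mul_I, neg_one_smul, map_neg, neg_apply] at this
    linarith
  simp only [hermPart_apply _ (h _)]
  set i := Complex.I with hi
  -- With type `(1,1)` and antisymmetry, both claims are real linear combinations of closedness at
  -- triples in which some arguments are multiplied by `i`.
  have e1 := hc a b c
  have e2 := hc a (i • b) c
  have e3 := hc (i • a) b c
  have e4 := hc (i • a) (i • b) c
  have e5 := hc (i • a) (i • b) (i • c)
  have e6 := hc (i • a) b (i • c)
  rw [h] at e4
  rw [h, h, h] at e5
  rw [h, hI] at e6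
  have f1 := hI c a b
  have f2 := ha c a b
  have f3 := ha c a (i • b)
  have f4 := ha (i • c) a b
  have f5 := ha (i • c) a (i • b)
  have f6 := hI (i • c) a b
  have f7 := ha c b a
  have f8 := ha c (i • b) a
  have f9 := ha (i • c) b a
  have f0 := ha (i • c) (i • b) a
  rw [hI] at e2
  constructor
  · apply Complex.ext <;> simp [hi] <;> simp only [← hi] <;> linarith
  · apply Complex.ext <;> simp [hi] <;> simp only [← hi] <;> linarith

theorem HolOn.hasFDerivAt {X Z : Type*} [NormedAddCommGroup X] [NormedSpace ℂ X]
    [NormedAddCommGroup Z] [NormedSpace ℂ Z] {f : X → Z} {O : Set X} (h : HolOn f O)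
    (hO : IsOpen O) {z : X} (hz : z ∈ O) : HasFDerivAt f (_root_.fderiv ℂ f z) z :=
  (h.2.differentiableAt (hO.mem_nhds hz)).hasFDerivAt

/-- The real part of a polarized potential. -/
theorem exists_isKernel_of_mixedDeriv {θ : E → E → E → ℝ} {B : Set E} (hB : IsOpen B)
    {k : E × Conj E → ℂ} (hk : HolOn k (sqConj B))
    (hform : ∀ x ∈ B, ∀ v w, Complex.I * (mixedDeriv k (x, toConj x) v w -
      mixedDeriv k (x, toConj x) w v) = θ x v w) : ∃ k', IsKernel θ B k' := by
  have hO := isOpen_sqConj hB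
  have hs := hk.swapConj hB
  have hhol : HolOn (fun z => (2⁻¹ : ℂ) • (k z + swapConj k z)) (sqConj B) :=
    (hk.add hs).clm_comp ((2⁻¹ : ℂ) • ContinuousLinearMap.id ℂ ℂ)
  have hm : ∀ x ∈ B, ∀ v w, mixedDeriv (fun z => (2⁻¹ : ℂ) • (k z + swapConj k z))
      (x, toConj x) v w = 2⁻¹ * (mixedDeriv k (x, toConj x) v w +
        mixedDeriv (swapConj k) (x, toConj x) v w) := by
    intro x hx v w
    have hxO : (x, toConj x) ∈ sqConj B := ⟨hx, hx⟩
    have h1 : fderiv ℂ (fun z => (2⁻¹ : ℂ) • (k z + swapConj k z)) =ᶠ[𝓝 (x, toConj x)]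
        fun z => (2⁻¹ : ℂ) • (fderiv ℂ k z + fderiv ℂ (swapConj k) z) := by
      filter_upwards [hO.mem_nhds hxO] with z hz
      exact (((hk.hasFDerivAt hO hz).fun_add (hs.hasFDerivAt hO hz)).fun_const_smul (2⁻¹ : ℂ)).fderiv
    rw [mixedDeriv, h1.fderiv_eq, (((hk.hasFDerivAt_fderiv hO hxO).fun_add
      (hs.hasFDerivAt_fderiv hO hxO)).fun_const_smul (2⁻¹ : ℂ)).fderiv]
    rfl
  refine ⟨fun z => (2⁻¹ : ℂ) • (k z + swapConj k z), hhol, fun x hx => ?_, fun x hx v w => ?_⟩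
  · change ((2⁻¹ : ℂ) * (k (x, toConj x) + starRingEnd ℂ (k (x, toConj x)))).im = 0
    rw [Complex.add_conj]
    simp
  · rw [hm x hx, hm x hx, mixedDeriv_swapConj hB hk hx, mixedDeriv_swapConj hB hk hx]
    have h1 := hform x hx v w
    -- The form is real, so the conjugate of its relation with `k` is its relation with `swapConj
    -- k`; the average of the two potentials satisfies both.
    have h2 := congrArg (starRingEnd ℂ) h1
    rw [map_mul, map_sub, Complex.conj_I, Complex.conj_ofReal] at h2
    linear_combination 2⁻¹ * h1 + 2⁻¹ * h2

theorem differentiableOn_fderiv_apply₂ {H : E × Conj E → (E →L[ℂ] Conj E →L[ℂ] ℂ)}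
    {O : Set (E × Conj E)} (hO : IsOpen O) (hH : HolOn H O) (a : E × Conj E) (b : E) (c : Conj E) :
    DifferentiableOn ℂ (fun z => fderiv ℂ H z a b c) O :=
  (((hH.fderiv hO).clm_comp (ContinuousLinearMap.apply ℂ _ a)).clm_comp
    (ContinuousLinearMap.apply ℂ _ b)).clm_comp (ContinuousLinearMap.apply ℂ _ c) |>.2

/-- The coefficient of a closed real-analytic `(1,1)`-form has a holomorphic extension that is
closed in both variables. -/
theorem exists_closed_complexification {Θ : E → E →L[ℝ] E →L[ℝ] ℝ} {x₀ : E}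
    (hΘ : AnalyticAt ℝ Θ x₀)
    (h11 : ∀ᶠ x in 𝓝 x₀, ∀ v w, Θ x (Complex.I • v) (Complex.I • w) = Θ x v w)
    (halt : ∀ᶠ x in 𝓝 x₀, ∀ v w, Θ x v w = - Θ x w v)
    (hcl : ∀ᶠ x in 𝓝 x₀, ∀ a b c,
      fderiv ℝ Θ x a b c - fderiv ℝ Θ x b a c + fderiv ℝ Θ x c a b = 0) :
    ∃ (H : E × Conj E → (E →L[ℂ] Conj E →L[ℂ] ℂ)) (r : ℝ), 0 < r ∧
      AnalyticOnNhd ℂ H (sqConj (Metric.ball x₀ r)) ∧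
      (∀ x ∈ Metric.ball x₀ r, ∀ v w, Complex.I * (H (x, toConj x) v (toConj w) -
        H (x, toConj x) w (toConj v)) = Θ x v w) ∧
      (∀ z ∈ sqConj (Metric.ball x₀ r), ∀ a b,
        fderiv ℂ H z (a, 0) b = fderiv ℂ H z (b, 0) a) ∧
      (∀ z ∈ sqConj (Metric.ball x₀ r), ∀ a b c,
        fderiv ℂ H z (0, a) b c = fderiv ℂ H z (0, c) b a) := by
  obtain ⟨H, hH, hHd⟩ := exists_complexification
    (((hermPart E).analyticAt _).comp hΘ : AnalyticAt ℝ (hermPart E ∘ Θ) x₀)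
  have hev : ∀ᶠ z in 𝓝 (x₀, toConj x₀), AnalyticAt ℂ H z := hH.eventually_analyticAt
  obtain ⟨r₁, hr₁, hr₁'⟩ : ∃ r > 0, sqConj (Metric.ball x₀ r) ⊆ {z | AnalyticAt ℂ H z} := by
    obtain ⟨r, hr, hr'⟩ := Metric.eventually_nhds_iff_ball.1 hev
    refine ⟨r, hr, fun z hz => hr' z ?_⟩
    rw [← ball_prod_same]
    exact hz
  obtain ⟨r₂, hr₂, hr₂'⟩ := Metric.eventually_nhds_iff_ball.1
    (hHd.and (h11.and (halt.and (hcl.and hΘ.eventually_analyticAt))))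
  have hr : 0 < min r₁ r₂ := lt_min hr₁ hr₂
  set B := Metric.ball x₀ (min r₁ r₂) with hBdef
  have hB : IsOpen B := Metric.isOpen_ball
  have hBc : Convex ℝ B := convex_ball _ _
  have hO := isOpen_sqConj hB
  have hH' : AnalyticOnNhd ℂ H (sqConj B) := fun z hz =>
    hr₁' ⟨Metric.ball_subset_ball (min_le_left _ _) hz.1,
      Metric.ball_subset_ball (min_le_left _ _) hz.2⟩
  have hHol := hH'.holOn
  have hd : ∀ x ∈ B, H (x, toConj x) = hermPart E (Θ x) := fun x hx =>
    (hr₂' x (Metric.ball_subset_ball (min_le_right _ _) hx)).1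
  have hΘB : ∀ x ∈ B, _ := fun x hx => (hr₂' x (Metric.ball_subset_ball (min_le_right _ _) hx)).2
  have hder : ∀ x ∈ B, ∀ a, fderiv ℂ H (x, toConj x) (a, toConj a) =
      hermPart E (fderiv ℝ Θ x a) := by
    intro x hx a
    have h1 := HasFDerivAt.comp (g := H) (f := fun x : E => (x, toConj x)) x
      ((hHol.hasFDerivAt hO (⟨hx, hx⟩ : (x, toConj x) ∈ sqConj B)).restrictScalars ℝ)
      ((hasFDerivAt_id x).prodMk (toConj (E := E)).hasFDerivAt)
    have h2 := (hermPart E).hasFDerivAt.comp x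
      ((hΘB x hx).2.2.2.differentiableAt.hasFDerivAt)
    have h3 := h1.unique (h2.congr_of_eventuallyEq (by
      filter_upwards [hB.mem_nhds hx] with y hy using hd y hy))
    exact congrArg (fun A : E →L[ℝ] _ => A a) h3
  -- The real derivative of the coefficient is the derivative of `H` along `(a, ā)`. Its complex
  -- linear and antilinear parts are the derivatives along `(a, 0)` and `(0, ā)`.
  have hS : ∀ x ∈ B, ∀ a b c, fderiv ℂ H (x, toConj x) (a, 0) b (toConj c) =
      2⁻¹ * (hermPart E (fderiv ℝ Θ x a) b (toConj c) -
        Complex.I * hermPart E (fderiv ℝ Θ x (Complex.I • a)) b (toConj c)) := by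
    intro x hx a b c
    rw [← hder x hx, ← hder x hx, toConj_smul, Complex.conj_I]
    have e1 : ((a, toConj a) : E × Conj E) = (a, 0) + (0, toConj a) := by simp
    have e2 : ((Complex.I • a, -Complex.I • toConj a) : E × Conj E) =
      Complex.I • (a, 0) - Complex.I • (0, toConj a) := by simp
    rw [e1, e2, map_add, map_sub, map_smul, map_smul]
    simp only [add_apply, sub_apply, smul_apply, smul_eq_mul]
    linear_combination (2⁻¹ * (fderiv ℂ H (x, toConj x) (a, 0) b (toConj c) -
      fderiv ℂ H (x, toConj x) (0, toConj a) b (toConj c))) * Complex.I_mul_I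
  have hT : ∀ x ∈ B, ∀ a b c, fderiv ℂ H (x, toConj x) (0, toConj a) b (toConj c) =
      2⁻¹ * (hermPart E (fderiv ℝ Θ x a) b (toConj c) +
        Complex.I * hermPart E (fderiv ℝ Θ x (Complex.I • a)) b (toConj c)) := by
    intro x hx a b c
    rw [← hder x hx, ← hder x hx, toConj_smul, Complex.conj_I]
    have e1 : ((a, toConj a) : E × Conj E) = (a, 0) + (0, toConj a) := by simp
    have e2 : ((Complex.I • a, -Complex.I • toConj a) : E × Conj E) =
      Complex.I • (a, 0) - Complex.I • (0, toConj a) := by simp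
    rw [e1, e2, map_add, map_sub, map_smul, map_smul]
    simp only [add_apply, sub_apply, smul_apply, smul_eq_mul]
    linear_combination (-2⁻¹ * (fderiv ℂ H (x, toConj x) (a, 0) b (toConj c) -
      fderiv ℂ H (x, toConj x) (0, toConj a) b (toConj c))) * Complex.I_mul_I
  have hP : ∀ x ∈ B, ∀ a b c, _ := fun x hx a b c => by
    have hΘx := (hΘB x hx).2.2.2.differentiableAt.hasFDerivAt
    have hap : ∀ v w : E, HasFDerivAt (fun y => Θ y v w)
        ((ContinuousLinearMap.apply ℝ ℝ w) ∘L (ContinuousLinearMap.apply ℝ (E →L[ℝ] ℝ) v) ∘L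
          fderiv ℝ Θ x) x := fun v w =>
      (ContinuousLinearMap.apply ℝ ℝ w).hasFDerivAt.comp x
        ((ContinuousLinearMap.apply ℝ (E →L[ℝ] ℝ) v).hasFDerivAt.comp x hΘx)
    refine hermPart_closed (fderiv ℝ Θ x) (fun a v w => ?_) (fun a v w => ?_) (hΘB x hx).2.2.1 a b c
    · refine congrArg (fun A : E →L[ℝ] ℝ => A a) ((hap (Complex.I • v) (Complex.I • w)).unique
        ((hap v w).congr_of_eventuallyEq ?_))
      filter_upwards [hB.mem_nhds hx] with y hy using (hΘB y hy).1 v w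
    · refine congrArg (fun A : E →L[ℝ] ℝ => A a) ((hap v w).unique
        ((hap w v).fun_neg.congr_of_eventuallyEq ?_))
      filter_upwards [hB.mem_nhds hx] with y hy using (hΘB y hy).2.1 v w
  -- Both closedness relations hold on the diagonal by `hermPart_closed` and extend to the whole
  -- neighbourhood by the identity theorem.
  refine ⟨H, min r₁ r₂, hr, hH', fun x hx v w => ?_, ?_, ?_⟩
  · rw [hd x hx]
    exact eq_hermPart _ (hΘB x hx).1 (hΘB x hx).2.1 v w
  · rintro z ⟨hz1, hz2⟩ a b
    ext c
    refine sub_eq_zero.1 (eq_zero_of_diag hB hBc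
      (f := fun z => fderiv ℂ H z (a, 0) b c - fderiv ℂ H z (b, 0) a c)
      ((differentiableOn_fderiv_apply₂ hO hHol _ _ _).sub
        (differentiableOn_fderiv_apply₂ hO hHol _ _ _)) (fun x hx => ?_) hz1 hz2)
    obtain ⟨c, rfl⟩ := (toConj (E := E)).surjective c
    rw [hS x hx, hS x hx, (hP x hx a b c).1, sub_self]
  · rintro z ⟨hz1, hz2⟩ a b c
    refine sub_eq_zero.1 (eq_zero_of_diag hB hBc
      (f := fun z => fderiv ℂ H z (0, a) b c - fderiv ℂ H z (0, c) b a)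
      ((differentiableOn_fderiv_apply₂ hO hHol _ _ _).sub
        (differentiableOn_fderiv_apply₂ hO hHol _ _ _)) (fun x hx => ?_) hz1 hz2)
    obtain ⟨c, rfl⟩ := (toConj (E := E)).surjective c
    obtain ⟨a, rfl⟩ := (toConj (E := E)).surjective a
    rw [hT x hx, hT x hx, (hP x hx a b c).2, sub_self]

/-- Local polarized potentials of closed real-analytic `(1,1)`-forms. -/
theorem exists_isKernel {Θ : E → E →L[ℝ] E →L[ℝ] ℝ} {x₀ : E}
    (hΘ : AnalyticAt ℝ Θ x₀)
    (h11 : ∀ᶠ x in 𝓝 x₀, ∀ v w, Θ x (Complex.I • v) (Complex.I • w) = Θ x v w)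
    (halt : ∀ᶠ x in 𝓝 x₀, ∀ v w, Θ x v w = - Θ x w v)
    (hcl : ∀ᶠ x in 𝓝 x₀, ∀ a b c,
      fderiv ℝ Θ x a b c - fderiv ℝ Θ x b a c + fderiv ℝ Θ x c a b = 0) :
    ∃ (r : ℝ) (k : E × Conj E → ℂ), 0 < r ∧
      IsKernel (fun x v w => Θ x v w) (Metric.ball x₀ r) k := by
  obtain ⟨H, r, hr, hH, hHΘ, hH1, hH2⟩ := exists_closed_complexification hΘ h11 halt hcl
  have hx₀ : (x₀, toConj x₀) ∈ sqConj (Metric.ball x₀ r) :=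
    ⟨Metric.mem_ball_self hr, Metric.mem_ball_self hr⟩
  obtain ⟨f, hf, hfH, hf0⟩ := exists_primitive (hH _ hx₀) (by
    filter_upwards [(isOpen_sqConj Metric.isOpen_ball).mem_nhds hx₀] with z hz using hH1 z hz)
  obtain ⟨r₁, hr₁, hr₁'⟩ : ∃ r' > 0, r' ≤ r ∧ ∀ z ∈ sqConj (Metric.ball x₀ r'),
      AnalyticAt ℂ f z ∧ ∀ a, fderiv ℂ f z (a, 0) = H z a := by
    obtain ⟨r', hr', hr''⟩ := Metric.eventually_nhds_iff_ball.1 (hf.eventually_analyticAt.and hfH)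
    refine ⟨min r r', lt_min hr hr', min_le_left _ _, fun z hz => hr'' z ?_⟩
    rw [← ball_prod_same]
    exact ⟨Metric.ball_subset_ball (min_le_right _ _) hz.1,
      Metric.ball_subset_ball (min_le_right _ _) hz.2⟩
  obtain ⟨hr₁r, hr₁''⟩ := hr₁'
  set B := Metric.ball x₀ r₁ with hBdef
  have hB : IsOpen B := Metric.isOpen_ball
  have hBc : Convex ℝ B := convex_ball _ _
  have hO := isOpen_sqConj hB
  have hxB : x₀ ∈ B := Metric.mem_ball_self hr₁
  have hsub : sqConj B ⊆ sqConj (Metric.ball x₀ r) := fun z hz =>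
    ⟨Metric.ball_subset_ball hr₁r hz.1, Metric.ball_subset_ball hr₁r hz.2⟩
  have hfhol : HolOn f (sqConj B) := AnalyticOnNhd.holOn fun z hz => (hr₁'' z hz).1
  -- The primitive `f` in `p` has to be closed in `q̄`. The defect is constant in `p` because `H` is
  -- closed in `q̄`, and it is zero at `p = x₀` by the normalization `f(x₀, ·) = 0`.
  have hfcl : ∀ z ∈ sqConj B, ∀ b c, fderiv ℂ f z (0, b) c = fderiv ℂ f z (0, c) b := by
    rintro ⟨p, q⟩ ⟨hp, hq⟩ b c
    have hder : ∀ p ∈ B, HasFDerivWithinAt (𝕜 := ℝ)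
        (fun p => fderiv ℂ f (p, q) (0, b) c - fderiv ℂ f (p, q) (0, c) b) (0 : E →L[ℝ] ℂ) B p := by
      intro p hp
      have hz : (p, q) ∈ sqConj B := ⟨hp, hq⟩
      have e : ∀ b c : Conj E, HasFDerivAt (𝕜 := ℝ) (fun p => fderiv ℂ f (p, q) (0, b) c)
          ((((ContinuousLinearMap.apply ℂ ℂ c) ∘L
            (fderiv ℂ (fderiv ℂ f) (p, q)).flip (0, b)) ∘L .inl ℂ E (Conj E)).restrictScalars ℝ)
            p := fun b c =>
        (HasFDerivAt.comp (g := fun z => fderiv ℂ f z (0, b) c) (f := fun p : E => (p, q)) p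
          ((ContinuousLinearMap.apply ℂ ℂ c).hasFDerivAt.comp (p, q)
            (hfhol.hasFDerivAt_fderiv_apply hO hz (0, b)))
              (hasFDerivAt_prodMk_left p q)).restrictScalars ℝ
      refine (((e b c).sub (e c b)).congr_fderiv ?_).hasFDerivWithinAt
      ext a
      have key : ∀ b c : Conj E, fderiv ℂ (fderiv ℂ f) (p, q) (a, 0) (0, b) c =
          fderiv ℂ H (p, q) (0, b) a c := by
        intro b c
        rw [hfhol.fderiv_fderiv_symm hO hz]
        have h1 := hfhol.hasFDerivAt_fderiv_apply hO hz (a, 0)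
        have h2 := (ContinuousLinearMap.apply ℂ (Conj E →L[ℂ] ℂ) a).hasFDerivAt.comp (p, q)
          (hH.holOn.hasFDerivAt (isOpen_sqConj Metric.isOpen_ball) (hsub hz))
        have h3 := h1.unique (h2.congr_of_eventuallyEq (by
          filter_upwards [hO.mem_nhds hz] with y hy using (hr₁'' y hy).2 a))
        exact congrArg (fun A : E × Conj E →L[ℂ] Conj E →L[ℂ] ℂ => A (0, b) c) h3
      have := key b c
      have h2 := key c b
      rw [hH2 _ (hsub hz) b a c, ← h2] at this
      simpa [sub_eq_zero] using this
    have h0 : ∀ b : Conj E, fderiv ℂ f (x₀, q) (0, b) = 0 := by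
      intro b
      have h1 := HasFDerivAt.comp (g := f) (f := fun q : Conj E => (x₀, q)) q
        (hfhol.hasFDerivAt hO (⟨hxB, hq⟩ : (x₀, q) ∈ sqConj B)) (hasFDerivAt_prodMk_right x₀ q)
      have h2 := h1.unique ((hasFDerivAt_const (0 : Conj E →L[ℂ] ℂ) q).congr_of_eventuallyEq
        (Filter.Eventually.of_forall fun q => hf0 q))
      exact congrArg (fun A : Conj E →L[ℂ] Conj E →L[ℂ] ℂ => A b) h2
    have := hBc.is_const_of_fderivWithin_eq_zero (𝕜 := ℝ)
      (fun q hq => (hder q hq).differentiableWithinAt)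
      (fun q hq => (hder q hq).fderivWithin (hB.uniqueDiffOn q hq)) hp hxB
    rw [h0, h0, zero_apply, zero_apply, sub_self] at this
    exact sub_eq_zero.1 this
  -- The second integration is in `q̄` with `p` as a parameter, so the factors are exchanged to
  -- apply the Poincaré lemma and exchanged back afterwards.
  let sw : Conj E × E →L[ℂ] E × Conj E := (ContinuousLinearMap.snd ℂ _ _).prod (.fst ℂ _ _)
  let ws : E × Conj E →L[ℂ] Conj E × E := (ContinuousLinearMap.snd ℂ _ _).prod (.fst ℂ _ _)
  obtain ⟨g, hg, hgf, -⟩ := exists_primitive (X := Conj E) (Y := E) (w := f ∘ sw)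
    (z₀ := (toConj x₀, x₀)) (AnalyticAt.comp (g := f) (f := sw) (x := (toConj x₀, x₀))
      (hr₁'' (x₀, toConj x₀) ⟨hxB, hxB⟩).1 (sw.analyticAt _)) (by
      have hev : ∀ᶠ z in 𝓝 (toConj x₀, x₀), sw z ∈ sqConj B :=
        sw.continuous.continuousAt.eventually_mem (hO.mem_nhds ⟨hxB, hxB⟩)
      filter_upwards [hev] with z hz a b
      rw [((hfhol.hasFDerivAt hO hz).comp z sw.hasFDerivAt).fderiv]
      exact hfcl _ hz a b)
  have hk0 : ∀ᶠ z in 𝓝 (x₀, toConj x₀), AnalyticAt ℂ (g ∘ ws) z ∧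
      ∀ w, fderiv ℂ (g ∘ ws) z (0, w) = f z w := by
    have h1 : Filter.Tendsto ws (𝓝 (x₀, toConj x₀)) (𝓝 (toConj x₀, x₀)) :=
      ws.continuous.tendsto (x₀, toConj x₀)
    filter_upwards [h1.eventually (hg.eventually_analyticAt.and hgf)] with z hz
    refine ⟨hz.1.comp (ws.analyticAt z), fun w => ?_⟩
    rw [(hz.1.differentiableAt.hasFDerivAt.comp z ws.hasFDerivAt).fderiv]
    exact hz.2 w
  obtain ⟨r₂, hr₂, hr₂'⟩ := Metric.eventually_nhds_iff_ball.1 hk0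
  have hr₃ : 0 < min r₁ r₂ := lt_min hr₁ hr₂
  have hB' : IsOpen (Metric.ball x₀ (min r₁ r₂)) := Metric.isOpen_ball
  have hk : ∀ z ∈ sqConj (Metric.ball x₀ (min r₁ r₂)), AnalyticAt ℂ (g ∘ ws) z ∧
      ∀ w, fderiv ℂ (g ∘ ws) z (0, w) = f z w := by
    intro z hz
    refine hr₂' z ?_
    rw [← ball_prod_same]
    exact ⟨Metric.ball_subset_ball (min_le_right _ _) hz.1,
      Metric.ball_subset_ball (min_le_right _ _) hz.2⟩
  have hkhol : HolOn (g ∘ ws) (sqConj (Metric.ball x₀ (min r₁ r₂))) :=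
    AnalyticOnNhd.holOn fun z hz => (hk z hz).1
  have hmix : ∀ x ∈ Metric.ball x₀ (min r₁ r₂), ∀ v w,
      mixedDeriv (g ∘ ws) (x, toConj x) v w = H (x, toConj x) v (toConj w) := by
    intro x hx v w
    have hz : (x, toConj x) ∈ sqConj (Metric.ball x₀ (min r₁ r₂)) := ⟨hx, hx⟩
    have hzB : (x, toConj x) ∈ sqConj B := ⟨Metric.ball_subset_ball (min_le_left _ _) hx,
      Metric.ball_subset_ball (min_le_left _ _) hx⟩
    have h1 := hkhol.hasFDerivAt_fderiv_apply (isOpen_sqConj hB') hz (0, toConj w)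
    have h2 := (ContinuousLinearMap.apply ℂ ℂ (toConj w)).hasFDerivAt.comp _
      (hfhol.hasFDerivAt hO hzB)
    have h3 := h1.unique (h2.congr_of_eventuallyEq (by
      filter_upwards [(isOpen_sqConj hB').mem_nhds hz] with y hy using (hk y hy).2 _))
    have h4 := congrArg (fun A : E × Conj E →L[ℂ] ℂ => A (v, 0)) h3
    refine h4.trans ?_
    change fderiv ℂ f (x, toConj x) (v, 0) (toConj w) = _
    rw [(hr₁'' _ hzB).2]
  obtain ⟨k, hk'⟩ := exists_isKernel_of_mixedDeriv (θ := fun x v w => Θ x v w) hB' hkhol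
    fun x hx v w => by
      rw [hmix x hx, hmix x hx]
      exact hHΘ x (Metric.ball_subset_ball ((min_le_left _ _).trans hr₁r) hx) v w
  exact ⟨_, k, hr₃, hk'⟩

end Projection

end CalabiLegendre

end

/-! ### Two-forms, `i∂∂̄` and coordinate changes -/

noncomputable section

set_option maxSynthPendingDepth 3

namespace CalabiLegendre

variable {E : Type*} [NormedAddCommGroup E] [NormedSpace ℂ E]

section Forms

/-- An alternating 2-form as a bilinear map. -/
def formBilin (E : Type*) [NormedAddCommGroup E] [NormedSpace ℂ E] :
    (E [⋀^Fin 2]→L[ℝ] ℝ) →L[ℝ] (E →L[ℝ] E →L[ℝ] ℝ) :=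
  (ContinuousLinearMap.compL ℝ E (E [×1]→L[ℝ] ℝ) (E →L[ℝ] ℝ)
    ((continuousMultilinearCurryFin1 ℝ E ℝ).toContinuousLinearEquiv : _ →L[ℝ] _)) ∘L
  ((continuousMultilinearCurryLeftEquiv ℝ (fun _ : Fin 2 => E) ℝ).toContinuousLinearEquiv :
    _ →L[ℝ] _) ∘L ContinuousAlternatingMap.toContinuousMultilinearMapCLM ℝ

theorem formBilin_apply (θ : E [⋀^Fin 2]→L[ℝ] ℝ) (v w : E) :
    formBilin E θ v w = θ ![v, w] := by
  change θ (Fin.cons v _) = _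
  congr 1
  ext i
  fin_cases i <;> rfl

theorem formBilin_swap (θ : E [⋀^Fin 2]→L[ℝ] ℝ) (v w : E) :
    formBilin E θ v w = - formBilin E θ w v := by
  rw [formBilin_apply, formBilin_apply]
  have := θ.map_swap ![w, v] (i := 0) (j := 1) (by decide)
  refine Eq.trans (congrArg θ ?_) this
  ext i
  fin_cases i <;> rfl

theorem extDeriv_two_apply {θ : E → E [⋀^Fin 2]→L[ℝ] ℝ} {x : E} (h : DifferentiableAt ℝ θ x)
    (a b c : E) : extDeriv θ x ![a, b, c] = fderiv ℝ (fun y => formBilin E (θ y)) x a b c -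
      fderiv ℝ (fun y => formBilin E (θ y)) x b a c +
      fderiv ℝ (fun y => formBilin E (θ y)) x c a b := by
  have key : ∀ v w : E, fderiv ℝ (fun y => θ y ![v, w]) x =
      (ContinuousLinearMap.apply ℝ ℝ w) ∘L (ContinuousLinearMap.apply ℝ (E →L[ℝ] ℝ) v) ∘L
          fderiv ℝ (fun y => formBilin E (θ y)) x := by
    intro v w
    have h1 := (ContinuousLinearMap.apply ℝ ℝ w).hasFDerivAt.comp x
      ((ContinuousLinearMap.apply ℝ (E →L[ℝ] ℝ) v).hasFDerivAt.comp x
        (((formBilin E).hasFDerivAt.comp x h.hasFDerivAt).differentiableAt).hasFDerivAt)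
    refine HasFDerivAt.fderiv (h1.congr_of_eventuallyEq (Filter.Eventually.of_forall fun y => ?_))
    exact (formBilin_apply (θ y) v w).symm
  rw [extDeriv_apply h, Fin.sum_univ_three]
  have r0 : (0 : Fin 3).removeNth ![a, b, c] = ![b, c] := by ext i; fin_cases i <;> rfl
  have r1 : (1 : Fin 3).removeNth ![a, b, c] = ![a, c] := by ext i; fin_cases i <;> rfl
  have r2 : (2 : Fin 3).removeNth ![a, b, c] = ![a, b] := by ext i; fin_cases i <;> rfl
  rw [r0, r1, r2, key, key, key]
  simp
  ring

end Forms

section Iddbar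

variable {F : Type*} [NormedAddCommGroup F] [NormedSpace ℂ F]

theorem iddbar_congr {f g : E → ℝ} {x : E} (h : f =ᶠ[𝓝 x] g) (v w : E) :
    iddbar f x v w = iddbar g x v w := by
  simp only [iddbar, h.fderiv.fderiv_eq]

/-- `i∂∂̄` commutes with holomorphic changes of coordinates. -/
theorem iddbar_comp {f : F → ℝ} {τ : E → F} {O : Set E} {x : E} (hO : IsOpen O) (hx : x ∈ O)
    (hτ : HolOn τ O) (hf : ContDiffAt ℝ 2 f (τ x)) (v w : E) :
    iddbar (f ∘ τ) x v w = iddbar f (τ x) (fderiv ℝ τ x v) (fderiv ℝ τ x w) := by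
  have hτx : HasFDerivAt τ (fderiv ℝ τ x) x :=
    ((hτ.1.contDiffAt (hO.mem_nhds hx)).differentiableAt (by simp)).hasFDerivAt
  have h1 : fderiv ℝ (f ∘ τ) =ᶠ[𝓝 x] fun y => fderiv ℝ f (τ y) ∘L
      (fderiv ℂ τ y).restrictScalars ℝ := by
    have hev : ∀ᶠ y in 𝓝 (τ x), DifferentiableAt ℝ f y :=
      (hf.eventually (by simp)).mono fun y hy => hy.differentiableAt (by simp)
    filter_upwards [hO.mem_nhds hx, hτx.continuousAt.eventually hev] with y hy hy'
    exact (hy'.hasFDerivAt.comp y ((hτ.hasFDerivAt hO hy).restrictScalars ℝ)).fderiv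
  have h2 : HasFDerivAt (fun y => fderiv ℝ f (τ y)) (fderiv ℝ (fderiv ℝ f) (τ x) ∘L fderiv ℝ τ x) x :=
    HasFDerivAt.comp x (((hf.fderiv_right (m := 1) (by norm_num)).differentiableAt
      (by simp)).hasFDerivAt) hτx
  have h3 : HasFDerivAt (fun y => (fderiv ℂ τ y).restrictScalars ℝ)
      ((ContinuousLinearMap.restrictScalarsL ℂ E F ℝ ℝ) ∘L
        ((fderiv ℂ (fderiv ℂ τ) x).restrictScalars ℝ)) x :=
    (ContinuousLinearMap.restrictScalarsL ℂ E F ℝ ℝ).hasFDerivAt.comp x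
      ((hτ.hasFDerivAt_fderiv hO hx).restrictScalars ℝ)
  have h4 := (h2.clm_comp h3).congr_of_eventuallyEq h1
  have hreal := hτ.fderiv_real_eq hO hx
  -- The extra term contains the second derivative of `τ`. It is complex bilinear, so it takes the
  -- same value on `(iv, w)` and `(v, iw)` and drops out of `i∂∂̄`.
  have h5 : ∀ a b, fderiv ℝ (fderiv ℝ (f ∘ τ)) x a b =
      fderiv ℝ f (τ x) (fderiv ℂ (fderiv ℂ τ) x a b) +
        fderiv ℝ (fderiv ℝ f) (τ x) (fderiv ℝ τ x a) (fderiv ℝ τ x b) := by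
    intro a b
    rw [h4.fderiv, hreal]
    rfl
  have h6 : ∀ a, fderiv ℝ τ x (Complex.I • a) = Complex.I • fderiv ℝ τ x a := by
    intro a
    rw [hreal]
    exact map_smul (fderiv ℂ τ x) _ _
  simp only [iddbar, h5, h6, map_smul, smul_apply]
  ring

/-- The pure second derivatives of `k` in `p` and in `q̄` take equal values on `(iv, w)` and `(v,
iw)`, so only the mixed ones survive. -/
theorem iddbar_diag {k : E × Conj E → ℂ} {B : Set E} (hB : IsOpen B) (hk : HolOn k (sqConj B))
    {x : E} (hx : x ∈ B) (v w : E) : iddbar (fun x => (k (x, toConj x)).re) x v w =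
      (Complex.I * (mixedDeriv k (x, toConj x) v w - mixedDeriv k (x, toConj x) w v)).re := by
  have hO := isOpen_sqConj hB
  have hxO : (x, toConj x) ∈ sqConj B := ⟨hx, hx⟩
  let δ : E →L[ℝ] E × Conj E := (ContinuousLinearMap.id ℝ E).prod ((toConj (E := E)) : E →L[ℝ] Conj E)
  have hδ : ∀ y ∈ B, δ y ∈ sqConj B := fun y hy => ⟨hy, hy⟩
  have h1 : fderiv ℝ (fun x => (k (x, toConj x)).re) =ᶠ[𝓝 x] fun y =>
      (Complex.reCLM ∘L (fderiv ℂ k (δ y)).restrictScalars ℝ) ∘L δ := by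
    filter_upwards [hB.mem_nhds hx] with y hy
    exact (Complex.reCLM.hasFDerivAt.comp y (((hk.hasFDerivAt hO (hδ y hy)).restrictScalars ℝ).comp
      y δ.hasFDerivAt)).fderiv
  have h2 : ∀ b, HasFDerivAt (fun y => fderiv ℝ (fun x => (k (x, toConj x)).re) y b)
      (Complex.reCLM ∘L ((fderiv ℂ (fderiv ℂ k) (δ x)).flip (δ b)).restrictScalars ℝ ∘L δ) x := by
    intro b
    have e := Complex.reCLM.hasFDerivAt.comp x
      (HasFDerivAt.comp (f := δ) x ((hk.hasFDerivAt_fderiv_apply hO hxO (δ b)).restrictScalars ℝ)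
        δ.hasFDerivAt)
    exact e.congr_of_eventuallyEq (h1.mono fun y hy =>
      congrArg (fun A : E →L[ℝ] ℝ => A b) hy)
  have hdiff : DifferentiableAt ℝ (fderiv ℝ (fun x => (k (x, toConj x)).re)) x := by
    have : ContDiffOn ℝ ω (fun x => (k (x, toConj x)).re) B :=
      Complex.reCLM.contDiff.comp_contDiffOn (hk.1.comp δ.contDiff.contDiffOn hδ)
    exact ((this.fderiv_of_isOpen (m := ω) hB (by simp)).contDiffAt (hB.mem_nhds hx)).differentiableAt
      (by simp)
  have h3 : ∀ a b, fderiv ℝ (fderiv ℝ (fun x => (k (x, toConj x)).re)) x a b =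
      (fderiv ℂ (fderiv ℂ k) (x, toConj x) (a, toConj a) (b, toConj b)).re := by
    intro a b
    have e := (ContinuousLinearMap.apply ℝ ℝ b).hasFDerivAt.comp x hdiff.hasFDerivAt
    exact congrArg (fun A : E →L[ℝ] ℝ => A a) (e.unique (h2 b))
  set D := fderiv ℂ (fderiv ℂ k) (x, toConj x) with hD
  have hsym : ∀ a b, D a b = D b a := hk.fderiv_fderiv_symm hO hxO
  have e1 : ∀ a : E, ((a, toConj a) : E × Conj E) = (a, 0) + (0, toConj a) := fun a => by simp
  have e2 : ∀ a : E, ((Complex.I • a, toConj (Complex.I • a)) : E × Conj E) =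
      Complex.I • (a, 0) - Complex.I • (0, toConj a) := fun a => by
    rw [toConj_smul, Complex.conj_I]; simp
  simp only [iddbar, h3, e2]
  rw [e1 v, e1 w]
  simp only [mixedDeriv, ← hD, map_add, map_sub, map_smul, add_apply, sub_apply, smul_apply,
    smul_eq_mul, hsym (0, toConj v) (w, 0), Complex.add_re,
    Complex.sub_re, Complex.mul_re, Complex.I_re, Complex.I_im, Complex.sub_im, Complex.add_im]
  ring

end Iddbar

section Manifold

variable {M : Type*} [TopologicalSpace M] [ChartedSpace E M]

theorem isManifold_real [IsManifold 𝓘(ℂ, E) ω M] : IsManifold 𝓘(ℝ, E) ω M :=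
  isManifold_of_contDiffOn 𝓘(ℝ, E) ω M fun e e' he he' => by
    have h := (contDiffGroupoid ω 𝓘(ℂ, E)).compatible he he'
    have h1 : ContDiffOn ℂ ω (e.symm ≫ₕ e') (e.symm ≫ₕ e').source := by
      simpa [contDiffPregroupoid] using (mem_groupoid_of_pregroupoid.1 h).1
    simpa using h1.restrict_scalars ℝ

/-- The change of coordinates between the preferred charts at `c` and `c'`. -/
def coordChange (E : Type*) [NormedAddCommGroup E] [NormedSpace ℂ E] {M : Type*}
    [TopologicalSpace M] [ChartedSpace E M] (c c' : M) : OpenPartialHomeomorph E E :=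
  (chartAt E c).symm ≫ₕ chartAt E c'

theorem mem_coordChange_source {c c' : M} {x : E} : x ∈ (coordChange E c c').source ↔
    x ∈ (chartAt E c).target ∧ (chartAt E c).symm x ∈ (chartAt E c').source := by
  simp [coordChange]

theorem holOn_coordChange [IsManifold 𝓘(ℂ, E) ω M] (c c' : M) :
    HolOn (coordChange E c c') (coordChange E c c').source := by
  have h := (contDiffGroupoid ω 𝓘(ℂ, E)).compatible (chart_mem_atlas E c) (chart_mem_atlas E c')
  have h1 : ContDiffOn ℂ ω (coordChange E c c') (coordChange E c c').source := by
    simpa [contDiffPregroupoid, coordChange] using (mem_groupoid_of_pregroupoid.1 h).1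
  exact ⟨h1.restrict_scalars ℝ, h1.differentiableOn (by simp)⟩

/-- The tangent space at a point is read in the preferred chart of that point, so the derivative of
an inverse chart is that of a coordinate change whose target chart varies with `x`. -/
theorem mfderiv_chart_symm [IsManifold 𝓘(ℝ, E) ω M] (c : M) {x : E}
    (hx : x ∈ (chartAt E c).target) : mfderiv 𝓘(ℝ, E) 𝓘(ℝ, E) (chartAt E c).symm x =
      fderiv ℝ (coordChange E c ((chartAt E c).symm x)) x := by
  have : IsManifold 𝓘(ℝ, E) 1 M := IsManifold.of_le (n := ω) (by simp)
  have h := (contMDiffOn_chart_symm (I := 𝓘(ℝ, E)) (n := 1) (x := c)).mdifferentiableOn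
    (by simp) |>.mdifferentiableAt ((chartAt E c).open_target.mem_nhds hx)
  rw [h.mfderiv]
  simp only [writtenInExtChartAt, mfld_simps, fderivWithin_univ]
  rfl

variable (κ : KahlerForm E M)

/-- The coordinate expression of a Kähler form. -/
def KahlerForm.inChart (c : M) (x : E) : E →L[ℝ] E →L[ℝ] ℝ :=
  formBilin E (formInChart κ.form c x)

theorem KahlerForm.inChart_apply [IsManifold 𝓘(ℝ, E) ω M] {c : M} {x : E}
    (hx : x ∈ (chartAt E c).target) (v w : E) : κ.inChart c x v w =
      κ.form ((chartAt E c).symm x) ![fderiv ℝ (coordChange E c ((chartAt E c).symm x)) x v,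
        fderiv ℝ (coordChange E c ((chartAt E c).symm x)) x w] := by
  rw [KahlerForm.inChart, formBilin_apply]
  have hA := mfderiv_chart_symm c hx
  refine congrArg (κ.form ((chartAt E c).symm x)) ?_
  ext i
  fin_cases i
  · exact congrArg (fun A : E →L[ℝ] E => A v) hA
  · exact congrArg (fun A : E →L[ℝ] E => A w) hA

end Manifold

end CalabiLegendre

end

/-! ### Kähler forms and polarized potentials in charts -/

noncomputable section

set_option maxSynthPendingDepth 3

namespace CalabiLegendre

variable {E : Type*} [NormedAddCommGroup E] [NormedSpace ℂ E]

section Separate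

theorem differentiableAt_conj_fromConj {g : E → ℂ} {y : E} (h : DifferentiableAt ℂ g y) :
    DifferentiableAt ℂ (fun z : Conj E => starRingEnd ℂ (g (fromConj E z))) (toConj y) := by
  have h1 : HasFDerivAt (fun z : Conj E => starRingEnd ℂ (g (fromConj E z)))
      ((Complex.conjCLE : ℂ →L[ℝ] ℂ) ∘L ((fderiv ℂ g y).restrictScalars ℝ ∘L fromConj E))
      (toConj y) :=
    (Complex.conjCLE : ℂ →L[ℝ] ℂ).hasFDerivAt.comp _
      (HasFDerivAt.comp (f := fromConj E) (toConj y)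
        (h.hasFDerivAt.restrictScalars ℝ) (fromConj E).hasFDerivAt)
  let A : Conj E →L[ℂ] ℂ :=
    { toFun := fun v => starRingEnd ℂ (fderiv ℂ g y (fromConj E v))
      map_add' := fun v w => by rw [map_add, map_add, map_add]
      map_smul' := fun c v => by
        have : fromConj E (c • v) = (starRingEnd ℂ c) • fromConj E v := rfl
        rw [this, map_smul, smul_eq_mul, map_mul, Complex.conj_conj]; rfl
      cont := by fun_prop }
  exact (hasFDerivAt_of_restrictScalars ℝ h1
    (show A.restrictScalars ℝ = _ from ContinuousLinearMap.ext fun _ => rfl)).differentiableAt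

theorem differentiableAt_conj_toConj {g : Conj E → ℂ} {y : E} (h : DifferentiableAt ℂ g (toConj y)) :
    DifferentiableAt ℂ (fun z : E => starRingEnd ℂ (g (toConj z))) y := by
  have h1 : HasFDerivAt (fun z : E => starRingEnd ℂ (g (toConj z)))
      ((Complex.conjCLE : ℂ →L[ℝ] ℂ) ∘L ((fderiv ℂ g (toConj y)).restrictScalars ℝ ∘L
        ((toConj (E := E)) : E →L[ℝ] Conj E))) y :=
    (Complex.conjCLE : ℂ →L[ℝ] ℂ).hasFDerivAt.comp _
      (HasFDerivAt.comp (f := toConj (E := E)) y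
        (h.hasFDerivAt.restrictScalars ℝ) (toConj (E := E)).hasFDerivAt)
  let A : E →L[ℂ] ℂ :=
    { toFun := fun v => starRingEnd ℂ (fderiv ℂ g (toConj y) (toConj v))
      map_add' := fun v w => by rw [map_add, map_add, map_add]
      map_smul' := fun c v => by
        rw [toConj_smul, map_smul, smul_eq_mul, map_mul, Complex.conj_conj]; rfl
      cont := by fun_prop }
  exact (hasFDerivAt_of_restrictScalars ℝ h1
    (show A.restrictScalars ℝ = _ from ContinuousLinearMap.ext fun _ => rfl)).differentiableAt

/-- Real-analytic separately holomorphic functions are holomorphic. -/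
theorem holOn_of_separately {X Y Z : Type*} [NormedAddCommGroup X] [NormedSpace ℂ X]
    [NormedAddCommGroup Y] [NormedSpace ℂ Y] [NormedAddCommGroup Z] [NormedSpace ℂ Z]
    {k : X × Y → Z} {O : Set (X × Y)} (hO : IsOpen O) (h : ContDiffOn ℝ ω k O)
    (h1 : ∀ x y, (x, y) ∈ O → DifferentiableAt ℂ (fun x => k (x, y)) x)
    (h2 : ∀ x y, (x, y) ∈ O → DifferentiableAt ℂ (fun y => k (x, y)) y) : HolOn k O := by
  refine ⟨h, fun ⟨x, y⟩ hz => ?_⟩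
  have hd : HasFDerivAt k (fderiv ℝ k (x, y)) (x, y) :=
    ((h.contDiffAt (hO.mem_nhds hz)).differentiableAt (by simp)).hasFDerivAt
  have e1 := (HasFDerivAt.comp (g := k) x hd (hasFDerivAt_prodMk_left x y)).unique
    ((h1 x y hz).hasFDerivAt.restrictScalars ℝ)
  have e2 := (HasFDerivAt.comp (g := k) y hd (hasFDerivAt_prodMk_right x y)).unique
    ((h2 x y hz).hasFDerivAt.restrictScalars ℝ)
  let A : X × Y →L[ℂ] Z := fderiv ℂ (fun x => k (x, y)) x ∘L .fst ℂ X Y +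
    fderiv ℂ (fun y => k (x, y)) y ∘L .snd ℂ X Y
  have hA : A.restrictScalars ℝ = fderiv ℝ k (x, y) := by
    refine ContinuousLinearMap.ext fun v => ?_
    have f1 := congrArg (fun A : X →L[ℝ] Z => A v.1) e1
    have f2 := congrArg (fun A : Y →L[ℝ] Z => A v.2) e2
    have f3 : v = (v.1, 0) + (0, v.2) := by simp
    change fderiv ℂ (fun x => k (x, y)) x v.1 + fderiv ℂ (fun y => k (x, y)) y v.2 =
      fderiv ℝ k (x, y) v
    conv_rhs => rw [f3, map_add]
    exact (congrArg₂ (· + ·) f1 f2).symm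
  exact (hasFDerivAt_of_restrictScalars ℝ hd hA).differentiableAt.differentiableWithinAt

theorem eq_swapConj {k : E × Conj E → ℂ} {B : Set E} (hB : IsOpen B) (hBc : Convex ℝ B)
    (hk : HolOn k (sqConj B)) (hr : ∀ x ∈ B, (k (x, toConj x)).im = 0) {z : E × Conj E}
    (hz : z ∈ sqConj B) : k z = swapConj k z := by
  refine sub_eq_zero.1 (eq_zero_of_diag hB hBc (f := fun z => k z - swapConj k z)
    (hk.sub (hk.swapConj hB)).2 (fun x hx => ?_) hz.1 hz.2)
  change k (x, toConj x) - starRingEnd ℂ (k (x, toConj x)) = 0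
  rw [Complex.conj_eq_iff_im.2 (hr x hx), sub_self]

/-- Reality on the diagonal forces `k = swapConj k`, so the mixed derivative is Hermitian and
`i(h(v, w) - h(w, v))` is already real; `iddbar_diag`, which only sees real parts, therefore
suffices. -/
theorem isKernel_iff_iddbar {k : E × Conj E → ℂ} {B : Set E} {θ : E → E → E → ℝ} (hB : IsOpen B)
    (hBc : Convex ℝ B) (hk : HolOn k (sqConj B)) (hr : ∀ x ∈ B, (k (x, toConj x)).im = 0)
    (h : ∀ x ∈ B, ∀ v w, iddbar (fun x => (k (x, toConj x)).re) x v w = θ x v w) :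
    IsKernel θ B k := by
  refine ⟨hk, hr, fun x hx v w => ?_⟩
  rw [← h x hx, iddbar_diag hB hk hx]
  have h1 : fderiv ℂ k =ᶠ[𝓝 (x, toConj x)] fderiv ℂ (swapConj k) := by
    refine Filter.EventuallyEq.fderiv ?_
    filter_upwards [(isOpen_sqConj hB).mem_nhds (⟨hx, hx⟩ : (x, toConj x) ∈ sqConj B)] with z hz
    exact eq_swapConj hB hBc hk hr hz
  have h2 : ∀ v w, mixedDeriv k (x, toConj x) v w = starRingEnd ℂ
      (mixedDeriv k (x, toConj x) w v) := by
    intro v w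
    rw [← mixedDeriv_swapConj hB hk hx]
    simp only [mixedDeriv, h1.fderiv_eq]
  rw [h2 w v]
  apply Complex.ext
  · simp
  · simp

end Separate

section Manifold

variable {M : Type*} [TopologicalSpace M] [ChartedSpace E M] (κ : KahlerForm E M)

theorem coordChange_apply (c c' : M) (x : E) :
    coordChange E c c' x = chartAt E c' ((chartAt E c).symm x) := rfl

theorem fderiv_coordChange_smul [IsManifold 𝓘(ℂ, E) ω M] {c c' : M} {x : E}
    (hx : x ∈ (coordChange E c c').source) (a : ℂ) (v : E) :
    fderiv ℝ (coordChange E c c') x (a • v) = a • fderiv ℝ (coordChange E c c') x v := by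
  rw [(holOn_coordChange c c').fderiv_real_eq (coordChange E c c').open_source hx]
  exact map_smul (fderiv ℂ (coordChange E c c') x) _ _

theorem hasFDerivAt_coordChange [IsManifold 𝓘(ℂ, E) ω M] {c c' : M} {x : E}
    (hx : x ∈ (coordChange E c c').source) :
    HasFDerivAt (coordChange E c c') (fderiv ℝ (coordChange E c c') x) x :=
  (((holOn_coordChange c c').1.contDiffAt
    ((coordChange E c c').open_source.mem_nhds hx)).differentiableAt (by simp)).hasFDerivAt

theorem fderiv_coordChange_comp [IsManifold 𝓘(ℂ, E) ω M] {c c' : M} {x : E}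
    (hx : x ∈ (coordChange E c c').source) (v : E) :
    fderiv ℝ (coordChange E c' c) (coordChange E c c' x) (fderiv ℝ (coordChange E c c') x v) =
      v := by
  have hx' := mem_coordChange_source.1 hx
  have hy : coordChange E c c' x ∈ (coordChange E c' c).source := by
    refine mem_coordChange_source.2 ⟨(chartAt E c').map_source hx'.2, ?_⟩
    rw [coordChange_apply, (chartAt E c').left_inv hx'.2]
    exact (chartAt E c).map_target hx'.1
  have h := (hasFDerivAt_coordChange hy).comp x (hasFDerivAt_coordChange hx)
  have h2 := h.unique ((hasFDerivAt_id x).congr_of_eventuallyEq (by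
    filter_upwards [(coordChange E c c').open_source.mem_nhds hx] with y hy
    have hy' := mem_coordChange_source.1 hy
    rw [Function.comp_apply, coordChange_apply, coordChange_apply, (chartAt E c').left_inv hy'.2,
      (chartAt E c).right_inv hy'.1, id]))
  exact congrArg (fun A : E →L[ℝ] E => A v) h2

theorem mem_coordChange_self {c : M} {x : E} (hx : x ∈ (chartAt E c).target) :
    x ∈ (coordChange E c ((chartAt E c).symm x)).source :=
  mem_coordChange_source.2 ⟨hx, mem_chart_source E _⟩

namespace KahlerForm

theorem analyticOnNhd_inChart (c : M) : AnalyticOnNhd ℝ (κ.inChart c) (chartAt E c).target :=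
  fun x hx => ((formBilin E).analyticAt _).comp (κ.analytic c x hx)

theorem inChart_swap (c : M) (x v w : E) : κ.inChart c x v w = - κ.inChart c x w v :=
  formBilin_swap _ v w

theorem inChart_smul_I [IsManifold 𝓘(ℂ, E) ω M] {c : M} {x : E} (hx : x ∈ (chartAt E c).target)
    (v w : E) : κ.inChart c x (Complex.I • v) (Complex.I • w) = κ.inChart c x v w := by
  have := isManifold_real (E := E) (M := M)
  rw [κ.inChart_apply hx, κ.inChart_apply hx, fderiv_coordChange_smul (mem_coordChange_self hx),
    fderiv_coordChange_smul (mem_coordChange_self hx)]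
  exact κ.type_one_one _ _ _

theorem inChart_pos [IsManifold 𝓘(ℂ, E) ω M] {c : M} {x : E} (hx : x ∈ (chartAt E c).target)
    {v : E} (hv : v ≠ 0) : 0 < κ.inChart c x v (Complex.I • v) := by
  have := isManifold_real (E := E) (M := M)
  rw [κ.inChart_apply hx, fderiv_coordChange_smul (mem_coordChange_self hx)]
  refine κ.pos _ _ fun h0 => hv ?_
  rw [← fderiv_coordChange_comp (mem_coordChange_self hx) v]
  exact (congrArg _ h0).trans (map_zero _)

theorem inChart_closed {c : M} {x : E} (hx : x ∈ (chartAt E c).target) (a b d : E) :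
    fderiv ℝ (κ.inChart c) x a b d - fderiv ℝ (κ.inChart c) x b a d +
      fderiv ℝ (κ.inChart c) x d a b = 0 := by
  have h := extDeriv_two_apply (κ.analytic c x hx).differentiableAt a b d
  rw [κ.closed c x hx] at h
  exact h.symm

theorem exists_isKernel_inChart [IsManifold 𝓘(ℂ, E) ω M] {c : M} {x : E}
    (hx : x ∈ (chartAt E c).target) : ∃ (r : ℝ) (k : E × Conj E → ℂ), 0 < r ∧
      Metric.ball x r ⊆ (chartAt E c).target ∧
      IsKernel (fun x v w => κ.inChart c x v w) (Metric.ball x r) k := by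
  have hev := (chartAt E c).open_target.mem_nhds hx
  obtain ⟨r, k, hr, hk⟩ := exists_isKernel (κ.analyticOnNhd_inChart c x hx)
    (by filter_upwards [hev] with y hy using κ.inChart_smul_I hy)
    (Filter.Eventually.of_forall fun y => κ.inChart_swap c y)
    (by filter_upwards [hev] with y hy using κ.inChart_closed hy)
  obtain ⟨r', hr', hr''⟩ := Metric.mem_nhds_iff.1 hev
  exact ⟨min r r', k, lt_min hr hr',
    (Metric.ball_subset_ball (min_le_right _ _)).trans hr'',
    hk.mono (Metric.ball_subset_ball (min_le_left _ _))⟩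

variable {κ}

/-- Brings an arbitrary local potential of a given diastasis to a convex set of a chart, where the
identity theorem applies. The polarization is separately holomorphic and real-analytic, hence
holomorphic. The form identity is stated in the preferred chart of each point and is transported by
the invariance of `i∂∂̄`. -/
theorem IsPolarizedPotential.isKernel [IsManifold 𝓘(ℂ, E) ω M] {U : Set M} {W : Set (M × M)}
    {u : M → ℝ} {uC : M × M → ℂ} (h : κ.IsPolarizedPotential U W u uC) {c : M} {B : Set E}
    (hB : IsOpen B) (hBc : Convex ℝ B) (hBt : B ⊆ (chartAt E c).target)
    (hBW : ∀ x ∈ B, ∀ y ∈ B, ((chartAt E c).symm x, (chartAt E c).symm y) ∈ W) :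
    IsKernel (fun x v w => κ.inChart c x v w) B
      (fun z => uC ((chartAt E c).symm z.1, (chartAt E c).symm (fromConj E z.2))) := by
  have := isManifold_real (E := E) (M := M)
  have hC1 : IsManifold 𝓘(ℂ, E) 1 M := IsManifold.of_le (n := ω) (by simp)
  have hO := isOpen_sqConj hB
  have hBU : ∀ x ∈ B, (chartAt E c).symm x ∈ U := fun x hx => (h.W_subset (hBW x hx x hx)).1
  have hdiag : ∀ x ∈ B, uC ((chartAt E c).symm x, (chartAt E c).symm x) =
    u ((chartAt E c).symm x) := fun x hx => h.diag _ (hBU x hx)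
  refine isKernel_iff_iddbar hB hBc (holOn_of_separately hO ?_ ?_ ?_) ?_ ?_
  · rw [← contMDiffOn_iff_contDiffOn]
    have hs := contMDiffOn_chart_symm (I := 𝓘(ℝ, E)) (n := ω) (x := c)
    have h1 : ContMDiffOn 𝓘(ℝ, E × Conj E) 𝓘(ℝ, E) ω
        (fun z : E × Conj E => (chartAt E c).symm z.1) (sqConj B) :=
      hs.comp (contMDiffOn_iff_contDiffOn.2 contDiffOn_fst) fun z hz => hBt hz.1
    have h2 : ContMDiffOn 𝓘(ℝ, E × Conj E) 𝓘(ℝ, E) ω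
        (fun z : E × Conj E => (chartAt E c).symm (fromConj E z.2)) (sqConj B) :=
      hs.comp (contMDiffOn_iff_contDiffOn.2
        ((fromConj E).contDiff.comp_contDiffOn contDiffOn_snd)) fun z hz => hBt hz.2
    exact h.polarization_analytic.comp (h1.prodMk h2) fun z hz => hBW _ hz.1 _ hz.2
  · rintro x y ⟨hx, hy⟩
    have h1 := (h.holomorphic ((chartAt E c).symm (fromConj E y))).comp
      ((mdifferentiableOn_atlas_symm (I := 𝓘(ℂ, E)) (chart_mem_atlas E c)).mono hBt)
      fun x hx => hBW x hx _ hy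
    exact (mdifferentiableOn_iff_differentiableOn.1 h1).differentiableAt (hB.mem_nhds hx)
  · rintro x y ⟨hx, hy⟩
    have h1 := (h.antiholomorphic ((chartAt E c).symm x)).comp
      ((mdifferentiableOn_atlas_symm (I := 𝓘(ℂ, E)) (chart_mem_atlas E c)).mono hBt)
      fun y hy => hBW x hx y hy
    have h2 := (mdifferentiableOn_iff_differentiableOn.1 h1).differentiableAt (hB.mem_nhds hy)
    have h3 := differentiableAt_conj_fromConj h2
    simp only [Function.comp_apply, Complex.conj_conj] at h3
    exact h3
  · intro x hx
    change (uC ((chartAt E c).symm x, (chartAt E c).symm x)).im = 0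
    rw [hdiag x hx, Complex.ofReal_im]
  · intro x hx v w
    rw [κ.inChart_apply (hBt hx)]
    refine Eq.trans ?_ (h.potential _ (hBU x hx) _ _).symm
    set p := (chartAt E c).symm x with hp
    have hxs : x ∈ (coordChange E c p).source := mem_coordChange_self (hBt hx)
    have hf : ContDiffAt ℝ 2 (u ∘ (chartAt E p).symm) (coordChange E c p x) := by
      have h1 := (h.analytic.contMDiffAt (h.isOpen_U.mem_nhds (hBU x hx))).comp_of_eq (y := p)
        (contMDiffOn_chart_symm (I := 𝓘(ℝ, E)) (n := ω) (x := p) |>.contMDiffAt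
          ((chartAt E p).open_target.mem_nhds (mem_chart_target E p)))
          ((chartAt E p).left_inv (mem_chart_source E p))
      exact (contMDiffAt_iff_contDiffAt.1 h1).of_le (by simp)
    refine Eq.trans ?_ (iddbar_comp (coordChange E c p).open_source hxs (holOn_coordChange c p) hf v w)
    refine iddbar_congr ?_ v w
    filter_upwards [hB.mem_nhds hx, (coordChange E c p).open_source.mem_nhds hxs] with y hy hy'
    change (uC ((chartAt E c).symm y, (chartAt E c).symm y)).re = _
    rw [hdiag y hy, Complex.ofReal_re, Function.comp_apply, Function.comp_apply, coordChange_apply,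
      (chartAt E p).left_inv (mem_coordChange_source.1 hy').2]

end KahlerForm

/-- The converse passage, used to build a diastasis. Convexity of `B` supplies the connectedness of
the domain of the polarization. -/
theorem IsKernel.isPolarizedPotential [IsManifold 𝓘(ℂ, E) ω M] {c : M} {B : Set E}
    {k : E × Conj E → ℂ} (h : IsKernel (fun x v w => κ.inChart c x v w) B k)
    (hB : IsOpen B) (hBc : Convex ℝ B) (hBt : B ⊆ (chartAt E c).target) :
    κ.IsPolarizedPotential ((chartAt E c).source ∩ chartAt E c ⁻¹' B)
      (((chartAt E c).source ∩ chartAt E c ⁻¹' B) ×ˢ ((chartAt E c).source ∩ chartAt E c ⁻¹' B))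
      (fun p => (k (chartAt E c p, toConj (chartAt E c p))).re)
      (fun z => k (chartAt E c z.1, toConj (chartAt E c z.2))) := by
  have := isManifold_real (E := E) (M := M)
  have hC1 : IsManifold 𝓘(ℂ, E) 1 M := IsManifold.of_le (n := ω) (by simp)
  set U := (chartAt E c).source ∩ chartAt E c ⁻¹' B with hU
  have hUo : IsOpen U := (chartAt E c).isOpen_inter_preimage hB
  have hO := isOpen_sqConj hB
  have hUc : IsPreconnected U := by
    have : U = (chartAt E c).symm '' B := by
      rw [hU, (chartAt E c).symm_image_eq_source_inter_preimage hBt]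
    rw [this]
    exact hBc.isPreconnected.image _ ((chartAt E c).continuousOn_symm.mono hBt)
  have hch := (contMDiffOn_chart (I := 𝓘(ℝ, E)) (n := ω) (x := c)).mono
    (Set.inter_subset_left : U ⊆ _)
  let δ : E →L[ℝ] E × Conj E := (ContinuousLinearMap.id ℝ E).prod ((toConj (E := E)) : E →L[ℝ] Conj E)
  have hre : ContDiffOn ℝ ω (fun x => (k (x, toConj x)).re) B :=
    Complex.reCLM.contDiff.comp_contDiffOn (h.hol.1.comp δ.contDiff.contDiffOn fun y hy => ⟨hy, hy⟩)
  refine ⟨hUo, hUo.prod hUo, hUc.prod hUc, subset_rfl, fun p hp => ⟨hp, hp⟩, ?_, ?_, ?_, ?_, ?_, ?_⟩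
  · exact (contMDiffOn_iff_contDiffOn.2 hre).comp hch fun p hp => hp.2
  · intro p hp
    suffices key : ∀ v w : E, κ.form p ![v, w] =
        iddbar ((fun p => (k (chartAt E c p, toConj (chartAt E c p))).re) ∘ (chartAt E p).symm)
          (chartAt E p p) v w from key
    intro v w
    have hps : chartAt E p p ∈ (coordChange E p c).source :=
      mem_coordChange_source.2 ⟨mem_chart_target E p, by
        rw [(chartAt E p).left_inv (mem_chart_source E p)]; exact hp.1⟩
    have hcp : coordChange E p c (chartAt E p p) = chartAt E c p := by
      rw [coordChange_apply, (chartAt E p).left_inv (mem_chart_source E p)]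
    have h1 : iddbar ((fun p => (k (chartAt E c p, toConj (chartAt E c p))).re) ∘ (chartAt E p).symm)
        (chartAt E p p) v w = iddbar ((fun x => (k (x, toConj x)).re) ∘ (coordChange E p c))
          (chartAt E p p) v w := rfl
    have h2 : ContDiffAt ℝ 2 (fun x => (k (x, toConj x)).re) (chartAt E c p) :=
      (hre.contDiffAt (hB.mem_nhds hp.2)).of_le (by simp)
    rw [h1, iddbar_comp (coordChange E p c).open_source hps (holOn_coordChange p c)
      (by rw [hcp]; exact h2), hcp, iddbar_diag hB h.hol hp.2, h.form _ hp.2, Complex.ofReal_re,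
      κ.inChart_apply (hBt hp.2)]
    have h3 := fderiv_coordChange_comp hps v
    have h4 := fderiv_coordChange_comp hps w
    rw [hcp] at h3 h4
    rw [(chartAt E c).left_inv hp.1, h3, h4]
  · have h1 : ContMDiffOn (𝓘(ℝ, E).prod 𝓘(ℝ, E)) 𝓘(ℝ, E) ω
        (fun z : M × M => chartAt E c z.1) (U ×ˢ U) :=
      hch.comp contMDiffOn_fst fun z hz => hz.1
    have h2 : ContMDiffOn (𝓘(ℝ, E).prod 𝓘(ℝ, E)) 𝓘(ℝ, Conj E) ω
        (fun z : M × M => toConj (chartAt E c z.2)) (U ×ˢ U) :=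
      ((toConj (E := E)).contDiff.contMDiff.comp_contMDiffOn
        (hch.comp contMDiffOn_snd fun z hz => hz.2))
    exact (contMDiffOn_iff_contDiffOn.2 h.hol.1).comp (h1.prodMk_space h2) fun z hz =>
      ⟨hz.1.2, hz.2.2⟩
  · intro q p hp
    have h1 : DifferentiableAt ℂ (fun x => k (x, toConj (chartAt E c q))) (chartAt E c p) :=
      DifferentiableAt.comp (g := k) (f := fun x => (x, toConj (chartAt E c q))) (chartAt E c p)
        (h.hol.2.differentiableAt (hO.mem_nhds ⟨hp.1.2, hp.2.2⟩))
        (hasFDerivAt_prodMk_left _ _).differentiableAt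
    exact (h1.mdifferentiableAt.comp p (mdifferentiableAt_atlas (I := 𝓘(ℂ, E))
      (chart_mem_atlas E c) hp.1.1)).mdifferentiableWithinAt
  · intro p q hq
    have h1 : DifferentiableAt ℂ (fun y => k (chartAt E c p, y)) (toConj (chartAt E c q)) :=
      DifferentiableAt.comp (g := k) (f := fun y => (chartAt E c p, y)) (toConj (chartAt E c q))
        (h.hol.2.differentiableAt (hO.mem_nhds ⟨hq.1.2, hq.2.2⟩))
        (hasFDerivAt_prodMk_right _ _).differentiableAt
    exact ((differentiableAt_conj_toConj h1).mdifferentiableAt.comp q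
      (mdifferentiableAt_atlas (I := 𝓘(ℂ, E)) (chart_mem_atlas E c) hq.2.1)).mdifferentiableWithinAt
  · intro p hp
    exact Complex.ext rfl (h.real _ hp.2)

end Manifold

end CalabiLegendre

end

/-! ### The Kähler distance compared with the topology and with charts -/

noncomputable section

set_option maxSynthPendingDepth 3

namespace CalabiLegendre

open MeasureTheory

/-- A positive function that is homogeneous of degree two is bounded below by the square of the
norm. -/
theorem exists_le_of_homogeneous {E : Type*} [NormedAddCommGroup E] [NormedSpace ℝ E]
    [FiniteDimensional ℝ E] {Q : E → ℝ} (hc : Continuous Q) (hQ : ∀ (t : ℝ) v, Q (t • v) = t ^ 2 * Q v)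
    (hpos : ∀ v, v ≠ 0 → 0 < Q v) : ∃ b : ℝ, 0 < b ∧ ∀ v, b * ‖v‖ ^ 2 ≤ Q v := by
  have h0 : Q 0 = 0 := by simpa using hQ 0 0
  rcases subsingleton_or_nontrivial E with hE | hE
  · exact ⟨1, one_pos, fun v => by simp [Subsingleton.elim v 0, h0]⟩
  · obtain ⟨w, hw, hmin⟩ := (isCompact_sphere (0 : E) 1).exists_isMinOn
      (f := Q) (NormedSpace.sphere_nonempty.2 zero_le_one) hc.continuousOn
    refine ⟨_, hpos w (by rintro rfl; simp at hw), fun v => ?_⟩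
    rcases eq_or_ne v 0 with rfl | hv
    · simp [h0]
    · have hv' : ‖v‖ ≠ 0 := norm_ne_zero_iff.2 hv
      have h1 : (‖v‖⁻¹ • v) ∈ Metric.sphere (0 : E) 1 := by simp [norm_smul, hv']
      have h2 : Q w ≤ Q (‖v‖⁻¹ • v) := hmin h1
      rw [hQ] at h2
      calc Q w * ‖v‖ ^ 2 ≤ (‖v‖⁻¹) ^ 2 * Q v * ‖v‖ ^ 2 := by gcongr
        _ = Q v := by field_simp

variable {E : Type*} [NormedAddCommGroup E] [NormedSpace ℂ E]
  {M : Type*} [TopologicalSpace M] [ChartedSpace E M] (κ : KahlerForm E M)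

theorem mfderiv_chart [IsManifold 𝓘(ℝ, E) ω M] {c p : M} (hp : p ∈ (chartAt E c).source) :
    mfderiv 𝓘(ℝ, E) 𝓘(ℝ, E) (chartAt E c) p = fderiv ℝ (coordChange E p c) (chartAt E p p) := by
  have : IsManifold 𝓘(ℝ, E) 1 M := IsManifold.of_le (n := ω) (by simp)
  have h := mdifferentiableAt_atlas (I := 𝓘(ℝ, E)) (chart_mem_atlas E c) hp
  rw [h.mfderiv]
  simp only [writtenInExtChartAt, mfld_simps, fderivWithin_univ]
  rfl

namespace KahlerForm

/-- The norm of the Kähler metric. -/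
@[reducible] def tangentENorm (x : M) : ENorm (TangentSpace 𝓘(ℝ, E) x) :=
  ⟨fun v => ENNReal.ofReal (Real.sqrt (κ.form x ![v, tangentJ x v]))⟩

/-- The square of the norm of a tangent vector for the Kähler metric. -/
def metricSq (x : M) (v : E) : ℝ := formBilin E (show E [⋀^Fin 2]→L[ℝ] ℝ from κ.form x) v (Complex.I • v)

theorem form_tangentJ (x : M) (v : TangentSpace 𝓘(ℝ, E) x) :
    κ.form x ![v, tangentJ x v] = κ.metricSq x v :=
  (formBilin_apply (show E [⋀^Fin 2]→L[ℝ] ℝ from κ.form x) v (Complex.I • (show E from v))).symm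

theorem metricSq_smul (x : M) (t : ℝ) (v : E) :
    κ.metricSq x (t • v) = t ^ 2 * κ.metricSq x v := by
  rw [metricSq, metricSq, smul_comm Complex.I t v]
  simp only [map_smul, smul_apply, smul_eq_mul]
  ring

theorem metricSq_inChart [IsManifold 𝓘(ℂ, E) ω M] {c p : M} (hp : p ∈ (chartAt E c).source)
    (v : E) : κ.metricSq p v = κ.inChart c (chartAt E c p)
      (fderiv ℝ (coordChange E p c) (chartAt E p p) v)
      (Complex.I • fderiv ℝ (coordChange E p c) (chartAt E p p) v) := by
  have := isManifold_real (E := E) (M := M)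
  have hps : chartAt E p p ∈ (coordChange E p c).source :=
    mem_coordChange_source.2 ⟨mem_chart_target E p, by
      rw [(chartAt E p).left_inv (mem_chart_source E p)]; exact hp⟩
  have hcp : coordChange E p c (chartAt E p p) = chartAt E c p := by
    rw [coordChange_apply, (chartAt E p).left_inv (mem_chart_source E p)]
  have h3 := fderiv_coordChange_comp hps v
  have h4 := fderiv_coordChange_comp hps (Complex.I • v)
  rw [fderiv_coordChange_smul hps] at h4
  rw [hcp] at h3 h4
  rw [κ.inChart_apply ((chartAt E c).map_source hp), (chartAt E c).left_inv hp, h3, h4]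
  exact formBilin_apply _ _ _

theorem inChart_eq_metricSq [IsManifold 𝓘(ℂ, E) ω M] {c : M} {x : E}
    (hx : x ∈ (chartAt E c).target) (v : E) : κ.inChart c x v (Complex.I • v) =
      κ.metricSq ((chartAt E c).symm x) (mfderiv 𝓘(ℝ, E) 𝓘(ℝ, E) (chartAt E c).symm x v) := by
  have := isManifold_real (E := E) (M := M)
  rw [κ.inChart_apply hx, fderiv_coordChange_smul (mem_coordChange_self hx),
    mfderiv_chart_symm c hx]
  exact (formBilin_apply (show E [⋀^Fin 2]→L[ℝ] ℝ from κ.form ((chartAt E c).symm x)) _ _).symm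

theorem enormSMulClass (x : M) :
    letI := κ.tangentENorm x
    ENormSMulClass ℝ (TangentSpace 𝓘(ℝ, E) x) := by
  let := κ.tangentENorm x
  refine ⟨fun t v => ?_⟩
  change ENNReal.ofReal (Real.sqrt (κ.form x ![t • v, tangentJ x (t • v)])) =
    ‖t‖ₑ * ENNReal.ofReal (Real.sqrt (κ.form x ![v, tangentJ x v]))
  have h : κ.form x ![t • v, tangentJ x (t • v)] = t ^ 2 * κ.metricSq x v :=
    (κ.form_tangentJ x (t • v)).trans (κ.metricSq_smul x t v)
  rw [congrArg Real.sqrt h, congrArg Real.sqrt (κ.form_tangentJ x v), Real.sqrt_mul (sq_nonneg t), Real.sqrt_sq_eq_abs,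
    ENNReal.ofReal_mul (abs_nonneg t), ← Real.norm_eq_abs, ofReal_norm]

/-- Integrate the derivative of `f` along a path from `p` to `q` of length less than `r`. -/
theorem ofReal_abs_sub_le_edist [IsManifold 𝓘(ℝ, E) 1 M] {f : M → ℝ}
    (hf : ContMDiff 𝓘(ℝ, E) 𝓘(ℝ, ℝ) 1 f)
    {L : ℝ} (hL0 : 0 ≤ L) (hL : ∀ (p : M) (v : E),
      |(show ℝ from mfderiv 𝓘(ℝ, E) 𝓘(ℝ, ℝ) f p v)| ≤ L * Real.sqrt (κ.metricSq p v))
    {p q : M} {r : ℝ≥0∞}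
    (hr : κ.edist p q < r) : ENNReal.ofReal |f q - f p| ≤ ENNReal.ofReal L * r := by
  let : ∀ x : M, ENorm (TangentSpace 𝓘(ℝ, E) x) := κ.tangentENorm
  obtain ⟨γ, h0, h1, hγ, hlen⟩ := Manifold.exists_lt_of_riemannianEDist_lt hr
  have hfγ : ContMDiffOn 𝓘(ℝ, ℝ) 𝓘(ℝ, ℝ) 1 (f ∘ γ) (Set.Icc 0 1) := hf.comp_contMDiffOn hγ
  have key := enorm_sub_le_lintegral_derivWithin_Icc_of_contDiffOn_Icc
    (contMDiffOn_iff_contDiffOn.1 hfγ) zero_le_one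
  rw [Function.comp_apply, Function.comp_apply, h0, h1, Real.enorm_eq_ofReal_abs] at key
  refine key.trans ?_
  refine le_trans ?_ (mul_le_mul_right hlen.le (ENNReal.ofReal L))
  rw [Manifold.pathELength_eq_lintegral_mfderivWithin_Icc,
    ← lintegral_const_mul' _ _ ENNReal.ofReal_ne_top]
  refine setLIntegral_mono' measurableSet_Icc fun t ht => ?_
  have hd : derivWithin (f ∘ γ) (Set.Icc 0 1) t = (show ℝ from
      mfderiv 𝓘(ℝ, E) 𝓘(ℝ, ℝ) f (γ t) (mfderivWithin 𝓘(ℝ, ℝ) 𝓘(ℝ, E) γ (Set.Icc 0 1) t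
        (1 : ℝ))) := by
    rw [← fderivWithin_derivWithin, ← mfderivWithin_eq_fderivWithin,
      mfderiv_comp_mfderivWithin (I' := 𝓘(ℝ, E)) t
      (hf.mdifferentiableAt (by simp)) (hγ.mdifferentiableOn (by simp) t ht)
      (uniqueMDiffWithinAt_iff_uniqueDiffWithinAt.2 (uniqueDiffOn_Icc zero_lt_one t ht))]
    rfl
  rw [hd, Real.enorm_eq_ofReal_abs]
  refine (ENNReal.ofReal_le_ofReal (hL (γ t) _)).trans ?_
  rw [ENNReal.ofReal_mul hL0]
  exact mul_le_mul_right (ENNReal.ofReal_le_ofReal (Real.sqrt_le_sqrt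
    (κ.form_tangentJ (γ t) _).ge)) _

/-- Locally the Kähler metric is comparable with the norm of a chart. -/
theorem exists_inChart_bounds [FiniteDimensional ℂ E] [IsManifold 𝓘(ℂ, E) ω M] {c : M} {x : E}
    (hx : x ∈ (chartAt E c).target) : ∃ m K : ℝ, 0 < m ∧ 0 < K ∧ ∀ᶠ y in 𝓝 x, ∀ v,
      m * ‖v‖ ^ 2 ≤ κ.inChart c y v (Complex.I • v) ∧
      κ.inChart c y v (Complex.I • v) ≤ K * ‖v‖ ^ 2 := by
  have : FiniteDimensional ℝ E := FiniteDimensional.complexToReal E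
  have hcont : ContinuousAt (κ.inChart c) x := (κ.analyticOnNhd_inChart c x hx).continuousAt
  obtain ⟨b, hb, hbv⟩ := exists_le_of_homogeneous (Q := fun v => κ.inChart c x v (Complex.I • v))
    (by fun_prop) (fun t v => by
      rw [smul_comm Complex.I t v]; simp only [map_smul, smul_apply, smul_eq_mul]; ring)
    (fun v hv => κ.inChart_pos hx hv)
  have hev : ∀ᶠ y in 𝓝 x, ‖κ.inChart c y - κ.inChart c x‖ < b / 2 :=
    (tendsto_iff_norm_sub_tendsto_zero.1 hcont).eventually_lt_const (by positivity)
  refine ⟨b / 2, ‖κ.inChart c x‖ + b / 2, by positivity, by positivity, ?_⟩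
  filter_upwards [hev] with y hy v
  have hI : ‖Complex.I • v‖ = ‖v‖ := by rw [norm_smul, Complex.norm_I, one_mul]
  have h1 := (κ.inChart c y - κ.inChart c x).le_opNorm₂ v (Complex.I • v)
  have h2 := (κ.inChart c x).le_opNorm₂ v (Complex.I • v)
  have h3 := hbv v
  rw [hI, Real.norm_eq_abs] at h1 h2
  rw [sub_apply, sub_apply] at h1
  have h4 : ‖κ.inChart c y - κ.inChart c x‖ * ‖v‖ * ‖v‖ ≤ b / 2 * ‖v‖ * ‖v‖ := by gcongr
  have h5 := abs_le.1 (h1.trans h4)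
  have h6 := (abs_le.1 h2).2
  constructor <;> nlinarith

/-- Near the centre of a chart the metric is bounded below by a multiple of the chart norm and the
differential of `f` is bounded by continuity; compactness makes the constant uniform. -/
theorem exists_mfderiv_le [FiniteDimensional ℂ E] [IsManifold 𝓘(ℂ, E) ω M] [CompactSpace M]
    {f : M → ℝ} (hf : ContMDiff 𝓘(ℝ, E) 𝓘(ℝ, ℝ) 1 f) : ∃ L : ℝ, 0 < L ∧ ∀ (p : M) (v : E),
      |(show ℝ from mfderiv 𝓘(ℝ, E) 𝓘(ℝ, ℝ) f p v)| ≤ L * Real.sqrt (κ.metricSq p v) := by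
  have hR := isManifold_real (E := E) (M := M)
  have hR1 : IsManifold 𝓘(ℝ, E) 1 M := IsManifold.of_le (n := ω) (by simp)
  have hloc : ∀ c : M, ∃ L : ℝ, 0 < L ∧ ∀ᶠ p in 𝓝 c, ∀ v : E,
      |(show ℝ from mfderiv 𝓘(ℝ, E) 𝓘(ℝ, ℝ) f p v)| ≤ L * Real.sqrt (κ.metricSq p v) := by
    intro c
    obtain ⟨m, K, hm, -, hev⟩ := κ.exists_inChart_bounds (mem_chart_target E c)
    have hfc : ContDiffOn ℝ 1 (f ∘ (chartAt E c).symm) (chartAt E c).target :=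
      contMDiffOn_iff_contDiffOn.1 (hf.comp_contMDiffOn contMDiffOn_chart_symm)
    have hcont : ContinuousAt (fderiv ℝ (f ∘ (chartAt E c).symm)) (chartAt E c c) :=
      (hfc.continuousOn_fderiv_of_isOpen (chartAt E c).open_target (by simp)).continuousAt
        ((chartAt E c).open_target.mem_nhds (mem_chart_target E c))
    set N := ‖fderiv ℝ (f ∘ (chartAt E c).symm) (chartAt E c c)‖ + 1 with hN
    have hev2 : ∀ᶠ y in 𝓝 (chartAt E c c), ‖fderiv ℝ (f ∘ (chartAt E c).symm) y‖ < N :=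
      hcont.norm.eventually_lt_const (by linarith)
    have hN0 : 0 < N := by positivity
    refine ⟨N / Real.sqrt m, by positivity, ?_⟩
    filter_upwards [((chartAt E c).continuousAt (mem_chart_source E c)).eventually
      (hev.and hev2), (chartAt E c).open_source.mem_nhds (mem_chart_source E c)] with p hp hps v
    set A := fderiv ℝ (coordChange E p c) (chartAt E p p) with hA
    have h1 : mfderiv 𝓘(ℝ, E) 𝓘(ℝ, ℝ) f p v =
        fderiv ℝ (f ∘ (chartAt E c).symm) (chartAt E c p) (A v) := by
      have e1 : f =ᶠ[𝓝 p] (f ∘ (chartAt E c).symm) ∘ chartAt E c := by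
        filter_upwards [(chartAt E c).open_source.mem_nhds hps] with y hy
        simp only [Function.comp_apply, (chartAt E c).left_inv hy]
      have e2 : DifferentiableAt ℝ (f ∘ (chartAt E c).symm) (chartAt E c p) :=
        (hfc.contDiffAt ((chartAt E c).open_target.mem_nhds
          ((chartAt E c).map_source hps))).differentiableAt (by simp)
      rw [e1.mfderiv_eq, mfderiv_comp p e2.mdifferentiableAt
        (mdifferentiableAt_atlas (I := 𝓘(ℝ, E)) (chart_mem_atlas E c) hps), mfderiv_eq_fderiv,
        mfderiv_chart hps]
      rfl
    have h2 : m * ‖A v‖ ^ 2 ≤ κ.metricSq p v := by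
      rw [κ.metricSq_inChart hps]
      exact (hp.1 (A v)).1
    have h3 : Real.sqrt m * ‖A v‖ ≤ Real.sqrt (κ.metricSq p v) := by
      refine Real.le_sqrt_of_sq_le ?_
      rwa [mul_pow, Real.sq_sqrt hm.le]
    have h4 : |(show ℝ from mfderiv 𝓘(ℝ, E) 𝓘(ℝ, ℝ) f p v)| ≤ N * ‖A v‖ := by
      rw [h1, ← Real.norm_eq_abs]
      exact ((fderiv ℝ (f ∘ (chartAt E c).symm) (chartAt E c p)).le_opNorm (A v)).trans
        (mul_le_mul_of_nonneg_right hp.2.le (norm_nonneg _))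
    have hsm : 0 < Real.sqrt m := Real.sqrt_pos.2 hm
    calc _ ≤ N * ‖A v‖ := h4
      _ = N / Real.sqrt m * (Real.sqrt m * ‖A v‖) := by field_simp
      _ ≤ _ := by gcongr
  choose L hL0 hL using hloc
  obtain ⟨t, ht⟩ := CompactSpace.elim_nhds_subcover (fun c => {p | ∀ v : E,
    |(show ℝ from mfderiv 𝓘(ℝ, E) 𝓘(ℝ, ℝ) f p v)| ≤ L c * Real.sqrt (κ.metricSq p v)})
    (fun c => hL c)
  -- The sum dominates each local constant; the extra `1` keeps it positive when the subcover is
  -- empty.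
  refine ⟨∑ c ∈ t, L c + 1, by have := Finset.sum_nonneg fun c (_ : c ∈ t) => (hL0 c).le; linarith,
    fun p v => ?_⟩
  have hp : p ∈ (⊤ : Set M) := trivial
  rw [← ht] at hp
  simp only [Set.mem_iUnion] at hp
  obtain ⟨c, hc, hpc⟩ := hp
  refine (hpc v).trans (mul_le_mul_of_nonneg_right ?_ (Real.sqrt_nonneg _))
  have := Finset.single_le_sum (f := L) (fun c (_ : c ∈ t) => (hL0 c).le) hc
  linarith

/-- Points that are close for the Kähler metric are close for the topology. -/
theorem exists_edist_lt_mem [FiniteDimensional ℂ E] [IsManifold 𝓘(ℂ, E) ω M] [CompactSpace M]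
    [T2Space M] {N : Set (M × M)} (hN : IsOpen N) (hdiag : ∀ p, (p, p) ∈ N) :
    ∃ δ : ℝ, 0 < δ ∧ ∀ p q, κ.edist p q < ENNReal.ofReal δ → (p, q) ∈ N := by
  have : FiniteDimensional ℝ E := FiniteDimensional.complexToReal E
  have hR := isManifold_real (E := E) (M := M)
  have hR1 : IsManifold 𝓘(ℝ, E) 1 M := IsManifold.of_le (n := ω) (by simp)
  have hRi : IsManifold 𝓘(ℝ, E) ∞ M := IsManifold.of_le (n := ω) (by simp)
  have hloc : ∀ c : M, ∃ δ : ℝ, 0 < δ ∧ ∀ᶠ p in 𝓝 c, ∀ q, κ.edist p q < ENNReal.ofReal δ →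
      (p, q) ∈ N := by
    intro c
    obtain ⟨S, hS, hSN⟩ : ∃ S ∈ 𝓝 c, S ×ˢ S ⊆ N := by
      obtain ⟨S, T, hS, hcS, hT, hcT, h⟩ := mem_nhds_prod_iff'.1 (hN.mem_nhds (hdiag c))
      exact ⟨S ∩ T, Filter.inter_mem (hS.mem_nhds hcS) (hT.mem_nhds hcT),
        (Set.prod_mono Set.inter_subset_left Set.inter_subset_right).trans h⟩
    -- A Lipschitz bump function separates: it is `1` near `c` and changes by at most `L · 1/(2L) =
    -- 1/2` over the allowed distance, so it is still nonzero at `q`, which forces `q ∈ S`.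
    obtain ⟨f, -, hf⟩ := (SmoothBumpFunction.nhds_basis_support (I := 𝓘(ℝ, E)) hS).mem_iff.1 hS
    have hfs : ContMDiff 𝓘(ℝ, E) 𝓘(ℝ, ℝ) 1 f := f.contMDiff.of_le (by simp)
    obtain ⟨L, hL0, hL⟩ := κ.exists_mfderiv_le hfs
    refine ⟨1 / (2 * L), by positivity, ?_⟩
    filter_upwards [f.eventuallyEq_one, hS] with p hp hpS q hq
    refine hSN ⟨hpS, hf ?_⟩
    have h1 := κ.ofReal_abs_sub_le_edist hfs hL0.le hL hq
    rw [← ENNReal.ofReal_mul hL0.le, ENNReal.ofReal_le_ofReal_iff (by positivity)] at h1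
    have h2 : L * (1 / (2 * L)) = 1 / 2 := by field_simp
    rw [h2, hp] at h1
    have h3 := (abs_le.1 h1).1
    simp only [Pi.one_apply] at h3
    exact Function.mem_support.2 (by linarith)
  choose δ hδ0 hδ using hloc
  obtain ⟨t, ht⟩ := CompactSpace.elim_nhds_subcover (fun c => {p | ∀ q,
    κ.edist p q < ENNReal.ofReal (δ c) → (p, q) ∈ N}) (fun c => hδ c)
  obtain ⟨ε, hε, hεt⟩ : ∃ ε : ℝ, 0 < ε ∧ ∀ c ∈ t, ε ≤ δ c := by
    rcases t.eq_empty_or_nonempty with rfl | hne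
    · exact ⟨1, one_pos, by simp⟩
    · obtain ⟨c, hc, hmin⟩ := t.exists_min_image δ hne
      exact ⟨δ c, hδ0 c, hmin⟩
  refine ⟨ε, hε, fun p q hpq => ?_⟩
  have hp : p ∈ (⊤ : Set M) := trivial
  rw [← ht] at hp
  simp only [Set.mem_iUnion] at hp
  obtain ⟨c, hc, hpc⟩ := hp
  exact hpc q (hpq.trans_le (ENNReal.ofReal_le_ofReal (hεt c hc)))

/-- Inside a convex subset of a chart the distance is bounded by the distance in the chart. -/
theorem edist_le_of_inChart_le [IsManifold 𝓘(ℂ, E) ω M] {c : M} {B : Set E} (hB : Convex ℝ B)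
    (hBt : B ⊆ (chartAt E c).target) {K : ℝ}
    (hK : ∀ y ∈ B, ∀ v, κ.inChart c y v (Complex.I • v) ≤ K ^ 2 * ‖v‖ ^ 2) (hK0 : 0 ≤ K) {x y : E}
    (hx : x ∈ B) (hy : y ∈ B) :
    κ.edist ((chartAt E c).symm x) ((chartAt E c).symm y) ≤ ENNReal.ofReal (K * ‖x - y‖) := by
  have hR := isManifold_real (E := E) (M := M)
  have hR1 : IsManifold 𝓘(ℝ, E) 1 M := IsManifold.of_le (n := ω) (by simp)
  let : ∀ x : M, ENorm (TangentSpace 𝓘(ℝ, E) x) := κ.tangentENorm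
  have : ∀ x : M, ENormSMulClass ℝ (TangentSpace 𝓘(ℝ, E) x) := κ.enormSMulClass
  let l : ℝ → E := fun t => x + t • (y - x)
  have hl : ∀ t ∈ Set.Icc (0 : ℝ) 1, l t ∈ B := fun t ht => hB.add_smul_sub_mem hx hy ht
  have hld : ∀ t, HasDerivAt l (y - x) t := fun t => by
    have := ((hasDerivAt_id t).smul_const (y - x)).const_add x
    rwa [one_smul] at this
  have hls : ContDiff ℝ 1 l := by fun_prop
  have hγ : ContMDiffOn 𝓘(ℝ, ℝ) 𝓘(ℝ, E) 1 ((chartAt E c).symm ∘ l) (Set.Icc 0 1) :=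
    contMDiffOn_chart_symm.comp hls.contMDiff.contMDiffOn fun t ht => hBt (hl t ht)
  have h1 : κ.edist ((chartAt E c).symm x) ((chartAt E c).symm y) ≤
      Manifold.pathELength 𝓘(ℝ, E) ((chartAt E c).symm ∘ l) 0 1 :=
    Manifold.riemannianEDist_le_pathELength hγ (by simp [l]) (by simp [l]) zero_le_one
  refine h1.trans ?_
  rw [Manifold.pathELength_eq_lintegral_mfderivWithin_Icc]
  have h2 : ∀ t ∈ Set.Icc (0 : ℝ) 1, ‖mfderivWithin 𝓘(ℝ, ℝ) 𝓘(ℝ, E) ((chartAt E c).symm ∘ l)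
      (Set.Icc 0 1) t (1 : ℝ)‖ₑ ≤ ENNReal.ofReal (K * ‖x - y‖) := by
    intro t ht
    have e1 : mfderivWithin 𝓘(ℝ, ℝ) 𝓘(ℝ, E) ((chartAt E c).symm ∘ l) (Set.Icc 0 1) t (1 : ℝ) =
        mfderiv 𝓘(ℝ, E) 𝓘(ℝ, E) (chartAt E c).symm (l t) (y - x) := by
      rw [mfderiv_comp_mfderivWithin (I' := 𝓘(ℝ, E)) t
        ((contMDiffOn_chart_symm (I := 𝓘(ℝ, E)) (n := 1) (x := c)).mdifferentiableOn (by simp)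
          |>.mdifferentiableAt ((chartAt E c).open_target.mem_nhds (hBt (hl t ht))))
        (hls.contMDiff.mdifferentiableAt (by simp)).mdifferentiableWithinAt
        (uniqueMDiffWithinAt_iff_uniqueDiffWithinAt.2 (uniqueDiffOn_Icc zero_lt_one t ht)),
        mfderivWithin_eq_fderivWithin]
      have e2 : fderivWithin ℝ l (Set.Icc 0 1) t 1 = y - x := by
        rw [(hld t).hasFDerivAt.hasFDerivWithinAt.fderivWithin (uniqueDiffOn_Icc zero_lt_one t ht)]
        simp
      exact congrArg (mfderiv 𝓘(ℝ, E) 𝓘(ℝ, E) (chartAt E c).symm (l t)) e2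
    rw [e1]
    change ENNReal.ofReal (Real.sqrt (κ.form _ ![_, tangentJ _ _])) ≤ _
    rw [congrArg Real.sqrt (κ.form_tangentJ _ _)]
    refine ENNReal.ofReal_le_ofReal (Real.sqrt_le_iff.2 ⟨by positivity, ?_⟩)
    have e3 := hK (l t) (hl t ht) (y - x)
    rw [κ.inChart_eq_metricSq (hBt (hl t ht))] at e3
    rw [mul_pow, norm_sub_rev x y]
    exact e3
  refine (setLIntegral_mono' measurableSet_Icc h2).trans ?_
  simp

end KahlerForm

end CalabiLegendre

end

/-! ### Existence of a diastasis neighbourhood -/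

noncomputable section

set_option maxSynthPendingDepth 3

namespace CalabiLegendre

theorem exists_pos_le_of_finset {ι : Type*} (t : Finset ι) {δ : ι → ℝ} (h : ∀ i, 0 < δ i) :
    ∃ ε : ℝ, 0 < ε ∧ ∀ i ∈ t, ε ≤ δ i := by
  rcases t.eq_empty_or_nonempty with rfl | hne
  · exact ⟨1, one_pos, by simp⟩
  · obtain ⟨c, hc, hmin⟩ := t.exists_min_image δ hne
    exact ⟨δ c, h c, hmin⟩

/-- The partial derivative of a convex cell. -/
theorem IsConvexCell.hasFDerivAt_left {E : Type*} [NormedAddCommGroup E] [NormedSpace ℝ E]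
    {d : E × E → ℝ} {x₀ : E} {R a : ℝ} (h : IsConvexCell d x₀ R a) {x y : E}
    (hx : x ∈ Metric.ball x₀ R) (hy : y ∈ Metric.ball x₀ R) :
    HasFDerivAt (fun z => d (z, y)) (dfst d (x, y)) x :=
  HasFDerivAt.comp (g := d) _ ((h.smooth.contDiffAt
    ((Metric.isOpen_ball.prod Metric.isOpen_ball).mem_nhds
      (⟨hx, hy⟩ : (x, y) ∈ Metric.ball x₀ R ×ˢ Metric.ball x₀ R))).differentiableAt
    (by simp)).hasFDerivAt (hasFDerivAt_prodMk_left _ y)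

/-- On the segment from `y` to `x` the derivative of `d(·, y)` starts at `0` and grows at least at
the rate `a ‖x - y‖²` by strong monotonicity. Integration gives the factor `1 / 2`. -/
theorem IsConvexCell.mul_sq_le {E : Type*} [NormedAddCommGroup E] [NormedSpace ℝ E]
    {d : E × E → ℝ} {x₀ : E} {R a : ℝ} (h : IsConvexCell d x₀ R a) {x y : E}
    (hx : x ∈ Metric.ball x₀ R) (hy : y ∈ Metric.ball x₀ R) (h0 : d (y, y) = 0) :
    a / 2 * ‖x - y‖ ^ 2 ≤ d (x, y) := by
  have hseg : ∀ t ∈ Set.Icc (0 : ℝ) 1, y + t • (x - y) ∈ Metric.ball x₀ R := fun t ht =>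
    (convex_ball x₀ R).add_smul_sub_mem hy hx ht
  have hder : ∀ t ∈ Set.Icc (0 : ℝ) 1, HasDerivAt (fun t : ℝ => d (y + t • (x - y), y))
      (dfst d (y + t • (x - y), y) (x - y)) t := by
    intro t ht
    have h1 : HasDerivAt (fun t : ℝ => y + t • (x - y)) (x - y) t := by
      simpa using ((hasDerivAt_id t).smul_const (x - y)).const_add y
    have h2 := h.hasFDerivAt_left (hseg t ht) hy
    exact HasFDerivAt.comp_hasDerivAt (l := fun z => d (z, y)) t h2 h1
  have hpos : ∀ t ∈ Set.Ioo (0 : ℝ) 1, a * t * ‖x - y‖ ^ 2 ≤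
      dfst d (y + t • (x - y), y) (x - y) := by
    intro t ht
    have ht' := Set.Ioo_subset_Icc_self ht
    have := monotone_of_fderiv_pos (Φ := fun x => dfst d (x, y)) (convex_ball x₀ R) (c := a)
      (fun z hz => (h.hasFDerivAt_dfst_left hz hy).differentiableAt)
      (fun z hz v => by
        rw [(h.hasFDerivAt_dfst_left hz hy).fderiv]
        exact h.convex (z, y) ⟨hz, hy⟩ v) (hseg t ht') hy
    rw [add_sub_cancel_left, h.dfst_diag y hy, sub_zero, norm_smul, map_smul, mul_pow,
      Real.norm_of_nonneg ht.1.le, smul_eq_mul] at this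
    have h3 : t * (a * t * ‖x - y‖ ^ 2) ≤ t * dfst d (y + t • (x - y), y) (x - y) := by linarith
    exact le_of_mul_le_mul_left h3 ht.1
  have hmono : MonotoneOn (fun t : ℝ => d (y + t • (x - y), y) - a / 2 * t ^ 2 * ‖x - y‖ ^ 2)
      (Set.Icc 0 1) := by
    have hd : ∀ t ∈ Set.Icc (0 : ℝ) 1, HasDerivAt
        (fun t : ℝ => d (y + t • (x - y), y) - a / 2 * t ^ 2 * ‖x - y‖ ^ 2)
        (dfst d (y + t • (x - y), y) (x - y) - a * t * ‖x - y‖ ^ 2) t := by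
      intro t ht
      have h1 := (hder t ht).sub ((((hasDerivAt_id t).pow 2).const_mul (a / 2)).mul_const
        (‖x - y‖ ^ 2))
      refine h1.congr_deriv ?_
      simp only [id]
      ring
    refine monotoneOn_of_deriv_nonneg (convex_Icc 0 1)
      (fun t ht => (hd t ht).continuousAt.continuousWithinAt) (fun t ht => ?_) fun t ht => ?_
    · exact (hd t (interior_subset ht)).differentiableAt.differentiableWithinAt
    · rw [(hd t (interior_subset ht)).deriv]
      rw [interior_Icc] at ht
      linarith [hpos t ht]
  have := hmono (Set.left_mem_Icc.2 zero_le_one) (Set.right_mem_Icc.2 zero_le_one) zero_le_one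
  simp only [zero_smul, add_zero, h0, one_smul, add_sub_cancel] at this
  linarith

section ChartSet

variable {H M : Type*} [TopologicalSpace H] [TopologicalSpace M] [ChartedSpace H M]

/-- A region of a chart. -/
def chartSet (c : M) (B : Set H) : Set M := (chartAt H c).source ∩ chartAt H c ⁻¹' B

theorem isOpen_chartSet (c : M) {B : Set H} (hB : IsOpen B) : IsOpen (chartSet c B) :=
  (chartAt H c).isOpen_inter_preimage hB

theorem symm_mem_chartSet {c : M} {B : Set H} {x : H} (hx : x ∈ (chartAt H c).target) :
    (chartAt H c).symm x ∈ chartSet c B ↔ x ∈ B := by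
  rw [chartSet, Set.mem_inter_iff, Set.mem_preimage, (chartAt H c).right_inv hx]
  exact and_iff_right ((chartAt H c).map_target hx)

end ChartSet

variable {E : Type*} [NormedAddCommGroup E] [NormedSpace ℂ E]
  {M : Type*} [TopologicalSpace M] [ChartedSpace E M]

/-- The potential defined by a kernel in a chart. -/
def kernelPotential (c : M) (k : E × Conj E → ℂ) (p : M) : ℝ :=
  (k (chartAt E c p, toConj (chartAt E c p))).re

/-- The polarization defined by a kernel in a chart. -/
def kernelPolarization (c : M) (k : E × Conj E → ℂ) (z : M × M) : ℂ :=
  k (chartAt E c z.1, toConj (chartAt E c z.2))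

variable {κ : KahlerForm E M}

/-- The diastases of two kernels agree. -/
theorem kernelDiastasis_eq [IsManifold 𝓘(ℂ, E) ω M] {c c' : M} {B B' : Set E}
    {k k' : E × Conj E → ℂ} (h : IsKernel (fun x v w => κ.inChart c x v w) B k)
    (h' : IsKernel (fun x v w => κ.inChart c' x v w) B' k')
    (hB : IsOpen B) (hBc : Convex ℝ B) (hBt : B ⊆ (chartAt E c).target)
    (hB' : IsOpen B') (hBc' : Convex ℝ B') (hBt' : B' ⊆ (chartAt E c').target)
    (hsub : chartSet c B ⊆ chartSet c' B') {p q : M} (hp : p ∈ chartSet c B)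
    (hq : q ∈ chartSet c B) :
    kernelDiastasis k (chartAt E c p, chartAt E c q) =
      kernelDiastasis k' (chartAt E c' p, chartAt E c' q) := by
  have hmem : ∀ x ∈ B, (chartAt E c).symm x ∈ chartSet c' B' := fun x hx =>
    hsub ((symm_mem_chartSet (hBt hx)).2 hx)
  -- Read in the chart at `c`, the second kernel is another kernel of the same form on the same
  -- convex set, so uniqueness of the diastasis applies.
  have h1 := (h'.isPolarizedPotential κ hB' hBc' hBt').isKernel hB hBc hBt
    (fun x hx y hy => ⟨hmem x hx, hmem y hy⟩)
  rw [h.diastasis_unique h1 hB hBc hp.2 hq.2]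
  simp only [kernelDiastasis, fromConj_toConj, (chartAt E c).left_inv hp.1,
    (chartAt E c).left_inv hq.1]

variable (κ)

/-- A kernel in a chart whose diastasis is uniformly convex. -/
theorem exists_convex_kernel [FiniteDimensional ℂ E] [IsManifold 𝓘(ℂ, E) ω M] (c : M) :
    ∃ (R C : ℝ) (k : E × Conj E → ℂ), 0 < R ∧ 0 < C ∧
      Metric.ball (chartAt E c c) R ⊆ (chartAt E c).target ∧
      IsKernel (fun x v w => κ.inChart c x v w) (Metric.ball (chartAt E c c) R) k ∧
      ∀ x ∈ Metric.ball (chartAt E c c) R, ∀ y ∈ Metric.ball (chartAt E c c) R,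
        ENNReal.ofReal C * κ.edist ((chartAt E c).symm x) ((chartAt E c).symm y) ^ 2 ≤
          ENNReal.ofReal (kernelDiastasis k (x, y)) := by
  have : FiniteDimensional ℝ E := FiniteDimensional.complexToReal E
  obtain ⟨r, k, hr, hrt, hk⟩ := κ.exists_isKernel_inChart (mem_chart_target E c)
  obtain ⟨m, K, -, hK, hev⟩ := κ.exists_inChart_bounds (mem_chart_target E c)
  obtain ⟨s, hs, hsK⟩ := Metric.eventually_nhds_iff_ball.1 hev
  set ρ := min r s with hρ
  have hρ0 : 0 < ρ := lt_min hr hs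
  have hkρ := hk.mono (Metric.ball_subset_ball (min_le_left r s))
  obtain ⟨R, a, hRρ, hcell⟩ := exists_isConvexCell hρ0
    (hkρ.contDiffOn_diastasis.of_le (by simp))
    (fun x hx => hkρ.dfst_diastasis_diag Metric.isOpen_ball (convex_ball _ _) hx)
    (fun v hv => by
      rw [hkρ.fderiv_dfst_diastasis Metric.isOpen_ball (convex_ball _ _)
        (Metric.mem_ball_self hρ0)]
      exact κ.inChart_pos (mem_chart_target E c) hv)
  have hsub := Metric.ball_subset_ball (x := chartAt E c c) hRρ
  have hRt : Metric.ball (chartAt E c c) R ⊆ (chartAt E c).target :=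
    (hsub.trans (Metric.ball_subset_ball (min_le_left r s))).trans hrt
  have ha := hcell.a_pos
  -- The diastasis is at least `(a / 2) ‖x - y‖²`, and the distance is at most `√K ‖x - y‖`.
  refine ⟨R, a / 2 / K, k, hcell.R_pos, by positivity, hRt, hkρ.mono hsub, fun x hx y hy => ?_⟩
  have h1 := hcell.mul_sq_le hx hy (kernelDiastasis_self k y)
  have h2 := κ.edist_le_of_inChart_le (convex_ball _ _) hRt (K := Real.sqrt K)
    (fun y hy v => by
      rw [Real.sq_sqrt hK.le]
      exact (hsK y (Metric.ball_subset_ball (min_le_right r s) (hsub hy)) v).2)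
    (Real.sqrt_nonneg K) hx hy
  calc _ ≤ ENNReal.ofReal (a / 2 / K) * ENNReal.ofReal (Real.sqrt K * ‖x - y‖) ^ 2 := by gcongr
    _ = ENNReal.ofReal (a / 2 * ‖x - y‖ ^ 2) := by
      rw [← ENNReal.ofReal_pow (by positivity), ← ENNReal.ofReal_mul (by positivity), mul_pow,
        Real.sq_sqrt hK.le]
      congr 1
      field_simp
    _ ≤ _ := ENNReal.ofReal_le_ofReal h1

/-- Every compact Kähler manifold with real-analytic Kähler form has a diastasis neighbourhood. -/
theorem exists_isDiastasisNhd [FiniteDimensional ℂ E] [IsManifold 𝓘(ℂ, E) ω M] [CompactSpace M]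
    [T2Space M] : ∃ (V : Set (M × M)) (D : M × M → ℝ), κ.IsDiastasisNhd V D := by
  classical
  have : FiniteDimensional ℝ E := FiniteDimensional.complexToReal E
  have : ProperSpace E := FiniteDimensional.proper_real E
  choose R C k hR hC hRt hk hCk using exists_convex_kernel κ
  let Ω : M → Set M := fun f => chartSet f (Metric.ball (chartAt E f f) (R f))
  let U : M → Set M := fun f => chartSet f (Metric.ball (chartAt E f f) (R f / 2))
  have hΩ : ∀ f, IsOpen (Ω f) := fun f => isOpen_chartSet f Metric.isOpen_ball
  have hU : ∀ f, IsOpen (U f) := fun f => isOpen_chartSet f Metric.isOpen_ball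
  have hUΩ : ∀ f, closure (U f) ⊆ Ω f := by
    intro f
    have hsub : Metric.closedBall (chartAt E f f) (R f / 2) ⊆ Metric.ball (chartAt E f f) (R f) :=
      Metric.closedBall_subset_ball (by linarith [hR f])
    have hcomp : IsCompact ((chartAt E f).symm '' Metric.closedBall (chartAt E f f) (R f / 2)) :=
      (isCompact_closedBall _ _).image_of_continuousOn
        ((chartAt E f).continuousOn_symm.mono (hsub.trans (hRt f)))
    refine (closure_minimal ?_ hcomp.isClosed).trans ?_
    · intro p hp
      exact ⟨chartAt E f p, Metric.ball_subset_closedBall hp.2, (chartAt E f).left_inv hp.1⟩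
    · rintro _ ⟨x, hx, rfl⟩
      exact (symm_mem_chartSet (hRt f (hsub hx))).2 (hsub hx)
  obtain ⟨F, hF⟩ := CompactSpace.elim_nhds_subcover U fun f => (hU f).mem_nhds
    ⟨mem_chart_source E f, Metric.mem_ball_self (half_pos (hR f))⟩
  have hcov : ∀ z, ∃ f ∈ F, z ∈ U f := by
    intro z
    have hz : z ∈ (⊤ : Set M) := trivial
    rw [← hF] at hz
    simpa using hz
  choose f hfF hfU using hcov
  -- The property that makes gluing work: a small neighbourhood that meets `U g` lies entirely in
  -- the larger region `Ω g`. Two local diastases can then be compared on a whole convex ball, and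
  -- nothing is needed about the shape of the intersection of two neighbourhoods.
  have hball : ∀ z, ∃ s : ℝ, 0 < s ∧
      Metric.ball (chartAt E (f z) z) s ⊆ Metric.ball (chartAt E (f z) (f z)) (R (f z)) ∧
      chartSet (f z) (Metric.ball (chartAt E (f z) z) s) ⊆ U (f z) ∧
      ∀ g ∈ F, (chartSet (f z) (Metric.ball (chartAt E (f z) z) s) ∩ U g).Nonempty →
        chartSet (f z) (Metric.ball (chartAt E (f z) z) s) ⊆ Ω g := by
    intro z
    have hzs : z ∈ (chartAt E (f z)).source := (hfU z).1
    have hN : ∀ᶠ p in 𝓝 z, p ∈ U (f z) ∧ ∀ g ∈ F, (z ∈ Ω g → p ∈ Ω g) ∧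
        (z ∉ Ω g → p ∉ U g) := by
      refine ((hU _).eventually_mem (hfU z)).and
        ((Filter.eventually_all_finset F).2 fun g _ => ?_)
      by_cases hz : z ∈ Ω g
      · filter_upwards [(hΩ g).mem_nhds hz] with p hp using ⟨fun _ => hp, fun h => absurd hz h⟩
      · have hz' : z ∈ (closure (U g))ᶜ := fun h => hz (hUΩ g h)
        filter_upwards [isClosed_closure.isOpen_compl.mem_nhds hz'] with p hp
        exact ⟨fun h => absurd h hz, fun _ h => hp (subset_closure h)⟩
    have h1 : ∀ᶠ x in 𝓝 (chartAt E (f z) z), (chartAt E (f z)).symm x ∈ U (f z) ∧ ∀ g ∈ F,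
        (z ∈ Ω g → (chartAt E (f z)).symm x ∈ Ω g) ∧
        (z ∉ Ω g → (chartAt E (f z)).symm x ∉ U g) := by
      have hc := (chartAt E (f z)).continuousAt_symm ((chartAt E (f z)).map_source hzs)
      rw [ContinuousAt, (chartAt E (f z)).left_inv hzs] at hc
      exact hc.eventually hN
    obtain ⟨s, hs, hsb⟩ := Metric.eventually_nhds_iff_ball.1 (h1.and
      (Metric.isOpen_ball.eventually_mem (Metric.ball_subset_ball (by linarith [hR (f z)])
        (hfU z).2 : chartAt E (f z) z ∈ Metric.ball (chartAt E (f z) (f z)) (R (f z)))))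
    have hmem : ∀ p ∈ chartSet (f z) (Metric.ball (chartAt E (f z) z) s), p ∈ U (f z) ∧
        ∀ g ∈ F, (z ∈ Ω g → p ∈ Ω g) ∧ (z ∉ Ω g → p ∉ U g) := by
      intro p hp
      have := (hsb _ hp.2).1
      rwa [(chartAt E (f z)).left_inv hp.1] at this
    refine ⟨s, hs, fun x hx => (hsb x hx).2, fun p hp => (hmem p hp).1, fun g hg => ?_⟩
    rintro ⟨p, hp, hpU⟩ p' hp'
    by_cases hz : z ∈ Ω g
    · exact ((hmem p' hp').2 g hg).1 hz
    · exact absurd hpU (((hmem p hp).2 g hg).2 hz)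
  choose s hs hsR hsU hsΩ using hball
  let B : M → Set E := fun z => Metric.ball (chartAt E (f z) z) (s z)
  let N : M → Set M := fun z => chartSet (f z) (B z)
  have hBt : ∀ z, B z ⊆ (chartAt E (f z)).target := fun z => (hsR z).trans (hRt (f z))
  have hkB : ∀ z, IsKernel (fun x v w => κ.inChart (f z) x v w) (B z) (k (f z)) := fun z =>
    (hk (f z)).mono (hsR z)
  have hcons : ∀ z w p q, p ∈ N z → q ∈ N z → p ∈ N w → q ∈ N w →
      kernelDiastasis (k (f z)) (chartAt E (f z) p, chartAt E (f z) q) =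
      kernelDiastasis (k (f w)) (chartAt E (f w) p, chartAt E (f w) q) := by
    intro z w p q hp hq hp' hq'
    -- The common point `p` lies in `U (f w)`, so the whole neighbourhood of `z` lies in the domain
    -- of the kernel attached to `w`.
    exact kernelDiastasis_eq (hkB z) (hk (f w)) Metric.isOpen_ball (convex_ball _ _) (hBt z)
      Metric.isOpen_ball (convex_ball _ _) (hRt (f w))
      (hsΩ z (f w) (hfF w) ⟨p, hp, hsU w hp'⟩) hp hq
  let D : M × M → ℝ := fun x => if h : ∃ z, x ∈ N z ×ˢ N z then
    kernelDiastasis (k (f h.choose)) (chartAt E (f h.choose) x.1, chartAt E (f h.choose) x.2) else 0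
  have hD : ∀ z, ∀ x ∈ N z ×ˢ N z, D x =
      kernelDiastasis (k (f z)) (chartAt E (f z) x.1, chartAt E (f z) x.2) := by
    intro z x hx
    have h : ∃ z, x ∈ N z ×ˢ N z := ⟨z, hx⟩
    simp only [D, dif_pos h]
    exact hcons _ _ _ _ h.choose_spec.1 h.choose_spec.2 hx.1 hx.2
  obtain ⟨C₀, hC₀, hCF⟩ := exists_pos_le_of_finset F hC
  refine ⟨⋃ z, N z ×ˢ N z, D, ⟨?_, fun p => ?_, fun x hx => ?_, C₀, hC₀, fun x hx => ?_⟩⟩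
  · exact isOpen_iUnion fun z => (isOpen_chartSet _ Metric.isOpen_ball).prod
      (isOpen_chartSet _ Metric.isOpen_ball)
  · refine Set.mem_iUnion.2 ⟨p, ?_⟩
    have : p ∈ N p := ⟨(hfU p).1, Metric.mem_ball_self (hs p)⟩
    exact ⟨this, this⟩
  · obtain ⟨z, hz⟩ := Set.mem_iUnion.1 hx
    exact ⟨N z, N z ×ˢ N z, kernelPotential (f z) (k (f z)), kernelPolarization (f z) (k (f z)),
      (hkB z).isPolarizedPotential κ Metric.isOpen_ball (convex_ball _ _) (hBt z), hz,
      fun y hy => hD z y hy.2⟩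
  · obtain ⟨z, hz⟩ := Set.mem_iUnion.1 hx
    rw [hD z x hz]
    have h1 := hCk (f z) _ (hsR z hz.1.2) _ (hsR z hz.2.2)
    rw [(chartAt E (f z)).left_inv hz.1.1, (chartAt E (f z)).left_inv hz.2.1] at h1
    refine le_trans ?_ h1
    gcongr
    exact hCF (f z) (hfF z)

end CalabiLegendre

end

/-! ### `C^k` norms and changes of charts -/

noncomputable section

set_option maxSynthPendingDepth 3

namespace CalabiLegendre

variable {E : Type*} [NormedAddCommGroup E] [NormedSpace ℂ E]
  {M : Type*} [TopologicalSpace M] [ChartedSpace E M]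

theorem contDiffOn_comp_chart_symm [IsManifold 𝓘(ℝ, E) ω M] {n : WithTop ℕ∞} {η : M → ℝ}
    (hη : ContMDiff 𝓘(ℝ, E) 𝓘(ℝ, ℝ) n η) (c : M) :
    ContDiffOn ℝ n (η ∘ (chartAt E c).symm) (chartAt E c).target := by
  have : IsManifold 𝓘(ℝ, E) n M := IsManifold.of_le (n := ω) le_top
  exact contMDiffOn_iff_contDiffOn.1 (hη.comp_contMDiffOn
    (contMDiffOn_chart_symm (I := 𝓘(ℝ, E)) (n := n) (x := c)))

theorem contDiffAt_comp_chart_symm [IsManifold 𝓘(ℝ, E) ω M] {n : WithTop ℕ∞} {η : M → ℝ}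
    (hη : ContMDiff 𝓘(ℝ, E) 𝓘(ℝ, ℝ) n η) {c : M} {x : E} (hx : x ∈ (chartAt E c).target) :
    ContDiffAt ℝ n (η ∘ (chartAt E c).symm) x :=
  (contDiffOn_comp_chart_symm hη c).contDiffAt ((chartAt E c).open_target.mem_nhds hx)

/-- Derivatives in one chart are controlled by derivatives in another one. -/
theorem exists_iteratedFDeriv_le [IsManifold 𝓘(ℝ, E) ω M]
    [IsManifold 𝓘(ℂ, E) ω M] (k : ℕ) {c c' p₀ : M}
    (hc : p₀ ∈ (chartAt E c).source) (hc' : p₀ ∈ (chartAt E c').source) :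
    ∃ A : ℝ, 0 < A ∧ ∀ᶠ p in 𝓝 p₀, ∀ η : M → ℝ, ContMDiff 𝓘(ℝ, E) 𝓘(ℝ, ℝ) k η → ∀ b : ℝ,
      (∀ j ≤ k, ‖iteratedFDeriv ℝ j (η ∘ (chartAt E c').symm) (chartAt E c' p)‖ ≤ b) →
      ∀ j ≤ k, ‖iteratedFDeriv ℝ j (η ∘ (chartAt E c).symm) (chartAt E c p)‖ ≤ A * b := by
  let τ := coordChange E c c'
  have hO : IsOpen τ.source := τ.open_source
  have hτ : ContDiffOn ℝ ω τ τ.source := (holOn_coordChange c c').1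
  have hmem : ∀ p ∈ (chartAt E c).source, p ∈ (chartAt E c').source → chartAt E c p ∈ τ.source :=
    fun p hp hp' => mem_coordChange_source.2 ⟨(chartAt E c).map_source hp, by
      rwa [(chartAt E c).left_inv hp]⟩
  have hcont : ∀ i : ℕ, ContinuousAt (fun x => iteratedFDeriv ℝ i τ x) (chartAt E c p₀) := by
    intro i
    refine ContinuousOn.continuousAt (s := τ.source) ?_ (hO.mem_nhds (hmem p₀ hc hc'))
    exact (hτ.continuousOn_iteratedFDerivWithin le_top hO.uniqueDiffOn).congr fun x hx =>
      (iteratedFDerivWithin_of_isOpen i hO hx).symm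
  -- A strict bound at `p₀` for the derivatives of the coordinate change persists nearby. The
  -- estimate for compositions wants the bound `S ^ i` on the `i`-th derivative, and `S ≤ S ^ i`
  -- because `S ≥ 1`.
  let S := 1 + ∑ i ∈ Finset.range (k + 1), (‖iteratedFDeriv ℝ i τ (chartAt E c p₀)‖ + 1)
  have hS1 : 1 ≤ S := le_add_of_nonneg_right (Finset.sum_nonneg fun i _ => by positivity)
  have hSi : ∀ i ≤ k, ‖iteratedFDeriv ℝ i τ (chartAt E c p₀)‖ < S := by
    intro i hi
    have := Finset.single_le_sum (f := fun i => ‖iteratedFDeriv ℝ i τ (chartAt E c p₀)‖ + 1)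
      (fun i _ => by positivity) (Finset.mem_range.2 (Nat.lt_succ_of_le hi))
    simp only [S]
    linarith
  have hev : ∀ᶠ p in 𝓝 p₀, ∀ i ∈ Finset.range (k + 1),
      ‖iteratedFDeriv ℝ i τ (chartAt E c p)‖ < S := by
    refine (Filter.eventually_all_finset _).2 fun i hi => ?_
    exact (((hcont i).comp (f := chartAt E c) ((chartAt E c).continuousAt hc)).norm).eventually_lt
      continuousAt_const (hSi i (Nat.lt_succ_iff.1 (Finset.mem_range.1 hi)))
  refine ⟨(k.factorial : ℝ) * S ^ k, by positivity, ?_⟩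
  filter_upwards [hev, (chartAt E c).open_source.mem_nhds hc,
    (chartAt E c').open_source.mem_nhds hc'] with p hp hpc hpc' η hη b hb j hj
  have hx := hmem p hpc hpc'
  have hb0 : 0 ≤ b := (norm_nonneg _).trans (hb 0 (Nat.zero_le k))
  have hτx : τ (chartAt E c p) = chartAt E c' p := by
    change chartAt E c' ((chartAt E c).symm (chartAt E c p)) = _
    rw [(chartAt E c).left_inv hpc]
  have heq : η ∘ (chartAt E c).symm =ᶠ[𝓝 (chartAt E c p)] (η ∘ (chartAt E c').symm) ∘ τ := by
    filter_upwards [hO.mem_nhds hx] with y hy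
    change _ = η ((chartAt E c').symm (chartAt E c' ((chartAt E c).symm y)))
    rw [(chartAt E c').left_inv (mem_coordChange_source.1 hy).2]
    rfl
  rw [(heq.iteratedFDeriv ℝ j).self_of_nhds, ← iteratedFDerivWithin_of_isOpen j hO hx]
  have hto := (chartAt E c').open_target
  have hcomp := norm_iteratedFDerivWithin_comp_le (n := j) (C := b) (D := S)
    (contDiffOn_comp_chart_symm hη c') (hτ.of_le le_top)
    (by exact_mod_cast hj) hto.uniqueDiffOn hO.uniqueDiffOn
    (fun y hy => (chartAt E c').map_source (mem_coordChange_source.1 hy).2) hx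
    (fun i hi => by
      rw [hτx, iteratedFDerivWithin_of_isOpen i hto ((chartAt E c').map_source hpc')]
      exact hb i (hi.trans hj))
    (fun i hi0 hi => by
      rw [iteratedFDerivWithin_of_isOpen i hO hx]
      exact (hp i (Finset.mem_range.2 (by omega))).le.trans (le_self_pow₀ hS1 (by omega)))
  refine hcomp.trans ?_
  have h1 : (j.factorial : ℝ) ≤ k.factorial := by exact_mod_cast Nat.factorial_le hj
  have h2 : S ^ j ≤ S ^ k := pow_le_pow_right₀ hS1 hj
  calc (j.factorial : ℝ) * b * S ^ j ≤ k.factorial * b * S ^ k := by gcongr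
    _ = _ := by ring

namespace ChartCover

variable (𝒦 : ChartCover E M)

theorem cNorm_le_iff {k : ℕ} {η : M → ℝ} {b : ℝ≥0∞} : 𝒦.cNorm k η ≤ b ↔
    ∀ c ∈ 𝒦.centers, ∀ p ∈ 𝒦.K c, ∀ j ≤ k,
      ‖iteratedFDeriv ℝ j (η ∘ (chartAt E c).symm) (chartAt E c p)‖ₑ ≤ b := by
  simp only [cNorm, iSup_le_iff, Set.mem_Iic]

theorem enorm_iteratedFDeriv_le_cNorm {k : ℕ} (η : M → ℝ) {c p : M} (hc : c ∈ 𝒦.centers)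
    (hp : p ∈ 𝒦.K c) {j : ℕ} (hj : j ≤ k) :
    ‖iteratedFDeriv ℝ j (η ∘ (chartAt E c).symm) (chartAt E c p)‖ₑ ≤ 𝒦.cNorm k η :=
  𝒦.cNorm_le_iff.1 le_rfl c hc p hp j hj

theorem cNorm_zero (k : ℕ) : 𝒦.cNorm k (0 : M → ℝ) = 0 := by
  refine le_antisymm (𝒦.cNorm_le_iff.2 fun c _ p _ j _ => ?_) zero_le
  have : (0 : M → ℝ) ∘ (chartAt E c).symm = fun _ => 0 := rfl
  rw [this, iteratedFDeriv_fun_zero]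
  simp

theorem cNorm_sub_comm (k : ℕ) (η η' : M → ℝ) : 𝒦.cNorm k (η - η') = 𝒦.cNorm k (η' - η) := by
  have key : ∀ η η' : M → ℝ, 𝒦.cNorm k (η - η') ≤ 𝒦.cNorm k (η' - η) := by
    refine fun η η' => 𝒦.cNorm_le_iff.2 fun c hc p hp j hj => ?_
    have h := 𝒦.enorm_iteratedFDeriv_le_cNorm (η' - η) hc hp hj
    have h1 : (η - η') ∘ (chartAt E c).symm = -((η' - η) ∘ (chartAt E c).symm) := by
      ext x; simp
    rw [h1, iteratedFDeriv_neg_apply, enorm_neg]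
    exact h
  exact le_antisymm (key _ _) (key _ _)

theorem cNorm_add_le [IsManifold 𝓘(ℝ, E) ω M] {k : ℕ} {η η' : M → ℝ}
    (hη : ContMDiff 𝓘(ℝ, E) 𝓘(ℝ, ℝ) k η) (hη' : ContMDiff 𝓘(ℝ, E) 𝓘(ℝ, ℝ) k η') :
    𝒦.cNorm k (η + η') ≤ 𝒦.cNorm k η + 𝒦.cNorm k η' := by
  refine 𝒦.cNorm_le_iff.2 fun c hc p hp j hj => ?_
  have hx := (chartAt E c).map_source (𝒦.subset_source c hc hp)
  have hj' : (j : WithTop ℕ∞) ≤ k := by exact_mod_cast hj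
  have h1 : (η + η') ∘ (chartAt E c).symm =
    η ∘ (chartAt E c).symm + η' ∘ (chartAt E c).symm := rfl
  rw [h1, iteratedFDeriv_add_apply ((contDiffAt_comp_chart_symm hη hx).of_le hj')
    ((contDiffAt_comp_chart_symm hη' hx).of_le hj')]
  exact (enorm_add_le _ _).trans (add_le_add (𝒦.enorm_iteratedFDeriv_le_cNorm η hc hp hj)
    (𝒦.enorm_iteratedFDeriv_le_cNorm η' hc hp hj))

/-- The `C^k` norm controls the derivatives in every chart. -/
theorem exists_iteratedFDeriv_le_cNorm [T2Space M] [IsManifold 𝓘(ℂ, E) ω M] (k : ℕ) {c p₀ : M}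
    (hc : p₀ ∈ (chartAt E c).source) : ∃ A : ℝ, 0 < A ∧ ∀ᶠ p in 𝓝 p₀, ∀ η : M → ℝ,
      ContMDiff 𝓘(ℝ, E) 𝓘(ℝ, ℝ) k η → ∀ b : ℝ, 0 ≤ b → 𝒦.cNorm k η ≤ ENNReal.ofReal b →
      ∀ j ≤ k, ‖iteratedFDeriv ℝ j (η ∘ (chartAt E c).symm) (chartAt E c p)‖ ≤ A * b := by
  have hR := isManifold_real (E := E) (M := M)
  -- For each centre either `p₀` lies in the compact set, and the two charts are compared at `p₀`,
  -- or a neighbourhood of `p₀` misses this closed set and there is nothing to prove.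
  have h : ∀ c' : M, ∃ A : ℝ, 0 < A ∧ (c' ∈ 𝒦.centers → ∀ᶠ p in 𝓝 p₀, p ∈ 𝒦.K c' →
      ∀ η : M → ℝ, ContMDiff 𝓘(ℝ, E) 𝓘(ℝ, ℝ) k η → ∀ b : ℝ, 0 ≤ b →
      𝒦.cNorm k η ≤ ENNReal.ofReal b →
      ∀ j ≤ k, ‖iteratedFDeriv ℝ j (η ∘ (chartAt E c).symm) (chartAt E c p)‖ ≤ A * b) := by
    intro c'
    by_cases hc' : c' ∈ 𝒦.centers
    · by_cases hp : p₀ ∈ 𝒦.K c'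
      · obtain ⟨A, hA, hev⟩ := exists_iteratedFDeriv_le k hc (𝒦.subset_source c' hc' hp)
        refine ⟨A, hA, fun _ => ?_⟩
        filter_upwards [hev] with p hp hpK η hη b hb0 hb
        refine hp η hη b fun j hj => ?_
        have := (𝒦.enorm_iteratedFDeriv_le_cNorm η hc' hpK hj).trans hb
        rwa [← ofReal_norm, ENNReal.ofReal_le_ofReal_iff hb0] at this
      · refine ⟨1, one_pos, fun _ => ?_⟩
        filter_upwards [(𝒦.isCompact c' hc').isClosed.isOpen_compl.mem_nhds hp] with p hp hp'
        exact absurd hp' hp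
    · exact ⟨1, one_pos, fun h => absurd h hc'⟩
  choose A hA hev using h
  refine ⟨∑ c' ∈ 𝒦.centers, A c' + 1, ?_, ?_⟩
  · have := Finset.sum_nonneg (s := 𝒦.centers) (f := A) fun c' _ => (hA c').le
    linarith
  · filter_upwards [(Filter.eventually_all_finset _).2 hev] with p hp η hη b hb0 hb j hj
    obtain ⟨c', hc', hpK⟩ := 𝒦.covers p
    refine (hp c' hc' hpK η hη b hb0 hb j hj).trans ?_
    have := Finset.single_le_sum (f := A) (fun c' _ => (hA c').le) hc'
    gcongr
    linarith

end ChartCover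

end CalabiLegendre

end

/-! ### Cells of the diastasis and uniform closeness -/

noncomputable section

set_option maxSynthPendingDepth 3

namespace CalabiLegendre

/-- A ball in a chart on which the diastasis is symmetric and uniformly convex. -/
structure DiastasisCell (E : Type*) [NormedAddCommGroup E] [NormedSpace ℂ E]
    {M : Type*} [TopologicalSpace M] [ChartedSpace E M] (V : Set (M × M)) (D : M × M → ℝ) where
  /-- the centre of the chart -/
  center : M
  /-- the centre of the ball -/
  x₀ : E
  /-- the radius of the ball -/
  R : ℝ
  /-- the constant of uniform convexity -/
  a : ℝ
  /-- the diastasis in the chart -/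
  d : E × E → ℝ
  isConvexCell : IsConvexCell d x₀ R a
  ball_subset : Metric.ball x₀ R ⊆ (chartAt E center).target
  mem : ∀ x ∈ Metric.ball x₀ R, ∀ y ∈ Metric.ball x₀ R,
    ((chartAt E center).symm x, (chartAt E center).symm y) ∈ V
  eq : ∀ x ∈ Metric.ball x₀ R, ∀ y ∈ Metric.ball x₀ R,
    D ((chartAt E center).symm x, (chartAt E center).symm y) = d (x, y)
  symm : ∀ x ∈ Metric.ball x₀ R, ∀ y ∈ Metric.ball x₀ R, d (y, x) = d (x, y)
  diag : ∀ x ∈ Metric.ball x₀ R, d (x, x) = 0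

variable {E : Type*} [NormedAddCommGroup E] [NormedSpace ℂ E]
  {M : Type*} [TopologicalSpace M] [ChartedSpace E M] {V : Set (M × M)} {D : M × M → ℝ}

namespace DiastasisCell

/-- The concentric subregions of a cell. -/
def region (s : DiastasisCell E V D) (t : ℝ) : Set M :=
  chartSet s.center (Metric.ball s.x₀ (t * s.R))

theorem isOpen_region (s : DiastasisCell E V D) (t : ℝ) : IsOpen (s.region t) :=
  isOpen_chartSet _ Metric.isOpen_ball

theorem region_mono (s : DiastasisCell E V D) {t t' : ℝ} (h : t ≤ t') :
    s.region t ⊆ s.region t' := fun _ hp =>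
  ⟨hp.1, Metric.ball_subset_ball (by gcongr; exact s.isConvexCell.R_pos.le) hp.2⟩

theorem mem_ball (s : DiastasisCell E V D) {t : ℝ} (ht : t ≤ 1) {p : M} (hp : p ∈ s.region t) :
    chartAt E s.center p ∈ Metric.ball s.x₀ s.R := by
  have := (s.region_mono ht hp).2
  rwa [one_mul] at this

theorem D_eq (s : DiastasisCell E V D) {p q : M} (hp : p ∈ s.region 1) (hq : q ∈ s.region 1) :
    D (p, q) = s.d (chartAt E s.center p, chartAt E s.center q) := by
  rw [← s.eq _ (s.mem_ball le_rfl hp) _ (s.mem_ball le_rfl hq), (chartAt E s.center).left_inv hp.1,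
    (chartAt E s.center).left_inv hq.1]

theorem mem_V (s : DiastasisCell E V D) {p q : M} (hp : p ∈ s.region 1) (hq : q ∈ s.region 1) :
    (p, q) ∈ V := by
  have := s.mem _ (s.mem_ball le_rfl hp) _ (s.mem_ball le_rfl hq)
  rwa [(chartAt E s.center).left_inv hp.1, (chartAt E s.center).left_inv hq.1] at this

theorem nonneg (s : DiastasisCell E V D) {x y : E} (hx : x ∈ Metric.ball s.x₀ s.R)
    (hy : y ∈ Metric.ball s.x₀ s.R) : 0 ≤ s.d (x, y) :=
  le_trans (mul_nonneg (half_pos s.isConvexCell.a_pos).le (sq_nonneg _))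
    (s.isConvexCell.mul_sq_le hx hy (s.diag y hy))

/-- The closed coordinate ball has a compact image, which is closed because `M` is Hausdorff; so no
limit points outside the chart occur. -/
theorem closure_region_subset [FiniteDimensional ℂ E] [T2Space M] (s : DiastasisCell E V D)
    {t t' : ℝ} (h : t < t') (ht' : t' ≤ 1) : closure (s.region t) ⊆ s.region t' := by
  have : ProperSpace E := FiniteDimensional.proper ℂ E
  have hR := s.isConvexCell.R_pos
  have hsub : Metric.closedBall s.x₀ (t * s.R) ⊆ Metric.ball s.x₀ (t' * s.R) :=
    Metric.closedBall_subset_ball (by gcongr)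
  have hsub' : Metric.ball s.x₀ (t' * s.R) ⊆ (chartAt E s.center).target :=
    (Metric.ball_subset_ball (by nlinarith)).trans s.ball_subset
  have hcomp : IsCompact ((chartAt E s.center).symm '' Metric.closedBall s.x₀ (t * s.R)) :=
    (isCompact_closedBall _ _).image_of_continuousOn
      ((chartAt E s.center).continuousOn_symm.mono (hsub.trans hsub'))
  refine (closure_minimal ?_ hcomp.isClosed).trans ?_
  · intro p hp
    exact ⟨chartAt E s.center p, Metric.ball_subset_closedBall hp.2,
      (chartAt E s.center).left_inv hp.1⟩
  · rintro _ ⟨x, hx, rfl⟩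
    exact (symm_mem_chartSet (hsub' (hsub hx))).2 (hsub hx)

/-- If `z` lies in the larger open region, so does the second point; otherwise `z` is off the
closure of the smaller one, and so is the first point. No relation between `z` and the cell is
assumed. -/
theorem eventually_imp [FiniteDimensional ℂ E] [T2Space M] (s : DiastasisCell E V D) {t t' : ℝ}
    (h : t < t') (ht' : t' ≤ 1) (z : M) :
    ∀ᶠ x : M × M in 𝓝 (z, z), x.1 ∈ s.region t → x.2 ∈ s.region t' := by
  rw [nhds_prod_eq]
  by_cases hz : z ∈ s.region t'
  · have := (s.isOpen_region t').mem_nhds hz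
    filter_upwards [Filter.tendsto_snd.eventually this] with x hx _ using hx
  · have : (closure (s.region t))ᶜ ∈ 𝓝 z :=
      isClosed_closure.isOpen_compl.mem_nhds fun h' => hz (s.closure_region_subset h ht' h')
    filter_upwards [Filter.tendsto_fst.eventually this] with x hx hx'
    exact absurd (subset_closure hx') hx

end DiastasisCell

/-- Around every point of a chart there are arbitrarily small cells. -/
theorem KahlerForm.IsDiastasisNhd.exists_cell [FiniteDimensional ℂ E] [IsManifold 𝓘(ℂ, E) ω M]
    {κ : KahlerForm E M} (h : κ.IsDiastasisNhd V D) {c p : M} (hp : p ∈ (chartAt E c).source)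
    {O : Set M} (hO : O ∈ 𝓝 p) :
    ∃ s : DiastasisCell E V D, s.center = c ∧ s.x₀ = chartAt E c p ∧ s.region 1 ⊆ O := by
  have : FiniteDimensional ℝ E := FiniteDimensional.complexToReal E
  obtain ⟨U, W, u, uC, hpot, hpW, hDW⟩ := h.eq_local _ (h.diag_subset p)
  set x₀ := chartAt E c p with hx₀
  have hx₀t : x₀ ∈ (chartAt E c).target := (chartAt E c).map_source hp
  have hpx : (chartAt E c).symm x₀ = p := (chartAt E c).left_inv hp
  have hc : Filter.Tendsto (chartAt E c).symm (𝓝 x₀) (𝓝 p) := by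
    have := (chartAt E c).continuousAt_symm hx₀t
    rwa [ContinuousAt, hpx] at this
  have hVW : V ∩ W ∈ 𝓝 (p, p) := (h.isOpen.inter hpot.isOpen_W).mem_nhds ⟨h.diag_subset p, hpW⟩
  obtain ⟨N, hN, hpN, hNsub⟩ := exists_nhds_square hVW
  obtain ⟨ρ, hρ, hρball⟩ := Metric.eventually_nhds_iff_ball.1
    (((chartAt E c).open_target.eventually_mem hx₀t).and
      ((hc.eventually (hN.mem_nhds hpN)).and (hc.eventually hO)))
  set B := Metric.ball x₀ ρ with hB
  have hBt : B ⊆ (chartAt E c).target := fun x hx => (hρball x hx).1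
  have hBVW : ∀ x ∈ B, ∀ y ∈ B, ((chartAt E c).symm x, (chartAt E c).symm y) ∈ V ∩ W :=
    fun x hx y hy => hNsub ⟨(hρball x hx).2.1, (hρball y hy).2.1⟩
  have hk := hpot.isKernel Metric.isOpen_ball (convex_ball x₀ ρ) hBt
    fun x hx y hy => (hBVW x hx y hy).2
  set k : E × Conj E → ℂ :=
    fun z => uC ((chartAt E c).symm z.1, (chartAt E c).symm (fromConj E z.2))
  obtain ⟨R, a, hRρ, hcell⟩ := exists_isConvexCell hρ (hk.contDiffOn_diastasis.of_le (by simp))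
    (fun x hx => hk.dfst_diastasis_diag Metric.isOpen_ball (convex_ball _ _) hx)
    (fun v hv => by
      rw [hk.fderiv_dfst_diastasis Metric.isOpen_ball (convex_ball _ _) (Metric.mem_ball_self hρ)]
      exact κ.inChart_pos hx₀t hv)
  have hsub : Metric.ball x₀ R ⊆ B := Metric.ball_subset_ball hRρ
  refine ⟨⟨c, x₀, R, a, kernelDiastasis k, hcell, hsub.trans hBt,
    fun x hx y hy => (hBVW x (hsub hx) y (hsub hy)).1, fun x hx y hy => ?_,
    fun x hx y hy => hk.diastasis_symm Metric.isOpen_ball (convex_ball _ _) (hsub hx) (hsub hy),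
    fun x _ => kernelDiastasis_self k x⟩, rfl, rfl, fun q hq => ?_⟩
  · have hU : ∀ x ∈ B, (chartAt E c).symm x ∈ U := fun x hx =>
      (hpot.W_subset (hBVW x hx x hx).2).1
    rw [hDW _ (hBVW x (hsub hx) y (hsub hy))]
    simp only [diastasis, kernelDiastasis, k, fromConj_toConj, hpot.diag _ (hU x (hsub hx)),
      hpot.diag _ (hU y (hsub hy)), Complex.ofReal_re]
  · have hqB : chartAt E c q ∈ B := hsub (by simpa using hq.2)
    have := (hρball _ hqB).2.2
    rwa [(chartAt E c).left_inv hq.1] at this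

/-- Two points are close with respect to a finite family of cells. -/
structure IsClose (S : Finset (DiastasisCell E V D)) (p q : M) : Prop where
  mem_swap : (q, p) ∈ V
  symm : D (q, p) = D (p, q)
  nonneg : 0 ≤ D (p, q)
  half : ∀ s ∈ S, p ∈ s.region (1 / 4) → q ∈ s.region (1 / 2)
  three_swap : ∀ s ∈ S, q ∈ s.region (1 / 2) → p ∈ s.region (3 / 4)

/-- Points with small diastasis are close. -/
theorem KahlerForm.IsDiastasisNhd.exists_isClose [FiniteDimensional ℂ E]
    [IsManifold 𝓘(ℂ, E) ω M] [CompactSpace M] [T2Space M] {κ : KahlerForm E M}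
    (h : κ.IsDiastasisNhd V D) (S : Finset (DiastasisCell E V D))
    (hS : ∀ p, ∃ s ∈ S, p ∈ s.region (1 / 4)) :
    ∃ b : ℝ, 0 < b ∧ ∀ p q, (p, q) ∈ V → D (p, q) < b → IsClose S p q := by
  have hev : ∀ z : M, ∀ᶠ x : M × M in 𝓝 (z, z), IsClose S x.1 x.2 := by
    intro z
    obtain ⟨s, hs, hz⟩ := hS z
    have h1 : ∀ᶠ x : M × M in 𝓝 (z, z), x.1 ∈ s.region 1 ∧ x.2 ∈ s.region 1 := by
      have := (s.isOpen_region 1).mem_nhds (s.region_mono (by norm_num) hz)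
      exact (continuous_fst.tendsto (z, z)).eventually this |>.and
        ((continuous_snd.tendsto (z, z)).eventually this)
    have h2 : ∀ t t' : ℝ, t < t' → t' ≤ 1 → ∀ᶠ x : M × M in 𝓝 (z, z), ∀ s ∈ S,
        x.1 ∈ s.region t → x.2 ∈ s.region t' := fun t t' ht ht' =>
      (Filter.eventually_all_finset S).2 fun s _ => s.eventually_imp ht ht' z
    have h3 : ∀ t t' : ℝ, t < t' → t' ≤ 1 → ∀ᶠ x : M × M in 𝓝 (z, z), ∀ s ∈ S,
        x.2 ∈ s.region t → x.1 ∈ s.region t' := fun t t' ht ht' =>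
      (continuous_swap.tendsto (z, z)).eventually (h2 t t' ht ht')
    filter_upwards [h1, h2 (1 / 4) (1 / 2) (by norm_num) (by norm_num),
      h3 (1 / 2) (3 / 4) (by norm_num) (by norm_num)] with x hx hx1 hx2
    have hb1 := s.mem_ball le_rfl hx.1
    have hb2 := s.mem_ball le_rfl hx.2
    refine ⟨s.mem_V hx.2 hx.1, ?_, ?_, hx1, hx2⟩
    · rw [s.D_eq hx.1 hx.2, s.D_eq hx.2 hx.1, s.symm _ hb1 _ hb2]
    · have := s.nonneg hb1 hb2
      rwa [← s.D_eq hx.1 hx.2] at this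
  obtain ⟨δ, hδ, hδN⟩ := κ.exists_edist_lt_mem (N := interior {x | IsClose S x.1 x.2})
    isOpen_interior fun z => mem_interior_iff_mem_nhds.2 (hev z)
  obtain ⟨C, hC, hCV⟩ := h.lower_bound
  -- Closeness holds near the diagonal, hence for points at distance less than some uniform `δ`. By
  -- the lower bound `D ≥ C d²`, a diastasis below `C δ²` forces such a distance.
  refine ⟨C * δ ^ 2, by positivity, fun p q hpq hD => ?_⟩
  refine (interior_subset : interior {x : M × M | IsClose S x.1 x.2} ⊆ _) (hδN p q ?_)
  by_contra! hle
  have h1 := hCV (p, q) hpq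
  have h2 : ENNReal.ofReal (C * δ ^ 2) ≤ ENNReal.ofReal (D (p, q)) := by
    refine le_trans ?_ h1
    rw [ENNReal.ofReal_mul hC.le, ENNReal.ofReal_pow hδ.le]
    gcongr
  exact absurd h2 (not_le.2 ((ENNReal.ofReal_lt_ofReal_iff (by positivity)).2 hD))

/-- Derivatives of functions on a cell are controlled by the `C²` norm. -/
def DiastasisCell.IsBounded (𝒦 : ChartCover E M) (s : DiastasisCell E V D) (A : ℝ) : Prop :=
  ∀ η : M → ℝ, ContMDiff 𝓘(ℝ, E) 𝓘(ℝ, ℝ) 2 η → ∀ b : ℝ, 0 ≤ b →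
    𝒦.cNorm 2 η ≤ ENNReal.ofReal b → ∀ x ∈ Metric.ball s.x₀ s.R, ∀ j ≤ 2,
      ‖iteratedFDeriv ℝ j (η ∘ (chartAt E s.center).symm) x‖ ≤ A * b

/-- The compact sets of a chart cover are covered by finitely many cells of the same charts. -/
theorem KahlerForm.IsDiastasisNhd.exists_finset_cell [FiniteDimensional ℂ E]
    [IsManifold 𝓘(ℂ, E) ω M] [T2Space M] {κ : KahlerForm E M}
    (h : κ.IsDiastasisNhd V D) (𝒦 : ChartCover E M) : ∃ S : Finset (DiastasisCell E V D),
      (∀ s ∈ S, ∃ A : ℝ, 0 < A ∧ s.IsBounded 𝒦 A) ∧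
      ∀ c ∈ 𝒦.centers, ∀ p ∈ 𝒦.K c, ∃ s ∈ S, s.center = c ∧ p ∈ s.region (1 / 4) := by
  classical
  have hc : ∀ c ∈ 𝒦.centers, ∃ S : Finset (DiastasisCell E V D),
      (∀ s ∈ S, ∃ A : ℝ, 0 < A ∧ s.IsBounded 𝒦 A) ∧
      ∀ p ∈ 𝒦.K c, ∃ s ∈ S, s.center = c ∧ p ∈ s.region (1 / 4) := by
    intro c hc
    -- The cells covering `K c` are taken in the chart at `c` itself, so that derivatives computed
    -- in them are the ones that enter the `C^k` norm.
    let I := {s : DiastasisCell E V D // s.center = c ∧ ∃ A : ℝ, 0 < A ∧ s.IsBounded 𝒦 A}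
    obtain ⟨T, hT⟩ := (𝒦.isCompact c hc).elim_finite_subcover
      (fun s : I => s.1.region (1 / 4)) (fun s => s.1.isOpen_region _) fun p hp => by
        have hps := 𝒦.subset_source c hc hp
        obtain ⟨A, hA, hev⟩ := 𝒦.exists_iteratedFDeriv_le_cNorm 2 hps
        obtain ⟨s, rfl, hs, hsub⟩ := h.exists_cell hps hev
        refine Set.mem_iUnion.2 ⟨⟨s, rfl, A, hA, fun η hη b hb0 hb x hx j hj => ?_⟩, ?_⟩
        · have hx1 : (chartAt E s.center).symm x ∈ s.region 1 :=
            (symm_mem_chartSet (s.ball_subset hx)).2 (by simpa using hx)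
          have := hsub hx1 η hη b hb0 hb j hj
          rwa [(chartAt E s.center).right_inv (s.ball_subset hx)] at this
        · refine ⟨hps, ?_⟩
          have hR := s.isConvexCell.R_pos
          change chartAt E s.center p ∈ Metric.ball s.x₀ (1 / 4 * s.R)
          rw [hs]
          exact Metric.mem_ball_self (by positivity)
    refine ⟨T.image Subtype.val, fun s hs => ?_, fun p hp => ?_⟩
    · obtain ⟨i, -, rfl⟩ := Finset.mem_image.1 hs
      exact i.2.2
    · obtain ⟨i, hi, hpi⟩ := Set.mem_iUnion₂.1 (hT hp)
      exact ⟨i.1, Finset.mem_image_of_mem _ hi, i.2.1, hpi⟩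
  choose! S hS1 hS2 using hc
  refine ⟨𝒦.centers.biUnion S, fun s hs => ?_, fun c hc p hp => ?_⟩
  · obtain ⟨c, hc, hs⟩ := Finset.mem_biUnion.1 hs
    exact hS1 c hc s hs
  · obtain ⟨s, hs, h⟩ := hS2 c hc p hp
    exact ⟨s, Finset.mem_biUnion.2 ⟨c, hc, hs⟩, h⟩

end CalabiLegendre

end

/-! ### Maximizers of small functions and the involution -/

noncomputable section

set_option maxSynthPendingDepth 3

namespace CalabiLegendre

section Maximizer

variable {M : Type*}

/-- `z` maximizes `p ↦ -D(p, q) - η(p)` on the slice `{p | (p, q) ∈ V}`. -/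
def IsMaximizer (V : Set (M × M)) (D : M × M → ℝ) (η : M → ℝ) (q z : M) : Prop :=
  (z, q) ∈ V ∧ ∀ p, (p, q) ∈ V → -D (p, q) - η p ≤ -D (z, q) - η z

variable {V : Set (M × M)} {D : M × M → ℝ} {η f : M → ℝ} {q z : M}

theorem legendreArg_toE (D : M × M → ℝ) (η : M → ℝ) (q p : M) :
    legendreArg D (toE η) q p = ((-D (p, q) - η p : ℝ) : EReal) := by
  rw [legendreArg, toE, ← EReal.coe_sub]

/-- A point with the same value would be a second maximizer. -/
theorem IsMaximizer.isUniqueMaximizer (h : IsMaximizer V D η q z)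
    (hu : ∀ p, IsMaximizer V D η q p → p = z) : IsUniqueMaximizer V D (toE η) q z := by
  refine ⟨h.1, fun p hp hpz => ?_⟩
  rw [legendreArg_toE, legendreArg_toE, EReal.coe_lt_coe_iff]
  refine lt_of_le_of_ne (h.2 p hp) fun heq => hpz (hu p ⟨hp, fun p' hp' => ?_⟩)
  exact (h.2 p' hp').trans heq.ge

/-- The Legendre transform is the maximal value if the latter is continuous. -/
theorem legendre_eq_toE [TopologicalSpace M] {z : M → M} (h : ∀ q, IsMaximizer V D η q (z q))
    (hf : ∀ q, f q = -D (z q, q) - η (z q)) (hc : Continuous f) :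
    legendre V D (toE η) = toE f := by
  have hsup : ∀ q, ⨆ p ∈ {p : M | (p, q) ∈ V}, legendreArg D (toE η) q p = (f q : EReal) := by
    intro q
    refine le_antisymm (iSup₂_le fun p hp => ?_) ?_
    · rw [legendreArg_toE, hf q, EReal.coe_le_coe_iff]
      exact (h q).2 p hp
    · rw [hf q, ← legendreArg_toE]
      exact le_iSup₂ (f := fun p _ => legendreArg D (toE η) q p) (z q) (h q).1
  funext q
  simp only [legendre, hsup]
  exact ((continuous_coe_real_ereal.comp hc).tendsto q).limsup_eq

end Maximizer

variable {E : Type*} [NormedAddCommGroup E] [NormedSpace ℂ E]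
  {M : Type*} [TopologicalSpace M] [ChartedSpace E M] {V : Set (M × M)} {D : M × M → ℝ}

/-- A finite family of cells that covers the manifold, such that points with diastasis smaller than
`b` are close. -/
structure IsCellAtlas (S : Finset (DiastasisCell E V D)) (b : ℝ) : Prop where
  covers : ∀ p, ∃ s ∈ S, p ∈ s.region (1 / 4)
  b_pos : 0 < b
  isClose : ∀ p q, (p, q) ∈ V → D (p, q) < b → IsClose S p q

/-- A function that is small enough, with its first two derivatives, on the cells of an atlas. -/
structure IsSmall (S : Finset (DiastasisCell E V D)) (b : ℝ) (η : M → ℝ) : Prop where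
  contMDiff : ContMDiff 𝓘(ℝ, E) 𝓘(ℝ, ℝ) 2 η
  abs_le : ∀ p, |η p| ≤ b / 4
  fderiv_le : ∀ s ∈ S, ∀ x ∈ Metric.ball s.x₀ s.R,
    ‖fderiv ℝ (η ∘ (chartAt E s.center).symm) x‖ ≤ s.a / 2 * (s.R / 4)
  fderiv_fderiv_le : ∀ s ∈ S, ∀ x ∈ Metric.ball s.x₀ s.R,
    ‖fderiv ℝ (fderiv ℝ (η ∘ (chartAt E s.center).symm)) x‖ ≤ s.a / 2

variable {S : Finset (DiastasisCell E V D)} {b : ℝ} {η ψ : M → ℝ} {p q z : M}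

namespace IsCellAtlas

theorem diag (hS : IsCellAtlas S b) (q : M) : (q, q) ∈ V ∧ D (q, q) = 0 := by
  obtain ⟨s, -, hq⟩ := hS.covers q
  have hq1 := s.region_mono (by norm_num : (1 / 4 : ℝ) ≤ 1) hq
  exact ⟨s.mem_V hq1 hq1, by rw [s.D_eq hq1 hq1, s.diag _ (s.mem_ball le_rfl hq1)]⟩

/-- A candidate at least as good as `p = q`, where `D` vanishes, has `D(z, q) ≤ η(q) - η(z) ≤ b / 2
< b`. This is the purpose of the bound `b / 4`. -/
theorem lt_of_le (hS : IsCellAtlas S b) (hη : ∀ p, |η p| ≤ b / 4)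
    (h : -D (q, q) - η q ≤ -D (z, q) - η z) : D (z, q) < b := by
  rw [(hS.diag q).2] at h
  have h1 := abs_le.1 (hη q)
  have h2 := abs_le.1 (hη z)
  linarith [hS.b_pos]

theorem isClose_of_isMaximizer (hS : IsCellAtlas S b) (hη : ∀ p, |η p| ≤ b / 4)
    (h : IsMaximizer V D η q z) : IsClose S z q :=
  hS.isClose z q h.1 (hS.lt_of_le hη (h.2 q (hS.diag q).1))

/-- Maximize over the compact ball of relative radius `3 / 4` in a cell around `q`. Points with
diastasis below `b` belong to it, and all others do worse than `q` itself. -/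
theorem exists_isMaximizer [FiniteDimensional ℂ E] (hS : IsCellAtlas S b)
    (hη : ∀ p, |η p| ≤ b / 4) (hc : Continuous η) (q : M) : ∃ z, IsMaximizer V D η q z := by
  have : ProperSpace E := FiniteDimensional.proper ℂ E
  obtain ⟨s, hs, hq⟩ := hS.covers q
  have hR := s.isConvexCell.R_pos
  set φ := chartAt E s.center
  have hq1 := s.region_mono (by norm_num : (1 / 4 : ℝ) ≤ 1) hq
  have hq2 := s.region_mono (by norm_num : (1 / 4 : ℝ) ≤ 1 / 2) hq
  have hsub : Metric.closedBall s.x₀ (3 / 4 * s.R) ⊆ Metric.ball s.x₀ s.R :=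
    Metric.closedBall_subset_ball (by linarith)
  have hy := s.mem_ball le_rfl hq1
  have hcont : ContinuousOn (fun x => -s.d (x, φ q) - η (φ.symm x))
      (Metric.closedBall s.x₀ (3 / 4 * s.R)) := by
    refine ContinuousOn.sub (ContinuousOn.neg ?_)
      (hc.comp_continuousOn (φ.continuousOn_symm.mono (hsub.trans s.ball_subset)))
    exact s.isConvexCell.smooth.continuousOn.comp (by fun_prop) fun x hx => ⟨hsub hx, hy⟩
  have hqc : φ q ∈ Metric.closedBall s.x₀ (3 / 4 * s.R) :=
    Metric.ball_subset_closedBall (s.region_mono (by norm_num : (1 / 4 : ℝ) ≤ 3 / 4) hq).2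
  obtain ⟨x, hx, hmax⟩ := (isCompact_closedBall s.x₀ (3 / 4 * s.R)).exists_isMaxOn ⟨_, hqc⟩ hcont
  have hx1 : φ.symm x ∈ s.region 1 :=
    (symm_mem_chartSet (s.ball_subset (hsub hx))).2 (by simpa using hsub hx)
  have hDx : D (φ.symm x, q) = s.d (x, φ q) := by
    rw [s.D_eq hx1 hq1, φ.right_inv (s.ball_subset (hsub hx))]
  have key : ∀ p ∈ s.region (3 / 4), -D (p, q) - η p ≤ -D (φ.symm x, q) - η (φ.symm x) := by
    intro p hp
    have := hmax (Metric.ball_subset_closedBall hp.2)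
    simp only [Set.mem_ofPred_eq] at this
    rwa [φ.left_inv hp.1, ← s.D_eq (s.region_mono (by norm_num) hp) hq1, ← hDx] at this
  refine ⟨φ.symm x, s.mem_V hx1 hq1, fun p hp => ?_⟩
  by_cases hpq : D (p, q) < b
  · exact key p ((hS.isClose p q hp hpq).three_swap s hs hq2)
  · have h1 := key q (s.region_mono (by norm_num) hq)
    rw [(hS.diag q).2] at h1
    have h2 := abs_le.1 (hη q)
    have h3 := abs_le.1 (hη p)
    linarith [hS.b_pos]

/-- Closeness puts the maximizer inside the open cell, so it is an interior local maximum in the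
chart and the differential vanishes. -/
theorem critical [IsManifold 𝓘(ℝ, E) ω M] (hS : IsCellAtlas S b) (hη : IsSmall S b η)
    (h : IsMaximizer V D η q z) {s : DiastasisCell E V D} (hs : s ∈ S)
    (hq : q ∈ s.region (1 / 2)) : z ∈ s.region (3 / 4) ∧
      dfst s.d (chartAt E s.center z, chartAt E s.center q) +
        fderiv ℝ (η ∘ (chartAt E s.center).symm) (chartAt E s.center z) = 0 := by
  have hz := (hS.isClose_of_isMaximizer hη.abs_le h).three_swap s hs hq
  refine ⟨hz, ?_⟩
  set φ := chartAt E s.center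
  have hx := s.mem_ball (by norm_num) hz
  have hy := s.mem_ball (by norm_num) hq
  have hq1 := s.region_mono (by norm_num : (1 / 2 : ℝ) ≤ 1) hq
  have hd := (s.isConvexCell.hasFDerivAt_left hx hy).neg.sub
    ((contDiffAt_comp_chart_symm hη.contMDiff (s.ball_subset hx)).differentiableAt
      (by simp)).hasFDerivAt
  have hmax : IsLocalMax (fun x => -s.d (x, φ q) - (η ∘ φ.symm) x) (φ z) := by
    filter_upwards [Metric.isOpen_ball.mem_nhds hx] with x hx'
    have hx1 : φ.symm x ∈ s.region 1 :=
      (symm_mem_chartSet (s.ball_subset hx')).2 (by simpa using hx')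
    have := h.2 (φ.symm x) (s.mem_V hx1 hq1)
    rwa [s.D_eq hx1 hq1, s.D_eq (s.region_mono (by norm_num) hz) hq1,
      φ.right_inv (s.ball_subset hx'), ← φ.left_inv hz.1, φ.right_inv (φ.map_source hz.1)] at this
  have h0 := hmax.hasFDerivAt_eq_zero hd
  rw [← neg_eq_zero, ← h0]
  abel

theorem differentiableAt_fderiv [IsManifold 𝓘(ℝ, E) ω M] (hη : IsSmall S b η)
    (s : DiastasisCell E V D) {x : E} (hx : x ∈ Metric.ball s.x₀ s.R) :
    DifferentiableAt ℝ (fderiv ℝ (η ∘ (chartAt E s.center).symm)) x :=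
  ((contDiffAt_comp_chart_symm hη.contMDiff (s.ball_subset hx)).fderiv_right (m := 1)
    (by norm_num)).differentiableAt (by simp)

theorem eq_of_critical [IsManifold 𝓘(ℝ, E) ω M] (hη : IsSmall S b η) {s : DiastasisCell E V D}
    (hs : s ∈ S) {x x' y : E} (hx : x ∈ Metric.ball s.x₀ s.R) (hx' : x' ∈ Metric.ball s.x₀ s.R)
    (hy : y ∈ Metric.ball s.x₀ s.R)
    (h : dfst s.d (x, y) + fderiv ℝ (η ∘ (chartAt E s.center).symm) x = 0)
    (h' : dfst s.d (x', y) + fderiv ℝ (η ∘ (chartAt E s.center).symm) x' = 0) : x = x' := by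
  have := s.isConvexCell.norm_sub_le_left (fun z hz => differentiableAt_fderiv hη s hz)
    (hη.fderiv_fderiv_le s hs) hx hx' hy
  rw [h, h', sub_zero, norm_zero] at this
  have ha := s.isConvexCell.a_pos
  have h1 : ‖x - x'‖ ≤ 0 := by
    by_contra! hlt
    nlinarith
  exact sub_eq_zero.1 (norm_le_zero_iff.1 h1)

theorem eq_of_isMaximizer [IsManifold 𝓘(ℝ, E) ω M] (hS : IsCellAtlas S b) (hη : IsSmall S b η)
    (hp : IsMaximizer V D η q p) (hz : IsMaximizer V D η q z) : p = z := by
  obtain ⟨s, hs, hq⟩ := hS.covers q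
  have hq' := s.region_mono (by norm_num : (1 / 4 : ℝ) ≤ 1 / 2) hq
  obtain ⟨h1, h2⟩ := hS.critical hη hp hs hq'
  obtain ⟨h3, h4⟩ := hS.critical hη hz hs hq'
  exact (chartAt E s.center).injOn h1.1 h3.1 (eq_of_critical hη hs (s.mem_ball (by norm_num) h1)
    (s.mem_ball (by norm_num) h3) (s.mem_ball (by norm_num) hq) h2 h4)

/-- In a cell around the common maximizer `z` both points solve `d_x(z, ·) = -dη(z)`, and `d_x(z,
·)` is expansive. -/
theorem eq_of_isMaximizer_right [IsManifold 𝓘(ℝ, E) ω M] (hS : IsCellAtlas S b)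
    (hη : IsSmall S b η) (hq : IsMaximizer V D η q z) (hp : IsMaximizer V D η p z) : q = p := by
  obtain ⟨s, hs, hz⟩ := hS.covers z
  have hq' := (hS.isClose_of_isMaximizer hη.abs_le hq).half s hs hz
  have hp' := (hS.isClose_of_isMaximizer hη.abs_le hp).half s hs hz
  have h1 := (hS.critical hη hq hs hq').2
  have h2 := (hS.critical hη hp hs hp').2
  have h3 := s.isConvexCell.norm_sub_le_right (s.mem_ball (by norm_num) hz)
    (s.mem_ball (by norm_num) hq') (s.mem_ball (by norm_num) hp')
  rw [eq_neg_of_add_eq_zero_left h1, eq_neg_of_add_eq_zero_left h2, sub_self, norm_zero] at h3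
  have ha := s.isConvexCell.a_pos
  have h4 : ‖chartAt E s.center q - chartAt E s.center p‖ ≤ 0 := by
    by_contra! hlt
    nlinarith
  exact (chartAt E s.center).injOn hq'.1 hp'.1 (sub_eq_zero.1 (norm_le_zero_iff.1 h4))

/-- Solve `d_x(z, y) = -dη(z)` for `y`. The critical point for this `y` is unique and the maximizer
is one, so the maximizer is `z`. With `z` in the quarter ball and `y` within `R / 4` of it, `y`
stays in the half ball where `critical` applies; this fixes the bound on `dη` in `IsSmall`. -/
theorem exists_isMaximizer_right [FiniteDimensional ℂ E] [IsManifold 𝓘(ℝ, E) ω M]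
    (hS : IsCellAtlas S b) (hη : IsSmall S b η) (z : M) : ∃ q, IsMaximizer V D η q z := by
  have : FiniteDimensional ℝ E := FiniteDimensional.complexToReal E
  obtain ⟨s, hs, hz⟩ := hS.covers z
  have hR := s.isConvexCell.R_pos
  set φ := chartAt E s.center
  have hx : φ z ∈ Metric.ball s.x₀ s.R := s.mem_ball (by norm_num) hz
  have hxz : dist (φ z) s.x₀ < 1 / 4 * s.R := hz.2
  obtain ⟨y, hy, hdy⟩ := s.isConvexCell.exists_dfst_eq (x := φ z) (ρ := s.R / 4)
    (ζ := -fderiv ℝ (η ∘ φ.symm) (φ z)) (by linarith)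
    (Metric.closedBall_subset_ball' (by linarith)) (by
      rw [norm_neg]; exact hη.fderiv_le s hs _ hx)
  have hy2 : y ∈ Metric.ball s.x₀ (1 / 2 * s.R) :=
    Metric.closedBall_subset_ball' (by linarith) hy
  have hyR : y ∈ Metric.ball s.x₀ s.R := Metric.ball_subset_ball (by linarith) hy2
  have hq : φ.symm y ∈ s.region (1 / 2) := (symm_mem_chartSet (s.ball_subset hyR)).2 hy2
  obtain ⟨p, hp⟩ := hS.exists_isMaximizer hη.abs_le hη.contMDiff.continuous (φ.symm y)
  obtain ⟨h1, h2⟩ := hS.critical hη hp hs hq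
  rw [φ.right_inv (s.ball_subset hyR)] at h2
  have hpz : p = z := φ.injOn h1.1 hz.1 (eq_of_critical hη hs (s.mem_ball (by norm_num) h1) hx hyR h2
    (by rw [hdy, neg_add_cancel]))
  exact ⟨φ.symm y, hpz ▸ hp⟩

/-- The map sending a point to the maximizer that defines the Legendre transform at this point. -/
theorem exists_equiv [FiniteDimensional ℂ E] [IsManifold 𝓘(ℝ, E) ω M]
    (hS : IsCellAtlas S b) (hη : IsSmall S b η) :
    ∃ G : M ≃ M, ∀ q, IsMaximizer V D η q (G q) := by
  choose g hg using hS.exists_isMaximizer hη.abs_le hη.contMDiff.continuous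
  refine ⟨Equiv.ofBijective g ⟨fun q q' h => ?_, fun z => ?_⟩, hg⟩
  · exact hS.eq_of_isMaximizer_right hη (hg q) (h ▸ hg q')
  · obtain ⟨q, hq⟩ := hS.exists_isMaximizer_right hη z
    exact ⟨q, hS.eq_of_isMaximizer hη (hg q) hq⟩

/-- From below compare with `p = q`; from above use `D ≥ 0`. The transform thus obeys the same bound
as `η`, which is all that `isMaximizer_symm` needs about its size. -/
theorem abs_value_le (hS : IsCellAtlas S b) (hη : ∀ p, |η p| ≤ b / 4)
    (h : IsMaximizer V D η q z) : |-D (z, q) - η z| ≤ b / 4 := by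
  have h1 := h.2 q (hS.diag q).1
  rw [(hS.diag q).2] at h1
  have h2 := abs_le.1 (hη q)
  have h3 := abs_le.1 (hη z)
  have h4 := (hS.isClose_of_isMaximizer hη h).nonneg
  exact abs_le.2 ⟨by linarith, by linarith⟩

/-- The Legendre transform is an involution: the maximizers of the transform of `η` are given by the
inverse map. -/
theorem isMaximizer_symm (hS : IsCellAtlas S b) (hη : ∀ p, |η p| ≤ b / 4) {G : M ≃ M}
    (hG : ∀ q, IsMaximizer V D η q (G q)) (hu : ∀ q p, IsMaximizer V D η q p → p = G q)
    (hψ : ∀ q, ψ q = -D (G q, q) - η (G q)) (p : M) :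
    IsMaximizer V D ψ p (G.symm p) ∧ η p = -D (G.symm p, p) - ψ (G.symm p) ∧
      ∀ q, IsMaximizer V D ψ p q → q = G.symm p := by
  have hψb : ∀ q, |ψ q| ≤ b / 4 := fun q => by
    rw [hψ q]; exact hS.abs_value_le hη (hG q)
  have hcl := hS.isClose_of_isMaximizer hη (hG (G.symm p))
  have hval : η p = -D (G.symm p, p) - ψ (G.symm p) := by
    rw [hψ, G.apply_symm_apply]
    rw [G.apply_symm_apply] at hcl
    rw [hcl.symm]
    ring
  rw [G.apply_symm_apply] at hcl
  -- For close points, symmetry of `D` turns `-D(p, q) - η(p) ≤ ψ(q)` into the inequality with the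
  -- roles exchanged. Equality means that `p` is a maximizer for `q`, that is `p = G q`.
  have hle : ∀ q, (q, p) ∈ V → D (q, p) < b → -D (q, p) - ψ q ≤ η p ∧
      (-D (q, p) - ψ q = η p → q = G.symm p) := by
    intro q hqp hlt
    have hc := hS.isClose q p hqp hlt
    have h1 := (hG q).2 p hc.mem_swap
    rw [← hψ q, hc.symm] at h1
    refine ⟨by linarith, fun heq => ?_⟩
    have : IsMaximizer V D η q p := ⟨hc.mem_swap, fun p' hp' => ?_⟩
    · rw [hu q p this, G.symm_apply_apply]
    · have h2 := (hG q).2 p' hp'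
      rw [← hψ q] at h2
      rw [hc.symm]
      linarith
  have hmax : IsMaximizer V D ψ p (G.symm p) := by
    refine ⟨hcl.mem_swap, fun q hq => ?_⟩
    rw [← hval]
    by_cases hlt : D (q, p) < b
    · exact (hle q hq hlt).1
    -- Distant points have values at most `-b + b / 4`, below `-b / 4 ≤ η p`.
    · have h2 := abs_le.1 (hψb q)
      have h3 := abs_le.1 (hη p)
      linarith [hS.b_pos]
  refine ⟨hmax, hval, fun q hq => ?_⟩
  refine (hle q hq.1 (hS.lt_of_le hψb (hq.2 p (hS.diag p).1))).2 (le_antisymm ?_ ?_)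
  · rw [hval]; exact hmax.2 q hq.1
  · rw [hval]; exact hq.2 _ hmax.1

end IsCellAtlas

end CalabiLegendre

end

/-! ### Regularity of the maximizers and of the transform -/

noncomputable section

set_option maxSynthPendingDepth 3

namespace CalabiLegendre

variable {E : Type*} [NormedAddCommGroup E] [NormedSpace ℂ E]
  {M : Type*} [TopologicalSpace M] [ChartedSpace E M] {V : Set (M × M)} {D : M × M → ℝ}

theorem contMDiffAt_of_comp_chart_symm [IsManifold 𝓘(ℝ, E) ω M] {n : WithTop ℕ∞} {F : Type*}
    [NormedAddCommGroup F] [NormedSpace ℝ F] {f : M → F} {c p : M} {B : Set E} (hB : IsOpen B)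
    (hf : ContDiffOn ℝ n (f ∘ (chartAt E c).symm) B)
    (hp : p ∈ chartSet c B) : ContMDiffAt 𝓘(ℝ, E) 𝓘(ℝ, F) n f p := by
  have : IsManifold 𝓘(ℝ, E) n M := IsManifold.of_le (n := ω) le_top
  have h1 : ContMDiffOn 𝓘(ℝ, E) 𝓘(ℝ, E) n (chartAt E c) (chartSet c B) :=
    (contMDiffOn_chart (I := 𝓘(ℝ, E)) (n := n) (x := c)).mono fun _ h => h.1
  have h2 := (contMDiffOn_iff_contDiffOn.2 hf).comp h1 fun q hq => hq.2
  refine (h2.congr fun q hq => ?_).contMDiffAt ((isOpen_chartSet c hB).mem_nhds hp)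
  simp only [Function.comp_apply, (chartAt E c).left_inv hq.1]

theorem contMDiffAt_of_chart_comp_chart_symm [IsManifold 𝓘(ℝ, E) ω M] {n : WithTop ℕ∞} {f : M → M}
    {c p : M} {B : Set E} (hB : IsOpen B)
    (hfs : ∀ q ∈ chartSet c B, f q ∈ (chartAt E c).source)
    (hf : ContDiffOn ℝ n (fun x => chartAt E c (f ((chartAt E c).symm x))) B)
    (hp : p ∈ chartSet c B) : ContMDiffAt 𝓘(ℝ, E) 𝓘(ℝ, E) n f p := by
  have : IsManifold 𝓘(ℝ, E) n M := IsManifold.of_le (n := ω) le_top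
  have h1 : ContMDiffAt 𝓘(ℝ, E) 𝓘(ℝ, E) n (fun q => chartAt E c (f q)) p :=
    contMDiffAt_of_comp_chart_symm hB hf hp
  have h2 : ContMDiffAt 𝓘(ℝ, E) 𝓘(ℝ, E) n (chartAt E c).symm (chartAt E c (f p)) :=
    (contMDiffOn_chart_symm (I := 𝓘(ℝ, E)) (n := n) (x := c)).contMDiffAt
      ((chartAt E c).open_target.mem_nhds ((chartAt E c).map_source (hfs p hp)))
  refine (h2.comp p h1).congr_of_eventuallyEq ?_
  filter_upwards [(isOpen_chartSet c hB).mem_nhds hp] with q hq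
  simp only [Function.comp_apply, (chartAt E c).left_inv (hfs q hq)]

section Family

variable {P : Type*} [TopologicalSpace P] {S : Finset (DiastasisCell E V D)} {b : ℝ}

theorem paramContDiffOn_fderiv {F : Type*} [NormedAddCommGroup F] [NormedSpace ℝ F] {n : ℕ}
    {f : P → F → ℝ} {B : Set F} (hB : IsOpen B)
    (hd : ∀ t, ContDiffOn ℝ (n + 1 : ℕ) (f t) B) (hc : ∀ j ≤ n + 1, ContinuousOn
      (fun z : P × F => iteratedFDeriv ℝ j (f z.1) z.2) {z | z.2 ∈ B}) :
    ParamContDiffOn n (fun t x => fderiv ℝ (f t) x) {z : P × F | z.2 ∈ B} := by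
  refine ParamContDiffOn.of_iteratedFDeriv (hB.preimage continuous_snd) (fun t => ?_)
    fun j hj => ?_
  · exact (hd t).fderiv_of_isOpen hB (by simp)
  · refine ((continuousMultilinearCurryRightEquiv' ℝ j F ℝ).continuous.comp_continuousOn
      (hc (j + 1) (by omega))).congr fun z _ => ?_
    rw [Function.comp_apply, iteratedFDeriv_succ_eq_comp_right, Function.comp_apply]
    exact (LinearIsometryEquiv.apply_symm_apply _ _).symm

namespace IsCellAtlas

variable [FiniteDimensional ℂ E] [IsManifold 𝓘(ℝ, E) ω M] {η : P → M → ℝ} {G : P → M ≃ M}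
  {s : DiastasisCell E V D} {n : ℕ}

/-- Regularity of the maximizers, of the maximal value, and of the inverse of the map of
maximizers, for a family of functions. -/
theorem family_regularity (hS : IsCellAtlas S b) (hη : ∀ t, IsSmall S b (η t))
    (hG : ∀ t q, IsMaximizer V D (η t) q (G t q)) (hs : s ∈ S) (hn : n ≠ 0)
    (hd : ∀ t, ContMDiff 𝓘(ℝ, E) 𝓘(ℝ, ℝ) (n + 1 : ℕ) (η t))
    (hc : ∀ j ≤ n + 1, ContinuousOn
      (fun z : P × E => iteratedFDeriv ℝ j (η z.1 ∘ (chartAt E s.center).symm) z.2)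
      {z | z.2 ∈ Metric.ball s.x₀ s.R}) :
    ((∀ t, ContDiffOn ℝ n (fun y => chartAt E s.center (G t ((chartAt E s.center).symm y)))
      (Metric.ball s.x₀ (1 / 2 * s.R))) ∧
    (∀ t, ContDiffOn ℝ n (fun y => chartAt E s.center ((G t).symm ((chartAt E s.center).symm y)))
      (Metric.ball s.x₀ (1 / 4 * s.R)))) ∧
    (∀ t, ContDiffOn ℝ (n + 1 : ℕ) ((fun q => -D (G t q, q) - η t (G t q)) ∘
      (chartAt E s.center).symm) (Metric.ball s.x₀ (1 / 2 * s.R))) ∧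
    ∀ j ≤ n + 1, ContinuousOn (fun z : P × E => iteratedFDeriv ℝ j
      ((fun q => -D (G z.1 q, q) - η z.1 (G z.1 q)) ∘ (chartAt E s.center).symm) z.2)
      {z | z.2 ∈ Metric.ball s.x₀ (1 / 2 * s.R)} := by
  have : FiniteDimensional ℝ E := FiniteDimensional.complexToReal E
  have hR := s.isConvexCell.R_pos
  set φ := chartAt E s.center
  have hfd : ∀ t, ContDiffOn ℝ (n + 1 : ℕ) (η t ∘ φ.symm) (Metric.ball s.x₀ s.R) := fun t =>
    (contDiffOn_comp_chart_symm (hd t) s.center).mono s.ball_subset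
  have hξ := paramContDiffOn_fderiv (P := P) Metric.isOpen_ball hfd hc
  have hξ' : ∀ t, ∀ x ∈ Metric.ball s.x₀ s.R, ‖fderiv ℝ (fderiv ℝ (η t ∘ φ.symm)) x‖ ≤ s.a / 2 :=
    fun t => (hη t).fderiv_fderiv_le s hs
  have hfx : ∀ t, ∀ x ∈ Metric.ball s.x₀ s.R, DifferentiableAt ℝ (η t ∘ φ.symm) x := fun t x hx =>
    ((hfd t).contDiffAt (Metric.isOpen_ball.mem_nhds hx)).differentiableAt (by simp)
  have hfc : ContinuousOn (fun z : P × E => (η z.1 ∘ φ.symm) z.2)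
      {z | z.2 ∈ Metric.ball s.x₀ s.R} :=
    ((ContinuousMultilinearMap.apply ℝ (fun _ : Fin 0 => E) ℝ
      0).continuous.comp_continuousOn (hc 0 (Nat.zero_le _))).congr fun z _ => by simp
  have hsub : ∀ t : ℝ, t ≤ 1 → Metric.ball s.x₀ (t * s.R) ⊆ Metric.ball s.x₀ s.R := fun t ht =>
    Metric.ball_subset_ball (by nlinarith)
  have hreg : ∀ t : ℝ, t ≤ 1 → ∀ y ∈ Metric.ball s.x₀ (t * s.R), φ.symm y ∈ s.region t :=
    fun t ht y hy => (symm_mem_chartSet (s.ball_subset (hsub t ht hy))).2 hy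
  have hcrit : ∀ t, ∀ y ∈ Metric.ball s.x₀ (1 / 2 * s.R), G t (φ.symm y) ∈ s.region (3 / 4) ∧
      dfst s.d (φ (G t (φ.symm y)), y) + fderiv ℝ (η t ∘ φ.symm) (φ (G t (φ.symm y))) = 0 := by
    intro t y hy
    have := hS.critical (hη t) (hG t (φ.symm y)) hs (hreg _ (by norm_num) y hy)
    rwa [φ.right_inv (s.ball_subset (hsub _ (by norm_num) hy))] at this
  -- The inverse map solves the same equation, now with `x` given and `y` unknown. Closeness sends
  -- the quarter region to the half region, where `critical` applies, so the inverse is controlled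
  -- on a smaller ball than `G`.
  have hcrit' : ∀ t, ∀ x ∈ Metric.ball s.x₀ (1 / 4 * s.R),
      (G t).symm (φ.symm x) ∈ s.region (1 / 2) ∧
      dfst s.d (x, φ ((G t).symm (φ.symm x))) + fderiv ℝ (η t ∘ φ.symm) x = 0 := by
    intro t x hx
    have hxr := hreg _ (by norm_num) x hx
    have h1 := hG t ((G t).symm (φ.symm x))
    rw [(G t).apply_symm_apply] at h1
    have h2 := (hS.isClose_of_isMaximizer (hη t).abs_le h1).half s hs hxr
    have h3 := (hS.critical (hη t) h1 hs h2).2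
    rw [φ.right_inv (s.ball_subset (hsub _ (by norm_num) hx))] at h3
    exact ⟨h2, h3⟩
  have hO : IsOpen {z : P × E | z.2 ∈ Metric.ball s.x₀ (1 / 2 * s.R)} :=
    Metric.isOpen_ball.preimage continuous_snd
  have hO' : IsOpen {z : P × E | z.2 ∈ Metric.ball s.x₀ (1 / 4 * s.R)} :=
    Metric.isOpen_ball.preimage continuous_snd
  have hgl := s.isConvexCell.paramContDiffOn_solution_left (P := P)
    (g := fun t y => φ (G t (φ.symm y))) hn hξ hξ' hO (fun z hz => hsub _ (by norm_num) hz)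
    (fun z hz => s.mem_ball (by norm_num) (hcrit z.1 z.2 hz).1) (fun z hz => (hcrit z.1 z.2 hz).2)
  have hgr := s.isConvexCell.paramContDiffOn_solution_right (P := P)
    (g := fun t x => φ ((G t).symm (φ.symm x))) hn hξ hO' (fun z hz => hsub _ (by norm_num) hz)
    (fun z hz => s.mem_ball (by norm_num) (hcrit' z.1 z.2 hz).1)
    (fun z hz => (hcrit' z.1 z.2 hz).2)
  obtain ⟨hv1, hv2⟩ := s.isConvexCell.continuousOn_iteratedFDeriv_criticalValue (P := P)
    (g := fun t y => φ (G t (φ.symm y))) hn hfx hfc hξ hξ' hO (fun z hz => hsub _ (by norm_num) hz)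
    (fun z hz => s.mem_ball (by norm_num) (hcrit z.1 z.2 hz).1) (fun z hz => (hcrit z.1 z.2 hz).2)
  have hval : ∀ t, ∀ y ∈ Metric.ball s.x₀ (1 / 2 * s.R),
      ((fun q => -D (G t q, q) - η t (G t q)) ∘ φ.symm) y =
      -s.d (φ (G t (φ.symm y)), y) - (η t ∘ φ.symm) (φ (G t (φ.symm y))) := by
    intro t y hy
    have h1 := (hcrit t y hy).1
    simp only [Function.comp_apply]
    rw [φ.left_inv h1.1, s.D_eq (s.region_mono (by norm_num) h1)
      (s.region_mono (by norm_num) (hreg _ (by norm_num) y hy)),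
      φ.right_inv (s.ball_subset (hsub _ (by norm_num) hy))]
  refine ⟨⟨fun t => hgl.contDiffOn hO t, fun t => hgr.contDiffOn hO' t⟩,
    fun t => (hv1 t).congr (hval t), fun j hj => (hv2 j hj).congr fun z hz => ?_⟩
  refine Filter.EventuallyEq.eq_of_nhds (Filter.EventuallyEq.iteratedFDeriv ℝ ?_ j)
  filter_upwards [Metric.isOpen_ball.mem_nhds hz] with y hy using hval z.1 y hy

end IsCellAtlas

end Family

variable {S : Finset (DiastasisCell E V D)} {b : ℝ}

/-- Regularity of the maximizers and of the maximal value. -/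
theorem IsCellAtlas.contMDiff [FiniteDimensional ℂ E] [IsManifold 𝓘(ℝ, E) ω M]
    (hS : IsCellAtlas S b) {η : M → ℝ} (hη : IsSmall S b η) {G : M ≃ M}
    (hG : ∀ q, IsMaximizer V D η q (G q)) {n : ℕ} (hn : n ≠ 0)
    (hd : ContMDiff 𝓘(ℝ, E) 𝓘(ℝ, ℝ) (n + 1 : ℕ) η) :
    ContMDiff 𝓘(ℝ, E) 𝓘(ℝ, E) n G ∧ ContMDiff 𝓘(ℝ, E) 𝓘(ℝ, E) n G.symm ∧
      ContMDiff 𝓘(ℝ, E) 𝓘(ℝ, ℝ) (n + 1 : ℕ) fun q => -D (G q, q) - η (G q) := by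
  -- A single function is a family over a one-point parameter space.
  have hreg : ∀ s ∈ S, _ := fun s hs => hS.family_regularity (P := Unit) (η := fun _ => η)
    (G := fun _ => G) (fun _ => hη) (fun _ => hG) hs hn (fun _ => hd) fun j hj => by
      have h1 := ((contDiffOn_comp_chart_symm hd s.center).mono
        s.ball_subset).continuousOn_iteratedFDerivWithin
          (by exact_mod_cast hj : (j : WithTop ℕ∞) ≤ (n + 1 : ℕ)) Metric.isOpen_ball.uniqueDiffOn
      exact (h1.congr fun x hx => (iteratedFDerivWithin_of_isOpen j Metric.isOpen_ball hx).symm).comp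
        continuousOn_snd fun z hz => hz
  refine ⟨fun q => ?_, fun q => ?_, fun q => ?_⟩ <;> obtain ⟨s, hs, hq⟩ := hS.covers q <;>
    obtain ⟨⟨h1, h2⟩, h3, -⟩ := hreg s hs
  · exact contMDiffAt_of_chart_comp_chart_symm Metric.isOpen_ball
      (fun q hq => (hS.critical hη (hG q) hs hq).1.1) (h1 ())
      (s.region_mono (by norm_num) hq)
  · refine contMDiffAt_of_chart_comp_chart_symm Metric.isOpen_ball
      (fun q hq => ?_) (h2 ()) hq
    have h4 := hG (G.symm q)
    rw [G.apply_symm_apply] at h4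
    exact ((hS.isClose_of_isMaximizer hη.abs_le h4).half s hs hq).1
  · exact contMDiffAt_of_comp_chart_symm Metric.isOpen_ball (h3 ())
      (s.region_mono (by norm_num) hq)

end CalabiLegendre

end

/-! ### Continuity in the `C^k` topology and assembly -/

noncomputable section

set_option maxSynthPendingDepth 3

namespace CalabiLegendre

variable {E : Type*} [NormedAddCommGroup E] [NormedSpace ℂ E]
  {M : Type*} [TopologicalSpace M] [ChartedSpace E M] {V : Set (M × M)} {D : M × M → ℝ}

/-- The small functions of class `C^k`. -/
def SmallFunction (_ : ChartCover E M) (S : Finset (DiastasisCell E V D)) (b : ℝ) (k : ℕ) : Type _ :=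
  {η : M → ℝ // IsSmall S b η ∧ ContMDiff 𝓘(ℝ, E) 𝓘(ℝ, ℝ) k η}

variable {𝒦 : ChartCover E M} {S : Finset (DiastasisCell E V D)} {b : ℝ} {k : ℕ}

namespace SmallFunction

/-- The functions serve as a topological parameter space only, so an extended pseudo-distance is
enough; neither finiteness nor separation of the norm is required. -/
instance [IsManifold 𝓘(ℝ, E) ω M] : PseudoEMetricSpace (SmallFunction 𝒦 S b k) where
  edist η η' := 𝒦.cNorm k (η.1 - η'.1)
  edist_self η := by simp only [sub_self]; exact 𝒦.cNorm_zero k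
  edist_comm η η' := 𝒦.cNorm_sub_comm k η.1 η'.1
  edist_triangle η₁ η₂ η₃ := by
    have := 𝒦.cNorm_add_le (η₁.2.2.sub η₂.2.2) (η₂.2.2.sub η₃.2.2)
    rwa [show (fun x => η₁.1 x - η₂.1 x) + (fun x => η₂.1 x - η₃.1 x) = η₁.1 - η₃.1 by
      ext x; simp] at this

/-- The derivatives in a chart depend continuously on the point and the function. -/
theorem continuousOn_iteratedFDeriv [IsManifold 𝓘(ℂ, E) ω M] [IsManifold 𝓘(ℝ, E) ω M] [T2Space M]
    (c : M) {j : ℕ} (hj : j ≤ k) :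
    ContinuousOn (fun z : SmallFunction 𝒦 S b k × E =>
      iteratedFDeriv ℝ j (z.1.1 ∘ (chartAt E c).symm) z.2) {z | z.2 ∈ (chartAt E c).target} := by
  rintro ⟨η₀, x₀⟩ hx₀
  refine ContinuousAt.continuousWithinAt ?_
  have hj' : (j : WithTop ℕ∞) ≤ k := by exact_mod_cast hj
  have hto := (chartAt E c).open_target
  obtain ⟨A, hA, hev⟩ := 𝒦.exists_iteratedFDeriv_le_cNorm k ((chartAt E c).map_target hx₀)
  have hcont : ContinuousAt (fun x => iteratedFDeriv ℝ j (η₀.1 ∘ (chartAt E c).symm) x) x₀ :=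
    (((contDiffOn_comp_chart_symm η₀.2.2 c).continuousOn_iteratedFDerivWithin hj'
      hto.uniqueDiffOn).congr fun x hx =>
        (iteratedFDerivWithin_of_isOpen j hto hx).symm).continuousAt (hto.mem_nhds hx₀)
  -- Half of `ε` is for changing the function, uniformly near `x₀` by the bound with `A`, and half
  -- for moving the point with `η₀` fixed.
  refine Metric.tendsto_nhds.2 fun ε hε => ?_
  have h1 : ∀ᶠ η : SmallFunction 𝒦 S b k in 𝓝 η₀,
      edist η η₀ < ENNReal.ofReal (ε / (2 * A)) :=
    Metric.eball_mem_nhds _ (ENNReal.ofReal_pos.2 (by positivity))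
  have h2 := ((chartAt E c).continuousAt_symm hx₀).eventually hev
  have h3 := Metric.tendsto_nhds.1 hcont (ε / 2) (half_pos hε)
  filter_upwards [h1.prod_nhds ((h2.and h3).and (hto.mem_nhds hx₀))] with z hz
  obtain ⟨hz1, ⟨hz2, hz3⟩, hz4⟩ := hz
  have h4 := hz2 (z.1.1 - η₀.1) (z.1.2.2.sub η₀.2.2) (ε / (2 * A)) (by positivity) hz1.le j hj
  rw [(chartAt E c).right_inv hz4] at h4
  have h5 : (z.1.1 - η₀.1) ∘ (chartAt E c).symm =
    z.1.1 ∘ (chartAt E c).symm - η₀.1 ∘ (chartAt E c).symm := rfl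
  rw [h5, iteratedFDeriv_sub_apply ((contDiffAt_comp_chart_symm z.1.2.2 hz4).of_le hj')
    ((contDiffAt_comp_chart_symm η₀.2.2 hz4).of_le hj'), ← dist_eq_norm] at h4
  have h6 : A * (ε / (2 * A)) = ε / 2 := by field_simp
  rw [h6] at h4
  change dist (iteratedFDeriv ℝ j (η₀.1 ∘ (chartAt E c).symm) z.2) _ < _ at hz3
  have h7 := dist_triangle (iteratedFDeriv ℝ j (z.1.1 ∘ (chartAt E c).symm) z.2)
    (iteratedFDeriv ℝ j (η₀.1 ∘ (chartAt E c).symm) z.2)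
    (iteratedFDeriv ℝ j (η₀.1 ∘ (chartAt E c).symm) x₀)
  change dist (iteratedFDeriv ℝ j (z.1.1 ∘ (chartAt E c).symm) z.2)
    (iteratedFDeriv ℝ j (η₀.1 ∘ (chartAt E c).symm) x₀) < ε
  linarith

end SmallFunction

/-- The maximal value depends continuously on the function in the `C^k` topology. -/
theorem IsCellAtlas.eventually_cNorm_le [FiniteDimensional ℂ E] [IsManifold 𝓘(ℂ, E) ω M]
    [IsManifold 𝓘(ℝ, E) ω M] [T2Space M] {n : ℕ} (hn : n ≠ 0) (hS : IsCellAtlas S b)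
    (hK : ∀ c ∈ 𝒦.centers, ∀ p ∈ 𝒦.K c, ∃ s ∈ S, s.center = c ∧ p ∈ s.region (1 / 4))
    {G : SmallFunction 𝒦 S b (n + 1) → M ≃ M} (hG : ∀ η q, IsMaximizer V D η.1 q (G η q))
    (η₀ : SmallFunction 𝒦 S b (n + 1)) {δ : ℝ} (hδ : 0 < δ) :
    ∀ᶠ η in 𝓝 η₀, 𝒦.cNorm (n + 1) ((fun q => -D (G η q, q) - η.1 (G η q)) -
      fun q => -D (G η₀ q, q) - η₀.1 (G η₀ q)) ≤ ENNReal.ofReal δ := by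
  set L : SmallFunction 𝒦 S b (n + 1) → M → ℝ := fun η q => -D (G η q, q) - η.1 (G η q)
  have hL : ∀ η, ContMDiff 𝓘(ℝ, E) 𝓘(ℝ, ℝ) (n + 1 : ℕ) (L η) := fun η =>
    (hS.contMDiff η.2.1 (hG η) hn η.2.2).2.2
  have key : ∀ c ∈ 𝒦.centers, ∀ᶠ η in 𝓝 η₀, ∀ p ∈ 𝒦.K c, ∀ j ∈ Finset.range (n + 2),
      ‖iteratedFDeriv ℝ j ((L η - L η₀) ∘ (chartAt E c).symm) (chartAt E c p)‖ ≤ δ := by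
    intro c hc
    -- By compactness of `K c` it suffices to have the estimate for pairs near each `(η₀, p)`, which
    -- is joint continuity.
    refine (𝒦.isCompact c hc).eventually_forall_of_forall_eventually fun p hp =>
      (Filter.eventually_all_finset _).2 fun j hj => ?_
    have hj : j ≤ n + 1 := Nat.lt_succ_iff.1 (Finset.mem_range.1 hj)
    have hj' : (j : WithTop ℕ∞) ≤ (n + 1 : ℕ) := by exact_mod_cast hj
    obtain ⟨s, hs, rfl, hps⟩ := hK c hc p hp
    set φ := chartAt E s.center
    have hcont := (hS.family_regularity (P := SmallFunction 𝒦 S b (n + 1)) (η := fun η => η.1)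
      (fun η => η.2.1) hG hs hn (fun η => η.2.2) fun j hj =>
        (SmallFunction.continuousOn_iteratedFDeriv s.center hj).mono fun z hz =>
          s.ball_subset hz).2.2 j hj
    have hpb : φ p ∈ Metric.ball s.x₀ (1 / 2 * s.R) := (s.region_mono (by norm_num) hps).2
    have hat : ∀ η : SmallFunction 𝒦 S b (n + 1), ContinuousAt (fun z : _ × E => iteratedFDeriv ℝ j
        (L z.1 ∘ φ.symm) z.2) (η, φ p) := fun η => hcont.continuousAt
          ((Metric.isOpen_ball.preimage continuous_snd).mem_nhds hpb)
    -- Subtracting the derivative for `η₀` at the same moving point gives a jointly continuous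
    -- function that vanishes at `(η₀, φ p)`.
    have hd0 : ContinuousAt (fun z : SmallFunction 𝒦 S b (n + 1) × E =>
        iteratedFDeriv ℝ j (L z.1 ∘ φ.symm) z.2 - iteratedFDeriv ℝ j (L η₀ ∘ φ.symm) z.2)
        (η₀, φ p) := by
      refine (hat η₀).sub (ContinuousAt.comp (f := fun z : SmallFunction 𝒦 S b (n + 1) × E =>
        (η₀, z.2)) (x := (η₀, φ p)) (hat η₀) ?_)
      fun_prop
    have h1 := Metric.tendsto_nhds.1 hd0.tendsto δ hδ
    have h2 : Filter.Tendsto (fun z : SmallFunction 𝒦 S b (n + 1) × M => (z.1, φ z.2))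
        (𝓝 (η₀, p)) (𝓝 (η₀, φ p)) :=
      continuousAt_fst.prodMk (ContinuousAt.comp (f := Prod.snd) (x := (η₀, p))
        (φ.continuousAt hps.1) continuousAt_snd)
    have h3 : ∀ᶠ z : SmallFunction 𝒦 S b (n + 1) × M in 𝓝 (η₀, p), z.2 ∈ φ.source :=
      continuousAt_snd.eventually (φ.open_source.mem_nhds hps.1)
    filter_upwards [h2.eventually h1, h3] with z hz hzs
    have hzt := φ.map_source hzs
    have h4 : (L z.1 - L η₀) ∘ φ.symm = L z.1 ∘ φ.symm - L η₀ ∘ φ.symm := rfl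
    rw [h4, iteratedFDeriv_sub_apply ((contDiffAt_comp_chart_symm (hL z.1) hzt).of_le hj')
      ((contDiffAt_comp_chart_symm (hL η₀) hzt).of_le hj')]
    simpa using hz.le
  filter_upwards [(Filter.eventually_all_finset _).2 key] with η hη
  refine 𝒦.cNorm_le_iff.2 fun c hc p hp j hj => ?_
  rw [← ofReal_norm]
  exact ENNReal.ofReal_le_ofReal (hη c hc p hp j (Finset.mem_range.2 (by omega)))

/-- Functions that are small in the `C²` norm are small on the cells of an atlas. -/
theorem IsCellAtlas.exists_isSmall (hS : IsCellAtlas S b)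
    (hA : ∀ s ∈ S, ∃ A : ℝ, 0 < A ∧ s.IsBounded 𝒦 A) : ∃ ε : ℝ, 0 < ε ∧ ∀ η : M → ℝ,
      ContMDiff 𝓘(ℝ, E) 𝓘(ℝ, ℝ) 2 η → 𝒦.cNorm 2 η < ENNReal.ofReal ε → IsSmall S b η := by
  have h : ∀ s : DiastasisCell E V D, ∃ ε : ℝ, 0 < ε ∧ (s ∈ S → ∀ η : M → ℝ,
      ContMDiff 𝓘(ℝ, E) 𝓘(ℝ, ℝ) 2 η → 𝒦.cNorm 2 η ≤ ENNReal.ofReal ε →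
      ∀ x ∈ Metric.ball s.x₀ s.R, ∀ j ≤ 2,
        ‖iteratedFDeriv ℝ j (η ∘ (chartAt E s.center).symm) x‖ ≤
          min (b / 4) (min (s.a / 2 * (s.R / 4)) (s.a / 2))) := by
    intro s
    by_cases hs : s ∈ S
    · obtain ⟨A, hA0, hAs⟩ := hA s hs
      have ha := s.isConvexCell.a_pos
      have hR := s.isConvexCell.R_pos
      have hb := hS.b_pos
      have hm : 0 < min (b / 4) (min (s.a / 2 * (s.R / 4)) (s.a / 2)) :=
        lt_min (by positivity) (lt_min (by positivity) (by positivity))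
      -- The minimum of the three bounds in `IsSmall`, divided by the constant `A` of the cell, is a
      -- norm bound that serves for orders `0`, `1` and `2` at once.
      refine ⟨_, div_pos hm hA0, fun _ η hη hle x hx j hj => ?_⟩
      have := hAs η hη _ (div_pos hm hA0).le hle x hx j hj
      rwa [mul_div_cancel₀ _ hA0.ne'] at this
    · exact ⟨1, one_pos, fun h => absurd h hs⟩
  choose e he hes using h
  obtain ⟨ε, hε, hεS⟩ := exists_pos_le_of_finset S he
  refine ⟨ε, hε, fun η hη hle => ?_⟩
  have key := fun s hs => hes s hs η hη (hle.le.trans (ENNReal.ofReal_le_ofReal (hεS s hs)))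
  refine ⟨hη, fun p => ?_, fun s hs x hx => ?_, fun s hs x hx => ?_⟩
  · obtain ⟨s, hs, hp⟩ := hS.covers p
    have := (key s hs _ (s.mem_ball (by norm_num) hp) 0 (by norm_num)).trans (min_le_left _ _)
    rwa [norm_iteratedFDeriv_zero, Function.comp_apply, (chartAt E s.center).left_inv hp.1] at this
  · have := (key s hs x hx 1 (by norm_num)).trans ((min_le_right _ _).trans (min_le_left _ _))
    rwa [norm_iteratedFDeriv_one] at this
  · have := (key s hs x hx 2 le_rfl).trans ((min_le_right _ _).trans (min_le_right _ _))
    rwa [← norm_iteratedFDeriv_fderiv, norm_iteratedFDeriv_one] at this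

/-- The Legendre transform of a small function is the maximal value. -/
theorem IsCellAtlas.legendre_eq [FiniteDimensional ℂ E] [IsManifold 𝓘(ℝ, E) ω M]
    (hS : IsCellAtlas S b) {η : M → ℝ} (hη : IsSmall S b η) {G : M ≃ M}
    (hG : ∀ q, IsMaximizer V D η q (G q)) :
    legendre V D (toE η) = toE fun q => -D (G q, q) - η (G q) :=
  legendre_eq_toE hG (fun _ => rfl)
    (hS.contMDiff hη hG one_ne_zero (by exact_mod_cast hη.contMDiff)).2.2.continuous

theorem legendreReal_eq {η f : M → ℝ} (h : legendre V D (toE η) = toE f) :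
    legendreReal V D η = f := by
  funext q
  rw [legendreReal, h, toE, EReal.toReal_coe]

theorem IsCellAtlas.exists_transform [FiniteDimensional ℂ E] [IsManifold 𝓘(ℝ, E) ω M]
    (hS : IsCellAtlas S b) {η : M → ℝ} (hη : IsSmall S b η) : ∃ G : M ≃ M,
      (∀ q : M, IsUniqueMaximizer V D (toE η) q (G q)) ∧
      (∀ q : M, legendre V D (toE η) q = ((-D (G q, q) - η (G q) : ℝ) : EReal)) ∧
      (∀ k : ℕ, 2 ≤ k → ContMDiff 𝓘(ℝ, E) 𝓘(ℝ, ℝ) k η →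
        (∃ Φ : Diffeomorph 𝓘(ℝ, E) 𝓘(ℝ, E) M M ((k - 1 : ℕ) : WithTop ℕ∞), Φ.toEquiv = G) ∧
        ContMDiff 𝓘(ℝ, E) 𝓘(ℝ, ℝ) k (legendreReal V D η)) ∧
      legendre V D (legendre V D (toE η)) = toE η ∧
      (∀ q : M, IsUniqueMaximizer V D (legendre V D (toE η)) q (G.symm q)) := by
  obtain ⟨G, hG⟩ := hS.exists_equiv hη
  have hu : ∀ q p, IsMaximizer V D η q p → p = G q := fun q p hp =>
    hS.eq_of_isMaximizer hη hp (hG q)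
  have hL := hS.legendre_eq hη hG
  have hinv := hS.isMaximizer_symm hη.abs_le hG hu (fun _ => rfl)
  refine ⟨G, fun q => (hG q).isUniqueMaximizer (hu q), fun q => by rw [hL]; rfl,
    fun k hk hηk => ?_, ?_, fun q => ?_⟩
  · obtain ⟨n, rfl⟩ : ∃ n, k = n + 1 := ⟨k - 1, by omega⟩
    obtain ⟨h1, h2, h3⟩ := hS.contMDiff hη hG (by omega : n ≠ 0) hηk
    exact ⟨⟨⟨G, h1, h2⟩, rfl⟩, by rw [legendreReal_eq hL]; exact h3⟩
  · rw [hL]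
    -- The second transform has maximizers `G⁻¹` and values `η`. Only continuity of `η` enters, so
    -- the `C²` size of the first transform plays no role.
    exact legendre_eq_toE (fun q => (hinv q).1) (fun q => (hinv q).2.1) hη.contMDiff.continuous
  · rw [hL]
    exact (hinv q).1.isUniqueMaximizer (hinv q).2.2

/-- The Legendre transform is continuous in the `C^k` topology on small functions. -/
theorem IsCellAtlas.exists_cNorm_lt [FiniteDimensional ℂ E] [IsManifold 𝓘(ℂ, E) ω M]
    [IsManifold 𝓘(ℝ, E) ω M] [T2Space M] (hS : IsCellAtlas S b)
    (hK : ∀ c ∈ 𝒦.centers, ∀ p ∈ 𝒦.K c, ∃ s ∈ S, s.center = c ∧ p ∈ s.region (1 / 4))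
    {k : ℕ} (hk : 2 ≤ k) {η : M → ℝ} (hη : IsSmall S b η)
    (hηk : ContMDiff 𝓘(ℝ, E) 𝓘(ℝ, ℝ) k η) {δ : ℝ} (hδ : 0 < δ) :
    ∃ δ' : ℝ, 0 < δ' ∧ ∀ η' : M → ℝ, IsSmall S b η' → ContMDiff 𝓘(ℝ, E) 𝓘(ℝ, ℝ) k η' →
      𝒦.cNorm k (η' - η) < ENNReal.ofReal δ' →
      𝒦.cNorm k (legendreReal V D η' - legendreReal V D η) < ENNReal.ofReal δ := by
  obtain ⟨n, rfl⟩ : ∃ n, k = n + 1 := ⟨k - 1, by omega⟩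
  choose G hG using fun η : SmallFunction 𝒦 S b (n + 1) => hS.exists_equiv η.2.1
  -- The estimate is not strict; `δ / 2` makes room for the strict inequality.
  have hev := hS.eventually_cNorm_le (by omega) hK hG ⟨η, hη, hηk⟩ (half_pos hδ)
  obtain ⟨e, he, hball⟩ := EMetric.mem_nhds_iff.1 hev
  obtain ⟨r, hr, hre⟩ := ENNReal.lt_iff_exists_nnreal_btwn.1 he
  refine ⟨r, by exact_mod_cast hr, fun η' hη' hηk' hlt => ?_⟩
  rw [ENNReal.ofReal_coe_nnreal] at hlt
  have := @hball ⟨η', hη', hηk'⟩ (hlt.trans hre)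
  rw [legendreReal_eq (hS.legendre_eq hη' (hG ⟨η', hη', hηk'⟩)),
    legendreReal_eq (hS.legendre_eq hη (hG ⟨η, hη, hηk⟩))]
  exact lt_of_le_of_lt this ((ENNReal.ofReal_lt_ofReal_iff hδ).2 (half_lt_self hδ))

/-- A diastasis neighbourhood has an atlas of cells adapted to a given cover by charts. -/
theorem KahlerForm.IsDiastasisNhd.exists_isCellAtlas [FiniteDimensional ℂ E]
    [IsManifold 𝓘(ℂ, E) ω M] [CompactSpace M] [T2Space M] {κ : KahlerForm E M}
    (h : κ.IsDiastasisNhd V D) (𝒦 : ChartCover E M) :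
    ∃ (S : Finset (DiastasisCell E V D)) (b : ℝ), IsCellAtlas S b ∧
      (∀ s ∈ S, ∃ A : ℝ, 0 < A ∧ s.IsBounded 𝒦 A) ∧
      ∀ c ∈ 𝒦.centers, ∀ p ∈ 𝒦.K c, ∃ s ∈ S, s.center = c ∧ p ∈ s.region (1 / 4) := by
  obtain ⟨S, hA, hK⟩ := h.exists_finset_cell 𝒦
  have hcov : ∀ p, ∃ s ∈ S, p ∈ s.region (1 / 4) := fun p => by
    obtain ⟨c, hc, hp⟩ := 𝒦.covers p
    obtain ⟨s, hs, -, hps⟩ := hK c hc p hp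
    exact ⟨s, hs, hps⟩
  obtain ⟨b, hb, hclose⟩ := h.exists_isClose S hcov
  exact ⟨S, b, ⟨hcov, hb, hclose⟩, hA, hK⟩

end CalabiLegendre

end

/-! ### The theorem -/

open CalabiLegendre in
theorem theorem5p1 {E : Type*} [NormedAddCommGroup E] [NormedSpace ℂ E] [FiniteDimensional ℂ E]
    {M : Type*} [TopologicalSpace M] [ChartedSpace E M] [IsManifold 𝓘(ℂ, E) ω M]
    [CompactSpace M] [T2Space M] (κ : KahlerForm E M) :
    (∃ (V : Set (M × M)) (D : M × M → ℝ), κ.IsDiastasisNhd V D) ∧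
    ∀ (V : Set (M × M)) (D : M × M → ℝ), κ.IsDiastasisNhd V D → ∀ 𝒦 : ChartCover E M,
      ∃ ε : ℝ, 0 < ε ∧
        (∀ η : M → ℝ, ContMDiff 𝓘(ℝ, E) 𝓘(ℝ, ℝ) 2 η → 𝒦.cNorm 2 η < ENNReal.ofReal ε →
          ∃ G : M ≃ M,
            (∀ q : M, IsUniqueMaximizer V D (toE η) q (G q)) ∧
            (∀ q : M, legendre V D (toE η) q = ((-D (G q, q) - η (G q) : ℝ) : EReal)) ∧
            (∀ k : ℕ, 2 ≤ k → ContMDiff 𝓘(ℝ, E) 𝓘(ℝ, ℝ) k η →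
              (∃ Φ : Diffeomorph 𝓘(ℝ, E) 𝓘(ℝ, E) M M ((k - 1 : ℕ) : WithTop ℕ∞),
                Φ.toEquiv = G) ∧
              ContMDiff 𝓘(ℝ, E) 𝓘(ℝ, ℝ) k (legendreReal V D η)) ∧
            legendre V D (legendre V D (toE η)) = toE η ∧
            (∀ q : M, IsUniqueMaximizer V D (legendre V D (toE η)) q (G.symm q))) ∧
        (∀ k : ℕ, 2 ≤ k → ∀ η : M → ℝ, ContMDiff 𝓘(ℝ, E) 𝓘(ℝ, ℝ) k η →
          𝒦.cNorm 2 η < ENNReal.ofReal ε → ∀ δ : ℝ, 0 < δ → ∃ δ' : ℝ, 0 < δ' ∧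
            ∀ η' : M → ℝ, ContMDiff 𝓘(ℝ, E) 𝓘(ℝ, ℝ) k η' → 𝒦.cNorm 2 η' < ENNReal.ofReal ε →
              𝒦.cNorm k (η' - η) < ENNReal.ofReal δ' →
              𝒦.cNorm k (legendreReal V D η' - legendreReal V D η) < ENNReal.ofReal δ) := by
  refine ⟨exists_isDiastasisNhd κ, fun V D h 𝒦 => ?_⟩
  have := isManifold_real (E := E) (M := M)
  obtain ⟨S, b, hS, hA, hK⟩ := h.exists_isCellAtlas 𝒦
  -- The atlas is fixed before `η` and `k`, and smallness involves two derivatives only, so one `ε`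
  -- serves every `k`.
  obtain ⟨ε, hε, hsmall⟩ := hS.exists_isSmall hA
  refine ⟨ε, hε, fun η hη hlt => hS.exists_transform (hsmall η hη hlt),
    fun k hk η hη hlt δ hδ => ?_⟩
  have hk2 : (2 : WithTop ℕ∞) ≤ k := by exact_mod_cast hk
  obtain ⟨δ', hδ', hcont⟩ := hS.exists_cNorm_lt hK hk (hsmall η (hη.of_le hk2) hlt) hη hδ
  exact ⟨δ', hδ', fun η' hη' hlt' => hcont η' (hsmall η' (hη'.of_le hk2) hlt') hη'⟩
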